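/- **Setting.** Let $n\ge 1$, let $\Omega\subset\mathbb R^n$ be a non-empty bounded open set of class $C^{1,1}$, and put $\delta(x)=\operatorname{dist}(x,\partial\Omega)$. Let $s\in(0,1)$ with $n\neq 2s$, and $\gamma\in(0,1]$. Let $\mathcal L$ be a non-negative linear operator in $L^2(\Omega)$ with Green's function $\mathcal G_0$: writing $\mathbb G_0(f)(x)=\int_\Omega \mathcal G_0(x,y)f(y)\,dy$, for $u,f\in L^2(\Omega)$ one has $u\in\operatorname{dom}\mathcal L$ and $\mathcal Lu=f$ if and only if $u=\mathbb G_0(f)$. Assume (K1): $\mathcal G_0$ is measurable, positive and symmetric off the diagonal of $\Omega\times\Omega$, and for some constant $C_0>0$, up to the factors $C_0^{\pm1}$, $$\mathcal G_0(x,y)\asymp \frac{1}{|x-y|^{n-2s}}\Big(\frac{\delta^\gamma(x)}{|x-y|^\gamma}\wedge 1\Big)\Big(\frac{\delta^\gamma(y)}{|x-y|^\gamma}\wedge 1\Big),\qquad x\ne y .$$ Then $L^2(\Omega)$ has an orthonormal basis $(\varphi_j)_{j\ge1}$ of eigenfunctions of $\mathcal L$, with eigenvalues $0<\lambda_1\le\lambda_2\le\dots\nearrow+\infty$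 repeated according to multiplicity. Put $\Sigma=\{\lambda_j\}$. For $\lambda\in\mathbb R\setminus\Sigma$ let $\bar\lambda=\lambda_{I+1}$, where $I=\min\{j:\lambda_j\ge\lambda,\ \lambda_{j+1}>\lambda_j\}$, let $d_\Sigma(\lambda)=\min_j|\lambda_j-\lambda|$, and for $f\in L^2(\Omega)$ let $$\mathbb G_\lambda(f)=\sum_{j\ge1}\frac{\langle f,\varphi_j\rangle}{\lambda_j-\lambda}\,\varphi_j\quad\text{(convergent in }L^2(\Omega)).$$ Here $L^1(\Omega;w)$ has norm $\|fw\|_{L^1(\Omega)}$, $wL^\infty(\Omega)$ has norm $\|f/w\|_{L^\infty(\Omega)}$, and $\mathbb H^2_{\mathcal L}(\Omega)=\{v\in L^2(\Omega):\sum_j\lambda_j^2\langle v,\varphi_j\rangle^2<\infty\}$ has norm $(\sum_j\lambda_j^2\langle v,\varphi_j\rangle^2)^{1/2}$. **Theorem (the solution operator $\mathbb G_\lambda$).** Let $\lambda\in\mathbb R\setminus\Sigma$. (1) $\mathbb G_\lambda$ has a unique extension from $L^2(\Omega)$ to a continuous linear operator on $L^1(\Omega;\delta^\gamma)$. For $f\in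 L^1(\Omega;\delta^\gamma)$, $u=\mathbb G_\lambda(f)$ is the unique $u\in L^1(\Omega;\delta^\gamma)$ with $\int_\Omega u\psi=\int_\Omega f\,\mathbb G_\lambda(\psi)$ for all $\psi\in\delta^\gamma L^\infty(\Omega)$ (both integrands being integrable). All the spaces on the left below are contained in $L^1(\Omega;\delta^\gamma)$, and $\mathbb G_\lambda$ maps continuously $$\begin{aligned} L^1(\Omega;\mathbb G_0(\delta^\alpha))&\to L^1(\Omega;\delta^\alpha), && \alpha>-1-\gamma,\\ L^1(\Omega)&\to L^p(\Omega), && p\in[1,\tfrac n{n-2s}),\\ L^2(\Omega)&\to\mathbb H^2_{\mathcal L}(\Omega),\\ L^{p_0}(\Omega)&\to L^{p_1}(\Omega), && p_0\in(1,\tfrac n{2s}),\ \tfrac1{p_1}=\tfrac1{p_0}-\tfrac{2s}n,\\ L^q(\Omega)&\to L^\infty(\Omega), && q\in(\tfrac n{2s},+\infty),\\ \delta^\alpha L^\infty(\Omega)&\to\mathbb G_0(\delta^\alpha)L^\infty(\Omega), && \alpha>-1-\gamma . \end{aligned}$$ For fixed $\Omega,\mathcal L,s,\gamma$ the operator norms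 are bounded by constants depending only on $\bar\lambda$, $d_\Sigma(\lambda)$ and, where appropriate, on $\alpha$, $p$, $p_0$ or $q$. (2) $\mathbb G_\lambda$ maps continuously $$\begin{aligned} L^1(\Omega;\delta^\gamma)&\to L^p_{\rm loc}(\Omega), && p\in(1,\tfrac n{n-2s}),\\ L^1(\Omega;\delta^\gamma)\cap L^{p_0}_{\rm loc}(\Omega)&\to L^{p_1}_{\rm loc}(\Omega), && p_0\in(1,\tfrac n{2s}),\ \tfrac1{p_1}=\tfrac1{p_0}-\tfrac{2s}n,\\ L^1(\Omega;\delta^\gamma)\cap L^q_{\rm loc}(\Omega)&\to L^\infty_{\rm loc}(\Omega), && q\in(\tfrac n{2s},+\infty), \end{aligned}$$ in the following sense: for $K\Subset K_0\Subset\Omega$ and $u=\mathbb G_\lambda(f)$, with $f$ in the respective space, $$\|u\|_{L^p(K)}\le C\|f\delta^\gamma\|_{L^1(\Omega)},\quad \|u\|_{L^{p_1}(K)}\le C\big(\|f\|_{L^{p_0}(K_0)}+\|f\delta^\gamma\|_{L^1(\Omega)}\big),\quad \|u\|_{L^\infty(K)}\le C\big(\|f\|_{L^q(K_0)}+\|f\delta^\gamma\|_{L^1(\Omega)}\big),$$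 where $C$ depends only on $\bar\lambda,d_\Sigma(\lambda)$, the exponent, $K$ and (in the last two) $K_0$. Furthermore, for $f\in L^1(\Omega;\delta^\gamma)\cap L^\infty_{\rm loc}(\Omega)$, $$\|u\|_{L^\infty(K)}\le C(\bar\lambda,d_\Sigma(\lambda),K,K_0)\big(\|f\|_{L^\infty(K_0)}+\|f\delta^\gamma\|_{L^1(\Omega)}\big).$$ -/

import Mathlib

open MeasureTheory Filter Topology
open scoped ENNReal NNReal

noncomputable section

/-- The ambient Euclidean space `ℝⁿ`. -/
abbrev Eu (n : ℕ) : Type := EuclideanSpace ℝ (Fin n)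

/-- `Ω` is of class `C^{1,1}`: near every boundary point, after a choice of a unit vector `ν` as
the vertical direction, `Ω` is the strict epigraph of a function of the horizontal variables
(`g` does not change in the direction `ν`) which is `C¹` with Lipschitz derivative. -/
def IsC11Domain {n : ℕ} (Ω : Set (Eu n)) : Prop :=
  IsOpen Ω ∧
    ∀ x₀ ∈ frontier Ω, ∃ r : ℝ, 0 < r ∧ ∃ ν : Eu n, ‖ν‖ = 1 ∧ ∃ g : Eu n → ℝ,
      ContDiff ℝ 1 g ∧ (∃ K : ℝ≥0, LipschitzWith K (fderiv ℝ g)) ∧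
      (∀ (x : Eu n) (t : ℝ), g (x + t • ν) = g x) ∧
      Ω ∩ Metric.ball x₀ r = {x | g x < inner ℝ ν x} ∩ Metric.ball x₀ r

/-- `δ(x) = dist(x, ∂Ω)`. -/
def bdryDist {n : ℕ} (Ω : Set (Eu n)) (x : Eu n) : ℝ := Metric.infDist x (frontier Ω)

/-- The weighted measure `w dx` on `Ω`; the space `L¹(Ω; w)` is `L¹` of this measure. -/
def wMeasure {n : ℕ} (Ω : Set (Eu n)) (w : Eu n → ℝ) : Measure (Eu n) :=
  (volume.restrict Ω).withDensity (fun x => ENNReal.ofReal (w x))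

/-- The real Hilbert space `L²(Ω)`. -/
abbrev L2Space {n : ℕ} (Ω : Set (Eu n)) : Type := Lp ℝ 2 (volume.restrict Ω)

/-- The Banach space `L¹(Ω; δ^γ)`. -/
abbrev L1Space {n : ℕ} (Ω : Set (Eu n)) (γ : ℝ) : Type :=
  Lp ℝ 1 (wMeasure Ω (fun x => bdryDist Ω x ^ γ))

/-- The Green operator `𝔾₀(f)(x) = ∫_Ω 𝒢₀(x, y) f(y) dy`. -/
def greenOp {n : ℕ} (Ω : Set (Eu n)) (G : Eu n → Eu n → ℝ) (f : Eu n → ℝ) (x : Eu n) : ℝ :=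
  ∫ y in Ω, G x y * f y

/-- The model kernel
`|x-y|^{-(n-2s)} (δ(x)^γ / |x-y|^γ ∧ 1) (δ(y)^γ / |x-y|^γ ∧ 1)`. -/
def modelKernel {n : ℕ} (Ω : Set (Eu n)) (s γ : ℝ) (x y : Eu n) : ℝ :=
  1 / dist x y ^ ((n : ℝ) - 2 * s) *
    min (bdryDist Ω x ^ γ / dist x y ^ γ) 1 * min (bdryDist Ω y ^ γ / dist x y ^ γ) 1

/-- The kernel hypotheses on the Green function: measurable, and off the diagonal of `Ω × Ω`
positive, symmetric and comparable to the model kernel. -/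
structure GreenKernelBounds {n : ℕ} (Ω : Set (Eu n)) (s γ : ℝ) (G : Eu n → Eu n → ℝ) : Prop where
  meas : Measurable (Function.uncurry G)
  pos : ∀ x ∈ Ω, ∀ y ∈ Ω, x ≠ y → 0 < G x y
  symm : ∀ x ∈ Ω, ∀ y ∈ Ω, x ≠ y → G x y = G y x
  comparable : ∃ C : ℝ, 0 < C ∧ ∀ x ∈ Ω, ∀ y ∈ Ω, x ≠ y →
    C⁻¹ * modelKernel Ω s γ x y ≤ G x y ∧ G x y ≤ C * modelKernel Ω s γ x y

/-- `G` is the Green function of the (unbounded) operator `ℒ` in `L²(Ω)`: for `u, f ∈ L²(Ω)`,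
`u ∈ dom ℒ` and `ℒ u = f` if and only if `u = 𝔾₀(f)`. -/
def IsGreenFunction {n : ℕ} (Ω : Set (Eu n)) (L : L2Space Ω →ₗ.[ℝ] L2Space Ω)
    (G : Eu n → Eu n → ℝ) : Prop :=
  ∀ u f : L2Space Ω, (u, f) ∈ L.graph ↔ (u : Eu n → ℝ) =ᵐ[volume.restrict Ω] greenOp Ω G f

/-- `ℒ` is a non-negative operator: `⟨u, ℒ u⟩ ≥ 0` on its domain. -/
def IsNonnegOp {n : ℕ} {Ω : Set (Eu n)} (L : L2Space Ω →ₗ.[ℝ] L2Space Ω) : Prop :=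
  ∀ u : L.domain, 0 ≤ inner ℝ (u : L2Space Ω) (L u)

/-- `(φ_j)` is an orthonormal basis of `L²(Ω)` made of eigenfunctions of `ℒ`, with positive,
non-decreasing, divergent eigenvalues `(lam j)`, repeated according to multiplicity
(indices start at `0`). -/
structure IsEigenbasis {n : ℕ} {Ω : Set (Eu n)} (L : L2Space Ω →ₗ.[ℝ] L2Space Ω)
    (lam : ℕ → ℝ) (φ : HilbertBasis ℕ ℝ (L2Space Ω)) : Prop where
  pos : ∀ j, 0 < lam j
  mono : Monotone lam
  diverges : Tendsto lam atTop atTop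
  eigen : ∀ j, (φ j, lam j • φ j) ∈ L.graph

/-- The spectral solution operator on `L²(Ω)`:
`𝔾_z(f) = ∑_j ⟨f, φ_j⟩ / (λ_j - z) φ_j`. -/
def spectralSol {n : ℕ} {Ω : Set (Eu n)} (lam : ℕ → ℝ) (φ : HilbertBasis ℕ ℝ (L2Space Ω))
    (z : ℝ) (f : L2Space Ω) : L2Space Ω :=
  ∑' j, (inner ℝ f (φ j) / (lam j - z)) • φ j

/-- `z̄ = λ_{I+1}`, where `I = min {j : λ_j ≥ z and λ_{j+1} > λ_j}`. -/
def nextEigenvalue (lam : ℕ → ℝ) (z : ℝ) : ℝ :=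
  lam (sInf {j : ℕ | z ≤ lam j ∧ lam j < lam (j + 1)} + 1)

/-- `d_Σ(z) = min_j |λ_j - z|`. -/
def spectralDist (lam : ℕ → ℝ) (z : ℝ) : ℝ := ⨅ j, |lam j - z|

/-- `T` is a continuous linear operator on `L¹(Ω; δ^γ)` which agrees with the spectral solution
operator on `L²(Ω)`. -/
def IsSolutionOperator {n : ℕ} {Ω : Set (Eu n)} {γ : ℝ} (lam : ℕ → ℝ)
    (φ : HilbertBasis ℕ ℝ (L2Space Ω)) (z : ℝ) (T : L1Space Ω γ →L[ℝ] L1Space Ω γ) : Prop :=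
  ∀ (f : L2Space Ω) (g : L1Space Ω γ),
    (g : Eu n → ℝ) =ᵐ[volume.restrict Ω] f →
      (T g : Eu n → ℝ) =ᵐ[volume.restrict Ω] spectralSol lam φ z f

/-- The norm of `w L^∞(Ω)`: `‖f / w‖_{L^∞(Ω)}`. -/
def wSupNorm {n : ℕ} (Ω : Set (Eu n)) (w f : Eu n → ℝ) : ℝ≥0∞ :=
  eLpNorm (fun x => f x / w x) ∞ (volume.restrict Ω)

/-- `u` is a weak-dual solution of `ℒ u - z u = f` with zero boundary data:
`∫ u ψ = ∫ f 𝔾_z(ψ)` for all `ψ ∈ δ^γ L^∞(Ω)` (a subspace of `L²(Ω)`). -/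
def IsWeakDualSolution {n : ℕ} {Ω : Set (Eu n)} {γ : ℝ} (lam : ℕ → ℝ)
    (φ : HilbertBasis ℕ ℝ (L2Space Ω)) (z : ℝ) (f u : L1Space Ω γ) : Prop :=
  ∀ ψ : L2Space Ω, wSupNorm Ω (fun x => bdryDist Ω x ^ γ) ψ < ∞ →
    IntegrableOn (fun x => u x * ψ x) Ω ∧
    IntegrableOn (fun x => f x * spectralSol lam φ z ψ x) Ω ∧
    ∫ x in Ω, u x * ψ x = ∫ x in Ω, f x * spectralSol lam φ z ψ x

open Classical in
/-- The norm of `ℍ²_ℒ(Ω)`: `(∑_j λ_j² ⟨u, φ_j⟩²)^{1/2}` if `u ∈ L²(Ω)`, and `∞` otherwise.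
The space consists of the functions where it is finite. -/
def H2Norm {n : ℕ} {Ω : Set (Eu n)} (lam : ℕ → ℝ) (φ : HilbertBasis ℕ ℝ (L2Space Ω))
    (u : Eu n → ℝ) : ℝ≥0∞ :=
  if MemLp u 2 (volume.restrict Ω) then
    (∑' j, ENNReal.ofReal (lam j ^ 2 * (∫ x in Ω, u x * φ j x) ^ 2)) ^ (1 / 2 : ℝ)
  else ∞

/-- Let `X`, `Y` be the spaces of measurable functions on `Ω` where the extended norms `NX`, `NY`
are finite. Then `X ⊆ L¹(Ω; δ^γ)`, and `T` maps `X` to `Y` with operator norm at most `C`. -/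
def MapsBoundedly {n : ℕ} {Ω : Set (Eu n)} {γ : ℝ} (T : L1Space Ω γ →L[ℝ] L1Space Ω γ)
    (NX NY : (Eu n → ℝ) → ℝ≥0∞) (C : ℝ≥0) : Prop :=
  ∀ f : Eu n → ℝ, AEStronglyMeasurable f (volume.restrict Ω) → NX f < ∞ →
    ∃ hf : MemLp f 1 (wMeasure Ω (fun x => bdryDist Ω x ^ γ)), NY (T (hf.toLp f)) ≤ C * NX f

/-- For all `z` outside the spectrum, the solution operator `𝔾_z` on `L¹(Ω; δ^γ)` maps `X` to `Y`
continuously, with operator norm bounded by a constant that depends on `z` only through `z̄`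
and `d_Σ(z)`. -/
def SolMapsBoundedly {n : ℕ} {Ω : Set (Eu n)} (γ : ℝ) (lam : ℕ → ℝ)
    (φ : HilbertBasis ℕ ℝ (L2Space Ω)) (NX NY : (Eu n → ℝ) → ℝ≥0∞) : Prop :=
  ∃ C : ℝ → ℝ → ℝ≥0, ∀ z : ℝ, z ∉ Set.range lam → ∀ T : L1Space Ω γ →L[ℝ] L1Space Ω γ,
    IsSolutionOperator lam φ z T →
      MapsBoundedly T NX NY (C (nextEigenvalue lam z) (spectralDist lam z))

/-- The norm of `L^p(A)`. -/
def LpNormOn {n : ℕ} (p : ℝ≥0∞) (A : Set (Eu n)) (f : Eu n → ℝ) : ℝ≥0∞ :=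
  eLpNorm f p (volume.restrict A)

/-- The norm of `L¹(Ω; w)`. -/
def wL1Norm {n : ℕ} (Ω : Set (Eu n)) (w f : Eu n → ℝ) : ℝ≥0∞ := eLpNorm f 1 (wMeasure Ω w)

/-- `f ∈ L^p_loc(Ω)`. -/
def IsLpLoc {n : ℕ} (Ω : Set (Eu n)) (p : ℝ≥0∞) (f : Eu n → ℝ) : Prop :=
  ∀ K : Set (Eu n), IsCompact K → K ⊆ Ω → MemLp f p (volume.restrict K)

/-- `A ⋐ B`. -/
def CompactlyIn {n : ℕ} (A B : Set (Eu n)) : Prop :=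
  IsCompact (closure A) ∧ closure A ⊆ interior B

/-- `𝔾_z` maps `L¹(Ω; δ^γ) ∩ L^p_loc(Ω)` to `L^q_loc(Ω)` continuously: for all `K ⋐ K₀ ⋐ Ω`,
`‖𝔾_z f‖_{L^q(K)} ≤ C (‖f‖_{L^p(K₀)} + ‖f δ^γ‖_{L¹(Ω)})`, where `C` depends on `z` only through
`z̄` and `d_Σ(z)`. -/
def SolMapsLocally {n : ℕ} {Ω : Set (Eu n)} (γ : ℝ) (lam : ℕ → ℝ)
    (φ : HilbertBasis ℕ ℝ (L2Space Ω)) (p q : ℝ≥0∞) : Prop :=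
  ∀ K K₀ : Set (Eu n), CompactlyIn K K₀ → CompactlyIn K₀ Ω →
    ∃ C : ℝ → ℝ → ℝ≥0, ∀ z : ℝ, z ∉ Set.range lam → ∀ T : L1Space Ω γ →L[ℝ] L1Space Ω γ,
      IsSolutionOperator lam φ z T → ∀ f : L1Space Ω γ, IsLpLoc Ω p f →
        IsLpLoc Ω q (T f) ∧
        LpNormOn q K (T f) ≤ C (nextEigenvalue lam z) (spectralDist lam z) *
          (LpNormOn p K₀ f + wL1Norm Ω (fun x => bdryDist Ω x ^ γ) f)

end

open MeasureTheory Filter Topology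
open scoped ENNReal NNReal

noncomputable section

/-! Everything rests on one pointwise estimate: off the spectrum, |𝔾_z f| ≤ A · 𝔾₀|f| almost
everywhere, with A depending on z only through z̄ and d = d_Σ(z) (`exists_enorm_spectralSol_le`). It
reduces nearly all mapping properties of 𝔾_z to those of the positive kernel 𝒢₀.

Write T for 𝔾₀ and R for 𝔾_z on L². Iterating R = T + zTR, and using that T and R commute, R =
∑_{k<2N} z^k T^{k+1} + z^{2N} T^N R T^N. The sum is dominated by T because the 3G inequality gives
T² ≤ MT on non-negative functions (`eGreen_eGreen_le`). For large N, T^N maps L² to δ^γ L^∞: its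
first factors raise the order of the Riesz kernel until it is bounded, the later ones build up the
boundary decay (`exists_iterate_eGreen_le`). By symmetry T^N also maps L¹(Ω; δ^γ) to L². Since ‖R‖ ≤
1/d on L², the remainder is at most a multiple of δ^γ(x) ∫ δ^γ |f|, and this is at most a multiple
of 𝔾₀|f|(x) by the lower kernel bound (`le_eGreen`). The powers of z are controlled by |z| ≤ z̄ + d.

From 𝔾₀(δ^γ) ≤ M δ^γ and symmetry, 𝔾₀ is bounded on L¹(Ω; δ^γ). By domination so is R, which extends
by density of L²; the domination and the weak-dual identity pass to the limit, and uniqueness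
follows by testing with δ^γ sign(u - v). The Lebesgue bounds use 𝒢₀ ≤ C |x-y|^{2s-n} with Jensen,
Hölder or Hardy–Littlewood–Sobolev (`hls_normalized`). The weighted bounds use duality and
monotonicity, and need ∫ δ^{γ+α} < ∞, which is where the regularity of the boundary enters. The
local bounds come from δ^γ(x) 𝒢₀(x,y) ≤ 2C |x-y|^{2s-n} δ^γ(y). The ℍ² bound is read off the
coefficients.

Two facts come before this. If n < 2s the kernel would vanish at the diagonal and stay positive away
from it, which contradicts non-negativity of ℒ (`exists_inner_greenOp_neg`); hence 2s < n. And a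
power T^{2^j} maps L² to L^∞ on a finite measure space, so it is Hilbert–Schmidt; this forces T to
be compact and yields the eigenbasis (`isCompactOperator_of_pow_hilbertSchmidt`,
`exists_eigenbasis`). -/

/-! ### The Hardy–Littlewood–Sobolev inequality and Jensen's inequality. -/

lemma lintegral_Ioo_rpow {m : ℝ} (hm : 0 < m) {A : ℝ} (hA : 0 ≤ A) :
    ∫⁻ t in Set.Ioo 0 A, ENNReal.ofReal (t ^ (m - 1)) = ENNReal.ofReal (A ^ m / m) := by
  have hint : IntervalIntegrable (fun t : ℝ => t ^ (m - 1)) volume 0 A :=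
    intervalIntegral.intervalIntegrable_rpow' (by linarith)
  rw [intervalIntegrable_iff_integrableOn_Ioo_of_le hA] at hint
  rw [← ofReal_integral_eq_lintegral_ofReal hint]
  · rw [← integral_Ioc_eq_integral_Ioo, ← intervalIntegral.integral_of_le hA,
      integral_rpow (Or.inl (by linarith))]
    rw [Real.zero_rpow (by linarith)]
    simp
  · filter_upwards [ae_restrict_mem measurableSet_Ioo] with t ht
    exact Real.rpow_nonneg ht.1.le _

lemma lintegral_Ioi_rpow_eq_top {m : ℝ} (hm : 0 < m) :
    ∫⁻ t in Set.Ioi (0 : ℝ), ENNReal.ofReal (t ^ (m - 1)) = ∞ := by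
  refine ENNReal.eq_top_of_forall_nnreal_le fun r => ?_
  have hA : (0 : ℝ) ≤ ((r : ℝ) * m) ^ (1 / m) := by positivity
  calc (r : ℝ≥0∞) = ENNReal.ofReal ((((r : ℝ) * m) ^ (1 / m)) ^ m / m) := by
        rw [← Real.rpow_mul (by positivity), one_div_mul_cancel hm.ne', Real.rpow_one,
          mul_div_cancel_right₀ _ hm.ne', ENNReal.ofReal_coe_nnreal]
    _ = _ := (lintegral_Ioo_rpow hm hA).symm
    _ ≤ _ := lintegral_mono_set Set.Ioo_subset_Ioi_self

/-- Layer-cake formula for a single value, with the constraint on t as an indicator so that Tonelli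
applies once F depends on a point. The value F = ∞ is allowed. -/
lemma rpow_le_lintegral_indicator {q : ℝ} (hq : 0 < q) (F : ℝ≥0∞) :
    F ^ q ≤ ∫⁻ t in Set.Ioi (0 : ℝ), {t : ℝ | ENNReal.ofReal t < F}.indicator
      (fun t => ENNReal.ofReal q * ENNReal.ofReal (t ^ (q - 1))) t := by
  have hms : MeasurableSet {t : ℝ | ENNReal.ofReal t < F} :=
    measurableSet_lt ENNReal.measurable_ofReal measurable_const
  rw [setLIntegral_indicator hms, lintegral_const_mul _ (by fun_prop)]
  rcases eq_or_ne F ∞ with rfl | hF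
  · have : {t : ℝ | ENNReal.ofReal t < ∞} ∩ Set.Ioi 0 = Set.Ioi 0 := by
      ext t; simp
    rw [this, lintegral_Ioi_rpow_eq_top hq, ENNReal.mul_top (by simpa using hq)]
    exact le_top
  · lift F to ℝ≥0 using hF
    have hsub : Set.Ioo 0 (F : ℝ) ⊆ {t : ℝ | ENNReal.ofReal t < F} ∩ Set.Ioi 0 := by
      intro t ht
      refine ⟨?_, ht.1⟩
      change ENNReal.ofReal t < F
      rw [← ENNReal.ofReal_coe_nnreal]
      exact (ENNReal.ofReal_lt_ofReal_iff (ht.1.trans ht.2)).2 ht.2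
    calc (F : ℝ≥0∞) ^ q = ENNReal.ofReal q * ENNReal.ofReal ((F : ℝ) ^ q / q) := by
          rw [← ENNReal.ofReal_mul hq.le, mul_div_cancel₀ _ hq.ne',
            ← ENNReal.ofReal_rpow_of_nonneg F.coe_nonneg hq.le, ENNReal.ofReal_coe_nnreal]
      _ = ENNReal.ofReal q * ∫⁻ t in Set.Ioo 0 (F : ℝ), ENNReal.ofReal (t ^ (q - 1)) := by
          rw [lintegral_Ioo_rpow hq F.coe_nonneg]
      _ ≤ _ := mul_le_mul_right (lintegral_mono_set hsub) _

/-- The converse direction of the layer cake: the constraint says t < (F/c)^{1/l}, and t^{m-1} is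
integrated up to there. -/
lemma lintegral_indicator_le_rpow {m l c : ℝ} (hm : 0 < m) (hl : 0 < l) (hc : 0 < c)
    (F : ℝ≥0∞) :
    ∫⁻ t in Set.Ioi (0 : ℝ), {t : ℝ | ENNReal.ofReal (c * t ^ l) < F}.indicator
      (fun t => ENNReal.ofReal (t ^ (m - 1))) t ≤
      ENNReal.ofReal (c⁻¹ ^ (m / l) / m) * F ^ (m / l) := by
  have hml : 0 < m / l := by positivity
  have hms : MeasurableSet {t : ℝ | ENNReal.ofReal (c * t ^ l) < F} :=
    measurableSet_lt (by fun_prop) measurable_const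
  rcases eq_or_ne F ∞ with rfl | hF
  · rw [ENNReal.top_rpow_of_pos hml, ENNReal.mul_top]
    · exact le_top
    · have : 0 < c⁻¹ ^ (m / l) / m := by positivity
      simpa using this
  · lift F to ℝ≥0 using hF
    rw [setLIntegral_indicator hms]
    have hsub : {t : ℝ | ENNReal.ofReal (c * t ^ l) < F} ∩ Set.Ioi 0 ⊆
        Set.Ioo 0 ((c⁻¹ * F) ^ (1 / l)) := by
      rintro t ⟨ht, ht0⟩
      have ht0' : 0 < t := ht0
      refine ⟨ht0, ?_⟩
      have h1 : ENNReal.ofReal (c * t ^ l) < F := ht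
      rw [← ENNReal.ofReal_coe_nnreal, ENNReal.ofReal_lt_ofReal_iff_of_nonneg (by positivity)] at h1
      have h2 : t ^ l < c⁻¹ * F := by
        rw [inv_mul_eq_div, lt_div_iff₀ hc]; linarith
      calc t = (t ^ l) ^ (1 / l) := by
            rw [← Real.rpow_mul ht0'.le, mul_one_div_cancel hl.ne', Real.rpow_one]
        _ < _ := Real.rpow_lt_rpow (by positivity) h2 (by positivity)
    refine (lintegral_mono_set hsub).trans ?_
    rw [lintegral_Ioo_rpow hm (by positivity), ← Real.rpow_mul (by positivity),
      Real.mul_rpow (by positivity) (by positivity), one_div_mul_eq_div]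
    rw [← ENNReal.ofReal_coe_nnreal, ENNReal.ofReal_rpow_of_nonneg F.coe_nonneg hml.le,
      ← ENNReal.ofReal_mul (by positivity)]
    apply le_of_eq
    congr 1
    ring

lemma lintegral_comp_scale {n : ℕ} {g : Eu n → ℝ≥0∞} (hg : Measurable g) (x : Eu n) {R : ℝ}
    (hR : 0 < R) :
    ∫⁻ y, g (R⁻¹ • (y - x)) = ENNReal.ofReal (R ^ (n : ℝ)) * ∫⁻ z, g z := by
  have h1 : ∫⁻ y, g (R⁻¹ • (y - x)) = ∫⁻ y, g (R⁻¹ • y) :=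
    lintegral_sub_right_eq_self (fun y => g (R⁻¹ • y)) x
  have h2 := Measure.map_addHaar_smul (volume : Measure (Eu n)) (inv_ne_zero hR.ne')
  rw [h1, ← lintegral_map (f := g) hg (measurable_const_smul R⁻¹), h2, lintegral_smul_measure]
  congr 1
  rw [finrank_euclideanSpace_fin, inv_pow, inv_inv, abs_of_nonneg (by positivity),
    Real.rpow_natCast]

/-- Scaling of the Riesz kernel under dilation about x. The set S of normalised radii is kept
general so that S = [0,1) gives balls and S = [1,∞) their complements. -/
lemma lintegral_dist_rpow_scale {n : ℕ} (S : Set ℝ) (hS : MeasurableSet S) (b : ℝ) (x : Eu n)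
    {R : ℝ} (hR : 0 < R) :
    ∫⁻ y in {y | R⁻¹ * dist x y ∈ S}, ENNReal.ofReal (dist x y ^ b) =
      ENNReal.ofReal (R ^ (b + n)) *
        ∫⁻ z in {z : Eu n | ‖z‖ ∈ S}, ENNReal.ofReal (‖z‖ ^ b) := by
  have hS1 : MeasurableSet {y : Eu n | R⁻¹ * dist x y ∈ S} :=
    hS.preimage (by fun_prop)
  have hS2 : MeasurableSet {z : Eu n | ‖z‖ ∈ S} := hS.preimage measurable_norm
  have key := lintegral_comp_scale (g := {z : Eu n | ‖z‖ ∈ S}.indicator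
    fun z => ENNReal.ofReal (‖z‖ ^ b)) (Measurable.indicator (by fun_prop) hS2) x hR
  rw [← lintegral_indicator hS1, ← lintegral_indicator hS2, Real.rpow_add hR,
    ENNReal.ofReal_mul (by positivity), mul_assoc, ← key, ← lintegral_const_mul _]
  · congr 1
    ext y
    have hnorm : ‖R⁻¹ • (y - x)‖ = R⁻¹ * dist x y := by
      rw [norm_smul, Real.norm_of_nonneg (by positivity), dist_comm, dist_eq_norm]
    by_cases h : R⁻¹ * dist x y ∈ S
    · rw [Set.indicator_of_mem (by exact h), Set.indicator_of_mem (by simpa [hnorm] using h), hnorm,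
        ← ENNReal.ofReal_mul (by positivity), ← Real.mul_rpow hR.le (by positivity),
        mul_inv_cancel_left₀ hR.ne']
    · rw [Set.indicator_of_notMem (by exact h), Set.indicator_of_notMem (by simpa [hnorm] using h),
        mul_zero]
  · exact (Measurable.indicator (by fun_prop) hS2).comp (by fun_prop)

lemma lintegral_ball_dist_rpow_le {n : ℕ} (hn : 1 ≤ n) {a : ℝ} (ha : 0 < a) :
    ∃ C : ℝ, 0 < C ∧ ∀ (x : Eu n) (R : ℝ), 0 < R →
      ∫⁻ y in Metric.ball x R, ENNReal.ofReal (dist x y ^ (a - n)) ≤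
        ENNReal.ofReal (C * R ^ a) := by
  have hfin : ∫⁻ z in {z : Eu n | ‖z‖ ∈ Set.Iio (1 : ℝ)},
      ENNReal.ofReal (‖z‖ ^ (a - n)) < ∞ := by
    have h : IntegrableOn (fun z : Eu n => ‖z‖ ^ (a - n)) (Metric.ball 0 1) := by
      refine integrableOn_ball_of_norm_le_rpow (C := 1) (α := n - a) (by simpa using hn) (by simpa using ha) ?_
        (by fun_prop : Measurable fun z : Eu n => ‖z‖ ^ (a - n)).aestronglyMeasurable
      refine Filter.Eventually.of_forall fun z => ?_
      rw [Real.norm_of_nonneg (by positivity), one_mul, neg_sub]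
    have h2 := h.lintegral_lt_top
    have : {z : Eu n | ‖z‖ ∈ Set.Iio (1 : ℝ)} = Metric.ball 0 1 := by ext; simp
    rwa [this]
  set I := ∫⁻ z in {z : Eu n | ‖z‖ ∈ Set.Iio (1 : ℝ)}, ENNReal.ofReal (‖z‖ ^ (a - n)) with hI
  -- The `+ 1` only makes the constant strictly positive.
  refine ⟨I.toReal + 1, by positivity, fun x R hR => ?_⟩
  have h := lintegral_dist_rpow_scale (Set.Iio (1 : ℝ)) measurableSet_Iio (a - n) x hR
  have hset : {y | R⁻¹ * dist x y ∈ Set.Iio (1 : ℝ)} = Metric.ball x R := by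
    ext y
    simp [inv_mul_lt_iff₀ hR, dist_comm]
  rw [hset, ← hI, sub_add_cancel] at h
  rw [h, mul_comm (_ + _), ENNReal.ofReal_mul (by positivity)]
  gcongr
  rw [ENNReal.le_ofReal_iff_toReal_le hfin.ne (by positivity)]
  linarith

lemma lintegral_compl_ball_dist_rpow_le {n : ℕ} {b : ℝ} (hb : (n : ℝ) < b) :
    ∃ C : ℝ, 0 < C ∧ ∀ (x : Eu n) (R : ℝ), 0 < R →
      ∫⁻ y in (Metric.ball x R)ᶜ, ENNReal.ofReal (dist x y ^ (-b)) ≤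
        ENNReal.ofReal (C * R ^ (n - b)) := by
  have hb0 : 0 < b := lt_of_le_of_lt (by positivity) hb
  have hfin : ∫⁻ z in {z : Eu n | ‖z‖ ∈ Set.Ici (1 : ℝ)},
      ENNReal.ofReal (‖z‖ ^ (-b)) < ∞ := by
    have h := finite_integral_one_add_norm (E := Eu n) (μ := volume) (r := b) (by simpa using hb)
    have hle : ∫⁻ z in {z : Eu n | ‖z‖ ∈ Set.Ici (1 : ℝ)}, ENNReal.ofReal (‖z‖ ^ (-b)) ≤
        ∫⁻ z : Eu n, ENNReal.ofReal (2 ^ b) * ENNReal.ofReal ((1 + ‖z‖) ^ (-b)) := by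
      refine (setLIntegral_mono' (measurableSet_Ici.preimage measurable_norm) fun z hz => ?_).trans
        (setLIntegral_le_lintegral _ _)
      -- Here 1 + ‖z‖ ≤ 2‖z‖, which is where the factor 2^b comes from.
      have hz1 : 1 ≤ ‖z‖ := hz
      rw [← ENNReal.ofReal_mul (by positivity)]
      refine ENNReal.ofReal_le_ofReal ?_
      rw [Real.rpow_neg (by positivity), Real.rpow_neg (by positivity), ← div_eq_mul_inv,
        ← Real.div_rpow (by positivity) (by positivity), ← Real.inv_rpow (by positivity)]
      refine Real.rpow_le_rpow (by positivity) ?_ hb0.le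
      rw [inv_eq_one_div, div_le_div_iff₀ (by positivity) (by positivity)]
      linarith
    refine hle.trans_lt ?_
    rw [lintegral_const_mul _ (by fun_prop)]
    exact ENNReal.mul_lt_top ENNReal.ofReal_lt_top h
  set I := ∫⁻ z in {z : Eu n | ‖z‖ ∈ Set.Ici (1 : ℝ)}, ENNReal.ofReal (‖z‖ ^ (-b)) with hI
  refine ⟨I.toReal + 1, by positivity, fun x R hR => ?_⟩
  have h := lintegral_dist_rpow_scale (Set.Ici (1 : ℝ)) measurableSet_Ici (-b) x hR
  have hset : {y | R⁻¹ * dist x y ∈ Set.Ici (1 : ℝ)} = (Metric.ball x R)ᶜ := by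
    ext y
    simp [le_inv_mul_iff₀ hR, dist_comm]
  rw [hset, ← hI, show -b + (n : ℝ) = n - b by ring] at h
  rw [h, mul_comm (_ + _), ENNReal.ofReal_mul (by positivity)]
  gcongr
  rw [ENNReal.le_ofReal_iff_toReal_le hfin.ne (by positivity)]
  linarith


lemma measurable_rieszKernel {n : ℕ} (b : ℝ) :
    Measurable fun z : Eu n × Eu n => ENNReal.ofReal (dist z.1 z.2 ^ b) := by fun_prop

/-- Tonelli: the condition dist x y < R is symmetric, so after the swap only the integral of the
kernel in its first variable matters. -/
lemma lintegral_near_le {n : ℕ} (k : Eu n → Eu n → ℝ≥0∞) (hk : Measurable (Function.uncurry k))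
    {R : ℝ} {A : ℝ≥0∞} (hA : ∀ y, ∫⁻ x in Metric.ball y R, k x y ≤ A) {h : Eu n → ℝ≥0∞}
    (hh : Measurable h) :
    ∫⁻ x, ∫⁻ y in Metric.ball x R, k x y * h y ≤ A * ∫⁻ y, h y := by
  have hS : MeasurableSet {z : Eu n × Eu n | dist z.1 z.2 < R} :=
    measurableSet_lt (by fun_prop) measurable_const
  have hm : Measurable ({z : Eu n × Eu n | dist z.1 z.2 < R}.indicator
      fun z => k z.1 z.2 * h z.2) :=
    (Measurable.mul hk (hh.comp measurable_snd)).indicator hS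
  have e1 : ∀ x, ∫⁻ y in Metric.ball x R, k x y * h y =
      ∫⁻ y, {z : Eu n × Eu n | dist z.1 z.2 < R}.indicator
        (fun z => k z.1 z.2 * h z.2) (x, y) := fun x => by
    rw [← lintegral_indicator measurableSet_ball]
    congr 1
    ext y
    simp [Set.indicator, dist_comm]
  simp_rw [e1]
  have hswap : ∫⁻ x, ∫⁻ y, {z : Eu n × Eu n | dist z.1 z.2 < R}.indicator
      (fun z => k z.1 z.2 * h z.2) (x, y) = ∫⁻ y, ∫⁻ x, {z : Eu n × Eu n | dist z.1 z.2 < R}.indicator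
      (fun z => k z.1 z.2 * h z.2) (x, y) := by
    rw [lintegral_lintegral_swap]
    exact hm.aemeasurable
  rw [hswap, ← lintegral_const_mul _ hh]
  refine lintegral_mono fun y => ?_
  have e2 : ∫⁻ x, {z : Eu n × Eu n | dist z.1 z.2 < R}.indicator
        (fun z => k z.1 z.2 * h z.2) (x, y) = (∫⁻ x in Metric.ball y R, k x y) * h y := by
    rw [← lintegral_mul_const _ (by exact hk.comp (by fun_prop : Measurable fun x => (x, y))),
      ← lintegral_indicator measurableSet_ball]
    congr 1
  rw [e2]
  gcongr
  exact hA y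

/-- A weak-type argument done at all levels t at once. The potential is cut at a radius R(t), and f
at a height c₂ t^l. Hölder bounds the far part and the kernel mass bounds the low near part; the
high near part is left to Chebyshev and an L¹ bound. Integrating the resulting estimate of the
distribution function against q t^{q-1} dt returns ∫ f^p, precisely because l = q/p. -/
lemma hls_normalized {n : ℕ} (hn : 1 ≤ n) {a p q : ℝ} (ha : 0 < a) (hp : 1 < p)
    (hq : 0 < q) (hpq : 1 / q = 1 / p - a / n) :
    ∃ C : ℝ≥0, ∀ f : Eu n → ℝ≥0∞, Measurable f → ∫⁻ x, f x ^ p = 1 →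
      ∫⁻ x, (∫⁻ y, ENNReal.ofReal (dist x y ^ (a - n)) * f y) ^ q ≤ C := by
  have hn0 : (0 : ℝ) < n := by positivity
  obtain ⟨C₁, hC₁, hnear⟩ := lintegral_ball_dist_rpow_le hn ha
  have hconj : (p.conjExponent).HolderConjugate p := (Real.HolderConjugate.conjExponent hp).symm
  set p' := p.conjExponent with hp'
  have hp'0 : 0 < p' := hconj.pos
  have hp'inv : 1 / p' = 1 - 1 / p := by
    have := hconj.inv_add_inv_eq_one
    rw [one_div, one_div]; linarith
  have hqn : n / q = n / p - a := by
    have : (n : ℝ) * (1 / q) = n * (1 / p - a / n) := by rw [hpq]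
    field_simp at this ⊢
    linarith
  -- The p'-th power of the kernel is integrable at infinity exactly because 1/q > 0.
  have hb : (n : ℝ) < (n - a) * p' := by
    have h1 : 0 < n / q := by positivity
    have h2 : (n : ℝ) * (1 / p') < n - a := by
      rw [hp'inv]
      have : (n : ℝ) * (1 - 1 / p) = n - n / p := by ring
      linarith
    rw [mul_one_div, div_lt_iff₀ hp'0] at h2
    exact h2
  obtain ⟨C₂, hC₂, hfar⟩ := lintegral_compl_ball_dist_rpow_le hb
  set C₃ := C₂ ^ (1 / p') with hC₃
  have hC₃0 : 0 < C₃ := by positivity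
  -- Chosen so that the Hölder bound C₃ R(t)^{-n/q} of the far part equals t/2.
  set c₁ := (2 * C₃)⁻¹ with hc₁
  have hc₁0 : 0 < c₁ := by positivity
  set l := q / p with hl
  have hl0 : 0 < l := by positivity
  have hl1 : l = 1 + a * q / n := by
    rw [hl]
    have : q * (1 / q) = q * (1 / p - a / n) := by rw [hpq]
    rw [mul_one_div_cancel hq.ne'] at this
    have e : q * (1 / p - a / n) = q / p - a * q / n := by ring
    linarith
  set m := q - l with hm
  have hm0 : 0 < m := by
    have : l < q := by rw [hl]; exact div_lt_self hq hp
    linarith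
  have hml : m / l = p - 1 := by
    rw [hm, hl]; field_simp
  set e := a * q / n with he
  -- Chosen so that C₁ R(t)^a · c₂ t^l, the bound of the low near part, equals t/4.
  set c₂ := c₁ ^ e / (4 * C₁) with hc₂
  have hc₂0 : 0 < c₂ := by positivity
  set D := 4 * q * C₁ * c₁ ^ (-e) with hD
  have hD0 : 0 < D := by positivity
  let R : ℝ → ℝ := fun t => (c₁ * t) ^ (-q / n)
  have hR0 : ∀ t, 0 < t → 0 < R t := fun t ht => by positivity
  have hRa : ∀ t, 0 < t → R t ^ a = (c₁ * t) ^ (-e) := fun t ht => by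
    simp only [R]
    rw [← Real.rpow_mul (by positivity)]
    congr 1
    rw [he]; ring
  have hk : Measurable (Function.uncurry fun x y : Eu n => ENNReal.ofReal (dist x y ^ (a - n))) :=
    measurable_rieszKernel _
  refine ⟨(D * (c₂⁻¹ ^ (m / l) / m)).toNNReal, fun f hf hfp => ?_⟩
  set F : Eu n → ℝ≥0∞ := fun x => ∫⁻ y, ENNReal.ofReal (dist x y ^ (a - n)) * f y with hF
  have hFm : Measurable F :=
    Measurable.lintegral_prod_right' (f := fun z : Eu n × Eu n =>
      ENNReal.ofReal (dist z.1 z.2 ^ (a - n)) * f z.2) (hk.mul (hf.comp measurable_snd))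
  have hfarF : ∀ t, 0 < t → ∀ x, ∫⁻ y in (Metric.ball x (R t))ᶜ,
      ENNReal.ofReal (dist x y ^ (a - n)) * f y ≤ ENNReal.ofReal (t / 2) := fun t ht x => by
    have hH := ENNReal.lintegral_mul_le_Lp_mul_Lq (volume.restrict (Metric.ball x (R t))ᶜ) hconj
      (f := fun y => ENNReal.ofReal (dist x y ^ (a - n))) (g := f) (by fun_prop) hf.aemeasurable
    refine hH.trans ?_
    have h1 : (∫⁻ y in (Metric.ball x (R t))ᶜ, f y ^ p) ^ (1 / p) ≤ 1 := by
      have : ∫⁻ y in (Metric.ball x (R t))ᶜ, f y ^ p ≤ 1 := by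
        rw [← hfp]; exact setLIntegral_le_lintegral _ _
      exact ENNReal.rpow_le_one this (by positivity)
    have h2 : ∫⁻ y in (Metric.ball x (R t))ᶜ, ENNReal.ofReal (dist x y ^ (a - n)) ^ p' ≤
        ENNReal.ofReal (C₂ * R t ^ (n - (n - a) * p')) := by
      refine le_trans (le_of_eq ?_) (hfar x (R t) (hR0 t ht))
      congr 1
      ext y
      rw [ENNReal.ofReal_rpow_of_nonneg (by positivity) hp'0.le, ← Real.rpow_mul dist_nonneg]
      congr 2
      ring
    calc _ ≤ (ENNReal.ofReal (C₂ * R t ^ (n - (n - a) * p'))) ^ (1 / p') * 1 :=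
          mul_le_mul' (ENNReal.rpow_le_rpow h2 (by positivity)) h1
      _ = ENNReal.ofReal (t / 2) := by
          have hRt := hR0 t ht
          rw [mul_one, ENNReal.ofReal_rpow_of_nonneg (by positivity) (by positivity),
            Real.mul_rpow (by positivity) (by positivity), ← Real.rpow_mul hRt.le]
          congr 1
          have : ((n : ℝ) - (n - a) * p') * (1 / p') = -(n / q) := by
            have : ((n : ℝ) - (n - a) * p') * (1 / p') = n * (1 / p') - (n - a) := by
              field_simp
            rw [this, hp'inv, hqn]; ring
          rw [this]
          simp only [R]
          rw [← Real.rpow_mul (by positivity),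
            show -q / (n : ℝ) * -((n : ℝ) / q) = 1 by field_simp, Real.rpow_one, ← hC₃, hc₁]
          field_simp
  have hlevel : ∀ t, 0 < t → volume {x | ENNReal.ofReal t < F x} ≤
      ENNReal.ofReal (4 / t * (C₁ * R t ^ a)) *
        ∫⁻ y, {y | ENNReal.ofReal (c₂ * t ^ l) < f y}.indicator f y := fun t ht => by
    have hRt := hR0 t ht
    have hsetm : MeasurableSet {y | ENNReal.ofReal (c₂ * t ^ l) < f y} :=
      measurableSet_lt measurable_const hf
    set h := {y | ENNReal.ofReal (c₂ * t ^ l) < f y}.indicator f with hh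
    have hhm : Measurable h := hf.indicator hsetm
    set N : Eu n → ℝ≥0∞ := fun x => ∫⁻ y in Metric.ball x (R t),
      ENNReal.ofReal (dist x y ^ (a - n)) * h y with hN
    -- The far part and the low near part account for at most 3t/4, so where F > t the high near
    -- part N must supply the remaining t/4.
    have hsub : {x | ENNReal.ofReal t < F x} ⊆ {x | ENNReal.ofReal (t / 4) ≤ N x} := by
      intro x hx
      have hx' : ENNReal.ofReal t < F x := hx
      by_contra hcon
      have hcon' : N x < ENNReal.ofReal (t / 4) := not_le.1 hcon
      refine absurd hx' (not_lt.2 ?_)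
      have hsplit : F x = (∫⁻ y in Metric.ball x (R t), ENNReal.ofReal (dist x y ^ (a - n)) * f y) +
          ∫⁻ y in (Metric.ball x (R t))ᶜ, ENNReal.ofReal (dist x y ^ (a - n)) * f y :=
        (lintegral_add_compl _ measurableSet_ball).symm
      have hlow : ∫⁻ y in Metric.ball x (R t), ENNReal.ofReal (dist x y ^ (a - n)) * f y ≤
          ENNReal.ofReal (t / 4) + N x := by
        calc _ ≤ ∫⁻ y in Metric.ball x (R t),
              (ENNReal.ofReal (dist x y ^ (a - n)) * ENNReal.ofReal (c₂ * t ^ l) +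
                ENNReal.ofReal (dist x y ^ (a - n)) * h y) := by
              refine lintegral_mono fun y => ?_
              rw [← mul_add]
              gcongr
              by_cases hy : ENNReal.ofReal (c₂ * t ^ l) < f y
              · rw [hh, Set.indicator_of_mem (by exact hy)]
                exact le_add_self
              · exact (not_lt.1 hy).trans le_self_add
          _ = (∫⁻ y in Metric.ball x (R t), ENNReal.ofReal (dist x y ^ (a - n))) *
                ENNReal.ofReal (c₂ * t ^ l) + N x := by
              rw [lintegral_add_left (by fun_prop), lintegral_mul_const _ (by fun_prop)]
          _ ≤ ENNReal.ofReal (C₁ * R t ^ a) * ENNReal.ofReal (c₂ * t ^ l) + N x := by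
              gcongr
              exact hnear x _ hRt
          _ = _ := by
              rw [← ENNReal.ofReal_mul (by positivity), hRa t ht]
              congr 2
              rw [hc₂, hl1, Real.rpow_add ht, Real.rpow_one,
                Real.mul_rpow hc₁0.le ht.le, Real.rpow_neg hc₁0.le, Real.rpow_neg ht.le]
              have : 0 < c₁ ^ e := by positivity
              have : 0 < t ^ e := by positivity
              field_simp
      rw [hsplit]
      calc _ ≤ (ENNReal.ofReal (t / 4) + ENNReal.ofReal (t / 4)) + ENNReal.ofReal (t / 2) :=
            add_le_add (hlow.trans (add_le_add le_rfl hcon'.le)) (hfarF t ht x)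
        _ = ENNReal.ofReal t := by
            rw [← ENNReal.ofReal_add (by positivity) (by positivity),
              ← ENNReal.ofReal_add (by positivity) (by positivity)]
            congr 1
            ring
    have hNle : ∫⁻ x, N x ≤ ENNReal.ofReal (C₁ * R t ^ a) * ∫⁻ y, h y := by
      refine lintegral_near_le _ hk (fun y => ?_) hhm
      simp_rw [dist_comm _ y]
      exact hnear y _ hRt
    have hNm : Measurable N := by
      have hS : MeasurableSet {z : Eu n × Eu n | dist z.1 z.2 < R t} :=
        measurableSet_lt (by fun_prop) measurable_const
      have hm : Measurable fun x => ∫⁻ y, ({z : Eu n × Eu n | dist z.1 z.2 < R t}.indicator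
          fun z => ENNReal.ofReal (dist z.1 z.2 ^ (a - n)) * h z.2) (x, y) :=
        Measurable.lintegral_prod_right' ((Measurable.mul hk (hhm.comp measurable_snd)).indicator hS)
      convert hm using 2 with x
      rw [hN]
      simp only
      rw [← lintegral_indicator measurableSet_ball]
      congr 1
      ext y
      simp [Set.indicator, dist_comm]
    have hcheb := mul_meas_ge_le_lintegral (μ := volume) hNm (ENNReal.ofReal (t / 4))
    calc volume {x | ENNReal.ofReal t < F x} ≤ volume {x | ENNReal.ofReal (t / 4) ≤ N x} :=
          measure_mono hsub
      _ = ENNReal.ofReal (4 / t) * (ENNReal.ofReal (t / 4) *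
            volume {x | ENNReal.ofReal (t / 4) ≤ N x}) := by
          rw [← mul_assoc, ← ENNReal.ofReal_mul (by positivity),
            show 4 / t * (t / 4) = 1 by field_simp, ENNReal.ofReal_one, one_mul]
      _ ≤ ENNReal.ofReal (4 / t) * (ENNReal.ofReal (C₁ * R t ^ a) * ∫⁻ y, h y) :=
          mul_le_mul' le_rfl (hcheb.trans hNle)
      _ = _ := by
          rw [← mul_assoc, ← ENNReal.ofReal_mul (by positivity)]
  have hset : MeasurableSet {z : Eu n × ℝ | ENNReal.ofReal z.2 < F z.1} :=
    measurableSet_lt (by fun_prop) (hFm.comp measurable_fst)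
  have hset2 : MeasurableSet {z : ℝ × Eu n | ENNReal.ofReal (c₂ * z.1 ^ l) < f z.2} :=
    measurableSet_lt (by fun_prop) (hf.comp measurable_snd)
  calc ∫⁻ x, F x ^ q
      ≤ ∫⁻ x, ∫⁻ t in Set.Ioi (0 : ℝ), {z : Eu n × ℝ | ENNReal.ofReal z.2 < F z.1}.indicator
          (fun z => ENNReal.ofReal q * ENNReal.ofReal (z.2 ^ (q - 1))) (x, t) :=
        lintegral_mono fun x => rpow_le_lintegral_indicator hq (F x)
    _ = ∫⁻ t in Set.Ioi (0 : ℝ), ∫⁻ x, {z : Eu n × ℝ | ENNReal.ofReal z.2 < F z.1}.indicator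
          (fun z => ENNReal.ofReal q * ENNReal.ofReal (z.2 ^ (q - 1))) (x, t) := by
        rw [lintegral_lintegral_swap]
        exact (Measurable.indicator (by fun_prop) hset).aemeasurable
    _ ≤ ∫⁻ t in Set.Ioi (0 : ℝ), ∫⁻ y, ENNReal.ofReal D * (f y *
          {z : ℝ × Eu n | ENNReal.ofReal (c₂ * z.1 ^ l) < f z.2}.indicator
            (fun z => ENNReal.ofReal (z.1 ^ (m - 1))) (t, y)) := by
        refine setLIntegral_mono' measurableSet_Ioi fun t ht => ?_
        have ht0 : 0 < t := ht
        have hst : MeasurableSet {x | ENNReal.ofReal t < F x} := measurableSet_lt measurable_const hFm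
        calc _ = ENNReal.ofReal q * ENNReal.ofReal (t ^ (q - 1)) *
              volume {x | ENNReal.ofReal t < F x} := by
              rw [← setLIntegral_const, ← lintegral_indicator hst]
              rfl
          _ ≤ ENNReal.ofReal q * ENNReal.ofReal (t ^ (q - 1)) *
              (ENNReal.ofReal (4 / t * (C₁ * R t ^ a)) *
                ∫⁻ y, {y | ENNReal.ofReal (c₂ * t ^ l) < f y}.indicator f y) := by
              gcongr
              exact hlevel t ht0
          _ = ENNReal.ofReal D * ENNReal.ofReal (t ^ (m - 1)) *
                ∫⁻ y, {y | ENNReal.ofReal (c₂ * t ^ l) < f y}.indicator f y := by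
              rw [← mul_assoc]
              congr 1
              rw [← ENNReal.ofReal_mul (by positivity), ← ENNReal.ofReal_mul (by positivity),
                ← ENNReal.ofReal_mul (by positivity)]
              congr 1
              rw [hRa t ht0, Real.mul_rpow hc₁0.le ht0.le, hD,
                show m - 1 = (q - 1) - 1 + (-e) by rw [hm, hl1]; ring, Real.rpow_add ht0,
                Real.rpow_sub ht0 (q - 1) 1, Real.rpow_one]
              field_simp
          _ = _ := by
              rw [← lintegral_const_mul _ (hf.indicator (measurableSet_lt measurable_const hf))]
              refine lintegral_congr fun y => ?_
              rw [mul_assoc]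
              congr 1
              by_cases hy : ENNReal.ofReal (c₂ * t ^ l) < f y
              · rw [Set.indicator_of_mem (by exact hy), Set.indicator_of_mem (by exact hy), mul_comm]
              · rw [Set.indicator_of_notMem (by exact hy), Set.indicator_of_notMem (by exact hy),
                  mul_zero, mul_zero]
    _ = ∫⁻ y, ∫⁻ t in Set.Ioi (0 : ℝ), ENNReal.ofReal D * (f y *
          {z : ℝ × Eu n | ENNReal.ofReal (c₂ * z.1 ^ l) < f z.2}.indicator
            (fun z => ENNReal.ofReal (z.1 ^ (m - 1))) (t, y)) := by
        rw [lintegral_lintegral_swap]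
        exact (Measurable.const_mul (Measurable.mul (hf.comp measurable_snd)
          (Measurable.indicator (by fun_prop) hset2)) _).aemeasurable
    -- The t-integral produces f^{m/l} = f^{p-1}, and the factor f already present completes f^p.
    _ ≤ ∫⁻ y, ENNReal.ofReal (D * (c₂⁻¹ ^ (m / l) / m)) * f y ^ p := by
        refine lintegral_mono fun y => ?_
        have hmeas : Measurable fun t : ℝ =>
            {z : ℝ × Eu n | ENNReal.ofReal (c₂ * z.1 ^ l) < f z.2}.indicator
            (fun z => ENNReal.ofReal (z.1 ^ (m - 1))) (t, y) :=
          (Measurable.indicator (by fun_prop) hset2).comp (by fun_prop)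
        rw [lintegral_const_mul _ (hmeas.const_mul _), lintegral_const_mul _ hmeas]
        calc _ ≤ ENNReal.ofReal D * (f y * (ENNReal.ofReal (c₂⁻¹ ^ (m / l) / m) *
              f y ^ (m / l))) := by
              gcongr
              exact lintegral_indicator_le_rpow hm0 hl0 hc₂0 (f y)
          _ = _ := by
              rw [ENNReal.ofReal_mul hD0.le, hml]
              have : f y ^ p = f y * f y ^ (p - 1) := by
                conv_rhs => rw [← ENNReal.rpow_one (f y)]
                rw [← ENNReal.rpow_mul, one_mul,
                  ← ENNReal.rpow_add_of_nonneg _ _ zero_le_one (by linarith)]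
                congr 1
                ring
              rw [this]
              ring
    _ = _ := by
        rw [lintegral_const_mul _ (by fun_prop), hfp, mul_one]
        rfl

/-- The Hardy–Littlewood–Sobolev inequality. -/
theorem hardy_littlewood_sobolev {n : ℕ} (hn : 1 ≤ n) {a p q : ℝ} (ha : 0 < a)
    (hp : 1 < p) (hq : 0 < q) (hpq : 1 / q = 1 / p - a / n) :
    ∃ C : ℝ≥0, ∀ f : Eu n → ℝ≥0∞, Measurable f → ∫⁻ x, f x ^ p < ∞ →
      (∫⁻ x, (∫⁻ y, ENNReal.ofReal (dist x y ^ (a - n)) * f y) ^ q) ^ (1 / q) ≤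
        C * (∫⁻ x, f x ^ p) ^ (1 / p) := by
  obtain ⟨C, hC⟩ := hls_normalized hn ha hp hq hpq
  have hp0 : 0 < p := by linarith
  refine ⟨C ^ (1 / q), fun f hf hfin => ?_⟩
  rcases eq_or_ne (∫⁻ x, f x ^ p) 0 with h0 | h0
  · have hae : f =ᵐ[volume] 0 := by
      rw [lintegral_eq_zero_iff (by fun_prop)] at h0
      filter_upwards [h0] with x hx
      simpa [hp0, hp0.not_gt, hp0.le] using hx
    have : ∀ x, ∫⁻ y, ENNReal.ofReal (dist x y ^ (a - n)) * f y = 0 := fun x => by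
      rw [← lintegral_zero (μ := (volume : Measure (Eu n)))]
      refine lintegral_congr_ae ?_
      filter_upwards [hae] with y hy
      rw [hy, Pi.zero_apply, mul_zero]
    simp [this, hq]
  -- Both sides are homogeneous of degree one in f, so the normalised case is applied to f/N.
  · set N := (∫⁻ x, f x ^ p) ^ (1 / p) with hN
    have hN0 : N ≠ 0 := by
      rw [hN]; simp [h0, hp0, hfin.ne]
    have hNt : N ≠ ∞ := ENNReal.rpow_ne_top_of_nonneg (by positivity) hfin.ne
    have hscale := hC (fun x => N⁻¹ * f x) (hf.const_mul _) (by
      simp_rw [ENNReal.mul_rpow_of_nonneg _ _ hp0.le]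
      rw [lintegral_const_mul _ (by fun_prop), ENNReal.inv_rpow, hN, ← ENNReal.rpow_mul,
        one_div_mul_cancel hp0.ne', ENNReal.rpow_one, ENNReal.inv_mul_cancel h0 hfin.ne])
    have e : ∀ x, ∫⁻ y, ENNReal.ofReal (dist x y ^ (a - n)) * f y =
        N * ∫⁻ y, ENNReal.ofReal (dist x y ^ (a - n)) * (N⁻¹ * f y) := fun x => by
      rw [← lintegral_const_mul _ (by fun_prop)]
      refine lintegral_congr fun y => ?_
      rw [mul_left_comm, ← mul_assoc N, ENNReal.mul_inv_cancel hN0 hNt, one_mul]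
    simp_rw [e, ENNReal.mul_rpow_of_nonneg _ _ hq.le]
    rw [lintegral_const_mul' _ _ (ENNReal.rpow_ne_top_of_nonneg hq.le hNt),
      ENNReal.mul_rpow_of_nonneg _ _ (by positivity), ← ENNReal.rpow_mul,
      mul_one_div_cancel hq.ne', ENNReal.rpow_one, mul_comm]
    gcongr
    rw [ENNReal.coe_rpow_of_nonneg _ (by positivity)]
    exact ENNReal.rpow_le_rpow hscale (by positivity)

/-- Jensen's inequality for a kernel. -/
lemma lintegral_mul_rpow_le {α : Type*} [MeasurableSpace α] {μ : Measure α} {k f : α → ℝ≥0∞}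
    (hk : AEMeasurable k μ) (hf : AEMeasurable f μ) {p : ℝ} (hp : 1 ≤ p) :
    (∫⁻ y, k y * f y ∂μ) ^ p ≤ (∫⁻ y, k y ∂μ) ^ (p - 1) * ∫⁻ y, k y * f y ^ p ∂μ := by
  rcases hp.eq_or_lt with rfl | hp
  · simp
  have hconj : (p.conjExponent).HolderConjugate p := (Real.HolderConjugate.conjExponent hp).symm
  have hp0 : 0 < p := by linarith
  set p' := p.conjExponent
  have hp'0 : 0 < p' := hconj.pos
  have hsum : 1 / p' + 1 / p = 1 := by simpa using hconj.inv_add_inv_eq_one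
  -- Hölder for the factorisation k f = k^{1/p'} · (k^{1/p} f).
  have h := ENNReal.lintegral_mul_le_Lp_mul_Lq μ hconj
    (f := fun y => k y ^ (1 / p')) (g := fun y => k y ^ (1 / p) * f y) (by fun_prop) (by fun_prop)
  have e1 : ∀ y, k y ^ (1 / p') * (k y ^ (1 / p) * f y) = k y * f y := fun y => by
    rw [← mul_assoc, ← ENNReal.rpow_add_of_nonneg _ _ (by positivity) (by positivity), hsum,
      ENNReal.rpow_one]
  have e2 : ∀ y, (k y ^ (1 / p')) ^ p' = k y := fun y => by
    rw [← ENNReal.rpow_mul, one_div_mul_cancel hp'0.ne', ENNReal.rpow_one]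
  have e3 : ∀ y, (k y ^ (1 / p) * f y) ^ p = k y * f y ^ p := fun y => by
    rw [ENNReal.mul_rpow_of_nonneg _ _ hp0.le, ← ENNReal.rpow_mul, one_div_mul_cancel hp0.ne',
      ENNReal.rpow_one]
  simp only [Pi.mul_apply, e1, e2, e3] at h
  calc (∫⁻ y, k y * f y ∂μ) ^ p
      ≤ ((∫⁻ y, k y ∂μ) ^ (1 / p') * (∫⁻ y, k y * f y ^ p ∂μ) ^ (1 / p)) ^ p :=
        ENNReal.rpow_le_rpow h hp0.le
    _ = _ := by
        rw [ENNReal.mul_rpow_of_nonneg _ _ hp0.le, ← ENNReal.rpow_mul, ← ENNReal.rpow_mul,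
          one_div_mul_cancel hp0.ne', ENNReal.rpow_one]
        congr 2
        rw [eq_sub_of_add_eq hsum]
        field_simp

/-! ### The distance to the boundary and the integrability of its powers. -/

lemma frontier_nonempty_of_bounded {n : ℕ} (hn : 1 ≤ n) {Ω : Set (Eu n)} (hne : Ω.Nonempty)
    (hb : Bornology.IsBounded Ω) : (frontier Ω).Nonempty := by
  rw [nonempty_frontier_iff]
  refine ⟨hne, fun h => ?_⟩
  have : Nonempty (Fin n) := ⟨⟨0, hn⟩⟩
  rw [h] at hb
  exact NormedSpace.unbounded_univ ℝ (Eu n) hb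

lemma bdryDist_pos {n : ℕ} (hn : 1 ≤ n) {Ω : Set (Eu n)} (ho : IsOpen Ω)
    (hb : Bornology.IsBounded Ω) {x : Eu n} (hx : x ∈ Ω) : 0 < bdryDist Ω x := by
  refine (isClosed_frontier.notMem_iff_infDist_pos
    (frontier_nonempty_of_bounded hn ⟨x, hx⟩ hb)).1 fun h => ?_
  rw [ho.frontier_eq] at h
  exact h.2 hx

lemma bdryDist_nonneg {n : ℕ} (Ω : Set (Eu n)) (x : Eu n) : 0 ≤ bdryDist Ω x :=
  Metric.infDist_nonneg

lemma bdryDist_le_add {n : ℕ} (Ω : Set (Eu n)) (x y : Eu n) :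
    bdryDist Ω x ≤ bdryDist Ω y + dist x y :=
  Metric.infDist_le_infDist_add_dist

lemma continuous_bdryDist {n : ℕ} (Ω : Set (Eu n)) : Continuous (bdryDist Ω) :=
  Metric.continuous_infDist_pt _

@[fun_prop]
lemma measurable_bdryDist {n : ℕ} (Ω : Set (Eu n)) : Measurable (bdryDist Ω) :=
  (continuous_bdryDist Ω).measurable

lemma exists_diam_bound {n : ℕ} (hn : 1 ≤ n) {Ω : Set (Eu n)} (hne : Ω.Nonempty)
    (hb : Bornology.IsBounded Ω) :
    ∃ D : ℝ, 0 < D ∧ (∀ x ∈ Ω, ∀ y ∈ Ω, dist x y ≤ D) ∧ ∀ x ∈ Ω, bdryDist Ω x ≤ D := by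
  obtain ⟨y, hy⟩ := frontier_nonempty_of_bounded hn hne hb
  have hbc := hb.closure
  rw [Metric.isBounded_iff] at hbc
  obtain ⟨D, hD⟩ := hbc
  refine ⟨max D 1, by positivity, fun x hx z hz =>
    (hD (subset_closure hx) (subset_closure hz)).trans (le_max_left _ _), fun x hx => ?_⟩
  exact (Metric.infDist_le_dist_of_mem hy).trans
    ((hD (subset_closure hx) (frontier_subset_closure hy)).trans (le_max_left _ _))

/-- Averaging over translations replaces a straightening of the boundary. By translation invariance
the integral equals its mean over shifts by tν with 0 < t < 1. After swapping, h(x + tν) = h(x) + t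
turns the inner integral into at most ∫₀^H τ^β dτ, and x ranges over a slightly larger ball. -/
lemma lintegral_height_rpow_lt_top {n : ℕ} {ν x₀ : Eu n} (hν : ‖ν‖ = 1) {h : Eu n → ℝ}
    (hm : Measurable h) (hadd : ∀ (x : Eu n) (t : ℝ), h (x + t • ν) = h x + t) {β : ℝ}
    (hβ : -1 < β) (ρ H : ℝ) :
    ∫⁻ x in {x | x ∈ Metric.ball x₀ ρ ∧ h x ∈ Set.Ioo 0 H}, ENNReal.ofReal (h x ^ β) < ∞ := by
  have hS : MeasurableSet {x | x ∈ Metric.ball x₀ ρ ∧ h x ∈ Set.Ioo 0 H} :=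
    measurableSet_ball.inter (measurableSet_Ioo.preimage hm)
  set F : Eu n → ℝ≥0∞ := {x | x ∈ Metric.ball x₀ ρ ∧ h x ∈ Set.Ioo 0 H}.indicator
    fun x => ENNReal.ofReal (h x ^ β) with hF
  have hFm : Measurable F := Measurable.indicator (by fun_prop) hS
  set φ : ℝ → ℝ≥0∞ := (Set.Ioo 0 H).indicator fun t => ENNReal.ofReal (t ^ β) with hφ
  have hφfin : ∫⁻ t, φ t < ∞ := by
    rw [hφ, lintegral_indicator measurableSet_Ioo]
    rcases le_or_gt H 0 with hH | hH
    · simp [hH]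
    · have := lintegral_Ioo_rpow (m := β + 1) (by linarith) hH.le
      rw [add_sub_cancel_right] at this
      rw [this]
      exact ENNReal.ofReal_lt_top
  have hFle : ∀ (x : Eu n) (t : ℝ), t ∈ Set.Ioo (0 : ℝ) 1 →
      F (x + t • ν) ≤ (Metric.ball x₀ (ρ + 1)).indicator (fun x => φ (h x + t)) x := by
    intro x t ht
    by_cases hx : x + t • ν ∈ {x | x ∈ Metric.ball x₀ ρ ∧ h x ∈ Set.Ioo 0 H}
    · have hx1 : x ∈ Metric.ball x₀ (ρ + 1) := by
        have h1 : dist (x + t • ν) x₀ < ρ := hx.1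
        have h2 : dist x (x + t • ν) ≤ 1 := by
          rw [dist_self_add_right, norm_smul, hν, mul_one, Real.norm_of_nonneg ht.1.le]
          exact ht.2.le
        rw [Metric.mem_ball]
        linarith [dist_triangle x (x + t • ν) x₀]
      have hx2 : h x + t ∈ Set.Ioo 0 H := by rw [← hadd]; exact hx.2
      rw [hF, Set.indicator_of_mem hx, Set.indicator_of_mem hx1, hφ, Set.indicator_of_mem hx2, hadd]
    · rw [hF, Set.indicator_of_notMem hx]
      exact zero_le
  have hval : ∫⁻ x, F x = ∫⁻ t in Set.Ioo (0 : ℝ) 1, ∫⁻ x, F (x + t • ν) := by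
    simp_rw [lintegral_add_right_eq_self F]
    simp
  have hswap : ∫⁻ t in Set.Ioo (0 : ℝ) 1, ∫⁻ x, F (x + t • ν) =
      ∫⁻ x, ∫⁻ t in Set.Ioo (0 : ℝ) 1, F (x + t • ν) := by
    rw [lintegral_lintegral_swap]
    exact (hFm.comp (by fun_prop : Measurable fun z : ℝ × Eu n => z.2 + z.1 • ν)).aemeasurable
  rw [← lintegral_indicator hS, hval, hswap]
  calc ∫⁻ x, ∫⁻ t in Set.Ioo (0 : ℝ) 1, F (x + t • ν)
      ≤ ∫⁻ x, (Metric.ball x₀ (ρ + 1)).indicator (fun _ => ∫⁻ t, φ t) x := by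
        refine lintegral_mono fun x => ?_
        refine (setLIntegral_mono' measurableSet_Ioo fun t ht => hFle x t ht).trans ?_
        by_cases hx : x ∈ Metric.ball x₀ (ρ + 1)
        · simp only [Set.indicator_of_mem hx]
          refine (setLIntegral_le_lintegral _ _).trans ?_
          rw [lintegral_add_left_eq_self φ (h x)]
        · simp [Set.indicator_of_notMem hx]
    _ = (∫⁻ t, φ t) * volume (Metric.ball x₀ (ρ + 1)) := by
        rw [lintegral_indicator measurableSet_ball, setLIntegral_const]
    _ < ∞ := ENNReal.mul_lt_top hφfin measure_ball_lt_top

/-- The height h = ⟨ν,·⟩ - g above the graph is Lipschitz near x₀ and is at most 0 at the nearest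
boundary point, so h ≤ Mδ on Ω near x₀. As β < 0, this bounds δ^β by a multiple of h^β. -/
lemma exists_ball_lintegral_bdryDist_rpow {n : ℕ} {Ω : Set (Eu n)} (hΩ : IsC11Domain Ω)
    {β : ℝ} (hβ : -1 < β) (hβ0 : β < 0) {x₀ : Eu n} (hx₀ : x₀ ∈ frontier Ω) :
    ∃ ρ : ℝ, 0 < ρ ∧ ∫⁻ x in Metric.ball x₀ ρ ∩ Ω, ENNReal.ofReal (bdryDist Ω x ^ β) < ∞ := by
  obtain ⟨r, hr, ν, hν, g, hg, -, hginv, hepi⟩ := hΩ.2 x₀ hx₀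
  set h : Eu n → ℝ := fun x => inner ℝ ν x - g x with hh
  have hhd : ContDiff ℝ 1 h := (contDiff_const.inner ℝ contDiff_id).sub hg
  have hadd : ∀ (x : Eu n) (t : ℝ), h (x + t • ν) = h x + t := fun x t => by
    simp only [hh, hginv, inner_add_right, inner_smul_right, real_inner_self_eq_norm_sq, hν]
    ring
  obtain ⟨K, T, hT, hLip⟩ := hhd.contDiffAt.exists_lipschitzOnWith (x := x₀)
  obtain ⟨r₁, hr₁, hr₁T⟩ := Metric.mem_nhds_iff.1 hT
  set r₂ := min r r₁ with hr₂
  have hr₂0 : 0 < r₂ := lt_min hr hr₁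
  set M : ℝ := K + 1 with hM
  have hM0 : 0 < M := by positivity
  have hmem : ∀ y ∈ Metric.ball x₀ r₂, (y ∈ Ω ↔ 0 < h y) := fun y hy => by
    have hyr : y ∈ Metric.ball x₀ r := Metric.ball_subset_ball (min_le_left _ _) hy
    have : y ∈ Ω ∩ Metric.ball x₀ r ↔ y ∈ {x | g x < inner ℝ ν x} ∩ Metric.ball x₀ r := by
      rw [hepi]
    simp only [Set.mem_inter_iff, hyr, and_true, Set.mem_ofPred_eq] at this
    rw [this, hh]
    simp
  -- Half the radius, so that the boundary point nearest to x still lies in the ball of radius r₂.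
  have hle : ∀ x ∈ Metric.ball x₀ (r₂ / 2), h x ≤ M * bdryDist Ω x := fun x hx => by
    obtain ⟨y, hy, hxy⟩ := isClosed_frontier.exists_infDist_eq_dist ⟨x₀, hx₀⟩ x
    have hxy' : bdryDist Ω x = dist x y := hxy
    have hdx : dist x x₀ < r₂ / 2 := hx
    have hd : dist x y ≤ dist x x₀ := by
      rw [← hxy]; exact Metric.infDist_le_dist_of_mem hx₀
    have hyb : y ∈ Metric.ball x₀ r₂ := by
      rw [Metric.mem_ball]
      linarith [dist_triangle y x x₀, dist_comm x y]
    have hxb : x ∈ Metric.ball x₀ r₂ := Metric.ball_subset_ball (by linarith) hx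
    have hyh : h y ≤ 0 := by
      rw [← not_lt, ← hmem y hyb]
      have := hy
      rw [hΩ.1.frontier_eq] at this
      exact this.2
    have hsub : Metric.ball x₀ r₂ ⊆ T :=
      (Metric.ball_subset_ball (min_le_right _ _)).trans hr₁T
    have h1 := hLip.dist_le_mul x (hsub hxb) y (hsub hyb)
    rw [Real.dist_eq] at h1
    rw [hxy', hM, add_mul]
    linarith [le_abs_self (h x - h y), dist_nonneg (x := x) (y := y)]
  refine ⟨r₂ / 2, by positivity, ?_⟩
  have hfin := lintegral_height_rpow_lt_top (x₀ := x₀) hν hhd.continuous.measurable hadd hβ (r₂ / 2)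
    (M * r₂)
  have hSm : MeasurableSet (Metric.ball x₀ (r₂ / 2) ∩ Ω) :=
    measurableSet_ball.inter hΩ.1.measurableSet
  calc ∫⁻ x in Metric.ball x₀ (r₂ / 2) ∩ Ω, ENNReal.ofReal (bdryDist Ω x ^ β)
      ≤ ∫⁻ x in Metric.ball x₀ (r₂ / 2) ∩ Ω, ENNReal.ofReal (M ^ (-β)) *
          ENNReal.ofReal (h x ^ β) := by
        refine setLIntegral_mono' hSm fun x hx => ?_
        have hxb : x ∈ Metric.ball x₀ r₂ := Metric.ball_subset_ball (by linarith) hx.1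
        have hpos : 0 < h x := (hmem x hxb).1 hx.2
        rw [← ENNReal.ofReal_mul (by positivity)]
        refine ENNReal.ofReal_le_ofReal ?_
        calc bdryDist Ω x ^ β ≤ (M⁻¹ * h x) ^ β := by
              refine Real.rpow_le_rpow_of_nonpos (by positivity) ?_ hβ0.le
              rw [inv_mul_le_iff₀ hM0]
              exact hle x hx.1
          _ = _ := by
              rw [Real.mul_rpow (by positivity) hpos.le, Real.inv_rpow hM0.le, Real.rpow_neg hM0.le]
    _ = ENNReal.ofReal (M ^ (-β)) * ∫⁻ x in Metric.ball x₀ (r₂ / 2) ∩ Ω,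
          ENNReal.ofReal (h x ^ β) :=
        lintegral_const_mul' _ _ ENNReal.ofReal_ne_top
    _ ≤ ENNReal.ofReal (M ^ (-β)) * ∫⁻ x in {x | x ∈ Metric.ball x₀ (r₂ / 2) ∧
          h x ∈ Set.Ioo 0 (M * r₂)}, ENNReal.ofReal (h x ^ β) := by
        refine mul_le_mul' le_rfl (lintegral_mono_set fun x hx => ⟨hx.1, ?_, ?_⟩)
        · exact (hmem x (Metric.ball_subset_ball (by linarith) hx.1)).1 hx.2
        · refine (hle x hx.1).trans_lt (mul_lt_mul_of_pos_left ?_ hM0)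
          have h1 : bdryDist Ω x ≤ dist x x₀ := Metric.infDist_le_dist_of_mem hx₀
          have h2 : dist x x₀ < r₂ / 2 := hx.1
          linarith
    _ < ∞ := ENNReal.mul_lt_top ENNReal.ofReal_lt_top hfin

/-- Non-negative powers are bounded. For negative ones, finiteness is local: clear near interior
points and known near boundary points, so compactness of the closure of Ω concludes. -/
theorem lintegral_bdryDist_rpow_lt_top {n : ℕ} (hn : 1 ≤ n) {Ω : Set (Eu n)} (hne : Ω.Nonempty)
    (hb : Bornology.IsBounded Ω) (hΩ : IsC11Domain Ω) {β : ℝ} (hβ : -1 < β) :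
    ∫⁻ x in Ω, ENNReal.ofReal (bdryDist Ω x ^ β) < ∞ := by
  have hΩfin : volume Ω < ∞ := hb.measure_lt_top
  obtain ⟨D, hD0, -, hD⟩ := exists_diam_bound hn hne hb
  rcases le_or_gt 0 β with h0 | h0
  · calc ∫⁻ x in Ω, ENNReal.ofReal (bdryDist Ω x ^ β) ≤ ∫⁻ _ in Ω, ENNReal.ofReal (D ^ β) :=
          setLIntegral_mono' hΩ.1.measurableSet fun x hx => ENNReal.ofReal_le_ofReal
            (Real.rpow_le_rpow (bdryDist_nonneg _ _) (hD x hx) h0)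
      _ < ∞ := by
          rw [setLIntegral_const]
          exact ENNReal.mul_lt_top ENNReal.ofReal_lt_top hΩfin
  · have key : ∀ x ∈ closure Ω, ∃ U ∈ 𝓝[closure Ω] x,
        ∫⁻ x in U ∩ Ω, ENNReal.ofReal (bdryDist Ω x ^ β) < ∞ := by
      intro x hx
      by_cases hxΩ : x ∈ Ω
      · have hδ := bdryDist_pos hn hΩ.1 hb hxΩ
        set c := bdryDist Ω x / 2 with hc
        have hc0 : 0 < c := by positivity
        refine ⟨Metric.ball x c, mem_nhdsWithin_of_mem_nhds (Metric.ball_mem_nhds _ hc0), ?_⟩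
        calc _ ≤ ∫⁻ _ in Metric.ball x c ∩ Ω, ENNReal.ofReal (c ^ β) := by
              refine setLIntegral_mono' (measurableSet_ball.inter hΩ.1.measurableSet)
                fun y hy => ENNReal.ofReal_le_ofReal
                (Real.rpow_le_rpow_of_nonpos hc0 ?_ h0.le)
              have h1 := bdryDist_le_add Ω x y
              have h2 : dist y x < c := hy.1
              rw [dist_comm] at h2
              linarith
          _ < ∞ := by
              rw [setLIntegral_const]
              exact ENNReal.mul_lt_top ENNReal.ofReal_lt_top
                ((measure_mono Set.inter_subset_right).trans_lt hΩfin)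
      · have hxf : x ∈ frontier Ω := by
          rw [hΩ.1.frontier_eq]; exact ⟨hx, hxΩ⟩
        obtain ⟨ρ, hρ, hfin⟩ := exists_ball_lintegral_bdryDist_rpow hΩ hβ h0 hxf
        exact ⟨_, mem_nhdsWithin_of_mem_nhds (Metric.ball_mem_nhds _ hρ), hfin⟩
    have hfinal := hb.isCompact_closure.induction_on
      (p := fun U => ∫⁻ x in U ∩ Ω, ENNReal.ofReal (bdryDist Ω x ^ β) < ∞)
      (by simp) (fun s t hst ht => (lintegral_mono_set (Set.inter_subset_inter_left _ hst)).trans_lt ht)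
      (fun s t hs ht => by
        rw [Set.union_inter_distrib_right]
        exact (lintegral_union_le _ _ _).trans_lt (ENNReal.add_lt_top.2 ⟨hs, ht⟩)) key
    rwa [Set.inter_eq_self_of_subset_right subset_closure] at hfinal

/-! ### Green kernels and pointwise kernel inequalities. -/

/-- A Green kernel that satisfies the two-sided bounds with constant `C`, in a bounded open set with
diameter and inradius at most `D`, in the subcritical case `2 s < n`. -/
structure IsGreenKernel {n : ℕ} (Ω : Set (Eu n)) (s γ C D : ℝ) (G : Eu n → Eu n → ℝ) : Prop where
  one_le : 1 ≤ n
  isOpen : IsOpen Ω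
  nonempty : Ω.Nonempty
  s_pos : 0 < s
  two_s_lt : 2 * s < n
  γ_pos : 0 < γ
  γ_le : γ ≤ 1
  C_pos : 0 < C
  D_pos : 0 < D
  dist_le : ∀ x ∈ Ω, ∀ y ∈ Ω, dist x y ≤ D
  delta_le : ∀ x ∈ Ω, bdryDist Ω x ≤ D
  delta_pos : ∀ x ∈ Ω, 0 < bdryDist Ω x
  meas : Measurable (Function.uncurry G)
  symm : ∀ x ∈ Ω, ∀ y ∈ Ω, G x y = G y x
  lower : ∀ x ∈ Ω, ∀ y ∈ Ω, x ≠ y → C⁻¹ * modelKernel Ω s γ x y ≤ G x y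
  upper : ∀ x ∈ Ω, ∀ y ∈ Ω, x ≠ y → G x y ≤ C * modelKernel Ω s γ x y

section Real

lemma min_rpow_one_le {u q γ : ℝ} (hu : 0 < u) (hq : 0 ≤ q) (hqγ : q ≤ γ) :
    min (u ^ γ) 1 ≤ u ^ q := by
  rcases le_total u 1 with h | h
  · exact (min_le_left _ _).trans (Real.rpow_le_rpow_of_exponent_ge hu h hqγ)
  · exact (min_le_right _ _).trans (Real.one_le_rpow h hq)

lemma add_rpow_le_rpow_add_rpow {a b q : ℝ} (ha : 0 ≤ a) (hb : 0 ≤ b) (hq : 0 ≤ q) (hq1 : q ≤ 1) :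
    (a + b) ^ q ≤ a ^ q + b ^ q := by
  have := NNReal.rpow_add_le_add_rpow ⟨a, ha⟩ ⟨b, hb⟩ hq hq1
  exact_mod_cast this

variable {n : ℕ} {Ω : Set (Eu n)} {s γ : ℝ}

lemma modelKernel_comm (x y : Eu n) : modelKernel Ω s γ x y = modelKernel Ω s γ y x := by
  simp only [modelKernel, dist_comm x y]
  ring

lemma cutoff_nonneg (x : Eu n) {r : ℝ} (hr : 0 ≤ r) :
    0 ≤ min (bdryDist Ω x ^ γ / r ^ γ) 1 :=
  le_min (div_nonneg (Real.rpow_nonneg (bdryDist_nonneg _ _) _) (Real.rpow_nonneg hr _)) zero_le_one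

lemma cutoff_pos {x : Eu n} (hx : 0 < bdryDist Ω x) {r : ℝ} (hr : 0 < r) :
    0 < min (bdryDist Ω x ^ γ / r ^ γ) 1 :=
  lt_min (by positivity) zero_lt_one

/-- Interpolation between the two terms of the minimum: any part q of the boundary decay γ may be
used. -/
lemma cutoff_le_rpow {x : Eu n} (hx : 0 < bdryDist Ω x) {r : ℝ} (hr : 0 < r) {q : ℝ}
    (hq : 0 ≤ q) (hqγ : q ≤ γ) :
    min (bdryDist Ω x ^ γ / r ^ γ) 1 ≤ bdryDist Ω x ^ q / r ^ q := by
  rw [← Real.div_rpow hx.le hr.le, ← Real.div_rpow hx.le hr.le]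
  exact min_rpow_one_le (by positivity) hq hqγ

lemma cutoff_le_of_le (x : Eu n) {r R : ℝ} (hr : 0 < r) (hγ : 0 ≤ γ) (hrR : r ≤ 2 * R) :
    min (bdryDist Ω x ^ γ / R ^ γ) 1 ≤ 2 ^ γ * min (bdryDist Ω x ^ γ / r ^ γ) 1 := by
  have hR : 0 < R := by linarith
  have h0 : 0 ≤ bdryDist Ω x ^ γ := Real.rpow_nonneg (bdryDist_nonneg _ _) _
  rw [mul_min_of_nonneg _ _ (by positivity)]
  refine min_le_min ?_ ?_
  · rw [mul_div_left_comm, div_eq_mul_one_div]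
    refine mul_le_mul_of_nonneg_left ?_ h0
    rw [div_le_div_iff₀ (by positivity) (by positivity), one_mul,
      ← Real.mul_rpow (by positivity) (by positivity)]
    exact Real.rpow_le_rpow hr.le hrR hγ
  · rw [mul_one]
    exact Real.one_le_rpow (by norm_num) hγ

lemma modelKernel_eq {x y : Eu n} : modelKernel Ω s γ x y =
    dist x y ^ (2 * s - n) * min (bdryDist Ω x ^ γ / dist x y ^ γ) 1 *
      min (bdryDist Ω y ^ γ / dist x y ^ γ) 1 := by
  rw [modelKernel, one_div, ← Real.rpow_neg dist_nonneg, neg_sub]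

lemma modelKernel_pos {x y : Eu n} (hx : 0 < bdryDist Ω x) (hy : 0 < bdryDist Ω y) (hxy : x ≠ y) :
    0 < modelKernel Ω s γ x y := by
  have hr := dist_pos.2 hxy
  have h1 := cutoff_pos (γ := γ) hx hr
  have h2 := cutoff_pos (γ := γ) hy hr
  rw [modelKernel_eq]
  positivity

lemma modelKernel_le_riesz (x y : Eu n) : modelKernel Ω s γ x y ≤ dist x y ^ (2 * s - n) := by
  rw [modelKernel_eq]
  have h0 : 0 ≤ dist x y ^ (2 * s - n) := by positivity
  have h1 := cutoff_nonneg (Ω := Ω) (γ := γ) x (dist_nonneg (x := x) (y := y))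
  refine (mul_le_of_le_one_right (mul_nonneg h0 h1) (min_le_right _ _)).trans
    (mul_le_of_le_one_right h0 (min_le_right _ _))

/-- Since δ is 1-Lipschitz and b ≤ 1, δ(y)^b ≤ δ(x)^b + |x-y|^b. The cutoff at x is then spent with
exponent ε on the first term and b + ε on the second. The result trades ε orders of the Riesz kernel
for ε extra powers of δ(x); with ε = 0 it moves the weight from y to x. -/
lemma modelKernel_mul_rpow_le {x y : Eu n} (hx : 0 < bdryDist Ω x)
    (hxy : x ≠ y) (hγ : γ ≤ 1) {b ε : ℝ} (hb : 0 ≤ b) (hε : 0 ≤ ε) (hbε : b + ε ≤ γ) :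
    modelKernel Ω s γ x y * bdryDist Ω y ^ b ≤
      2 * (dist x y ^ (2 * s - ε - n) * bdryDist Ω x ^ (b + ε)) := by
  have hr := dist_pos.2 hxy
  set r := dist x y with hrdef
  set d := bdryDist Ω x with hd
  have hm0 := cutoff_nonneg (Ω := Ω) (γ := γ) x hr.le
  have h1 : modelKernel Ω s γ x y ≤ r ^ (2 * s - n) * min (d ^ γ / r ^ γ) 1 := by
    rw [modelKernel_eq]
    exact mul_le_of_le_one_right (mul_nonneg (by positivity) hm0) (min_le_right _ _)
  have h2 : bdryDist Ω y ^ b ≤ d ^ b + r ^ b := by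
    refine (Real.rpow_le_rpow (bdryDist_nonneg _ _) ?_ hb).trans
      (add_rpow_le_rpow_add_rpow hx.le hr.le hb (by linarith))
    rw [hrdef, dist_comm]
    exact bdryDist_le_add Ω y x
  have h3 := cutoff_le_rpow (γ := γ) hx hr hε (by linarith)
  have h4 := cutoff_le_rpow (γ := γ) hx hr (by positivity : 0 ≤ b + ε) hbε
  calc modelKernel Ω s γ x y * bdryDist Ω y ^ b
      ≤ (r ^ (2 * s - n) * min (d ^ γ / r ^ γ) 1) * (d ^ b + r ^ b) :=
        mul_le_mul h1 h2 (Real.rpow_nonneg (bdryDist_nonneg _ _) _) (mul_nonneg (by positivity) hm0)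
    _ = r ^ (2 * s - n) * (min (d ^ γ / r ^ γ) 1 * d ^ b + min (d ^ γ / r ^ γ) 1 * r ^ b) := by
        ring
    _ ≤ r ^ (2 * s - n) * (d ^ ε / r ^ ε * d ^ b + d ^ (b + ε) / r ^ (b + ε) * r ^ b) := by
        gcongr
    _ = _ := by
        rw [Real.rpow_add hx, Real.rpow_add hr, show 2 * s - ε - n = (2 * s - n) - ε by ring,
          Real.rpow_sub hr (2 * s - n)]
        have : 0 < r ^ b := by positivity
        field_simp
        ring

/-- All distances are at most D, so replacing |x-y| by D lowers each factor, and δ ≤ D keeps (δ/D)^γ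
below the cutoff. -/
lemma le_modelKernel {x y : Eu n} {D : ℝ} (hsn : 2 * s ≤ n) (hγ : 0 ≤ γ) (hx : 0 < bdryDist Ω x)
    (hy : 0 < bdryDist Ω y) (hxD : bdryDist Ω x ≤ D) (hyD : bdryDist Ω y ≤ D) (hxy : x ≠ y)
    (hD : dist x y ≤ D) :
    D ^ (2 * s - n) / (D ^ γ) ^ 2 * (bdryDist Ω x ^ γ * bdryDist Ω y ^ γ) ≤
      modelKernel Ω s γ x y := by
  have hr := dist_pos.2 hxy
  have hD0 : 0 < D := hr.trans_le hD
  have h1 : D ^ (2 * s - n) ≤ dist x y ^ (2 * s - n) :=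
    Real.rpow_le_rpow_of_nonpos hr hD (by linarith)
  have h2 : ∀ z : Eu n, 0 < bdryDist Ω z → bdryDist Ω z ≤ D →
      bdryDist Ω z ^ γ / D ^ γ ≤ min (bdryDist Ω z ^ γ / dist x y ^ γ) 1 := fun z hz hzD => by
    refine le_min ?_ ?_
    · gcongr
    · rw [div_le_one (by positivity)]
      gcongr
  have hx2 := h2 x hx hxD
  have hy2 := h2 y hy hyD
  rw [modelKernel_eq]
  calc _ = D ^ (2 * s - n) * (bdryDist Ω x ^ γ / D ^ γ) * (bdryDist Ω y ^ γ / D ^ γ) := by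
        field_simp
    _ ≤ _ := by
        gcongr

/-- When z is at least as close to y as to x, |x-y| ≤ 2|x-z|, so the factor centred at x passes from
scale |x-z| to scale |x-y|. The singularity |z-y|^{2s-n} remains. -/
lemma modelKernel_mul_modelKernel_le_aux {x y z : Eu n} (hsn : 2 * s ≤ n) (hγ0 : 0 ≤ γ)
    (hγ : γ ≤ 1) (hx : 0 < bdryDist Ω x) (hy : 0 < bdryDist Ω y) (hz : 0 < bdryDist Ω z)
    (hxy : x ≠ y) (hzy : z ≠ y) (hle : dist z y ≤ dist x z) :
    modelKernel Ω s γ x z * modelKernel Ω s γ z y ≤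
      2 ^ (n - 2 * s) * 2 ^ γ * (2 * 2 ^ γ) *
        (modelKernel Ω s γ x y * dist z y ^ (2 * s - n)) := by
  have hr := dist_pos.2 hxy
  have hρ := dist_pos.2 hzy
  have htri := dist_triangle x z y
  have hyz : bdryDist Ω z ^ γ ≤ bdryDist Ω y ^ γ + dist z y ^ γ :=
    (Real.rpow_le_rpow (bdryDist_nonneg _ _) (bdryDist_le_add Ω z y) hγ0).trans
      (add_rpow_le_rpow_add_rpow hy.le hρ.le hγ0 hγ)
  rw [modelKernel_eq, modelKernel_eq, modelKernel_eq]
  generalize dist x y = r at *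
  generalize dist z y = ρ at *
  generalize dist x z = R at *
  have hrR : r ≤ 2 * R := by linarith
  have hR : 0 < R := by linarith
  have h1 : R ^ (2 * s - n) ≤ 2 ^ (n - 2 * s) * r ^ (2 * s - n) := by
    have : R ^ (2 * s - n) ≤ (r / 2) ^ (2 * s - n) :=
      Real.rpow_le_rpow_of_nonpos (by positivity) (by linarith) (by linarith)
    refine this.trans (le_of_eq ?_)
    rw [Real.div_rpow hr.le (by norm_num), div_eq_mul_inv, ← Real.rpow_neg (by norm_num), neg_sub,
      mul_comm]
  have h2 := cutoff_le_of_le (Ω := Ω) x hr hγ0 hrR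
  -- The cutoff of y lives at the short scale ρ. It is brought to scale R by the cutoff of z,
  -- through δ(z)^γ ≤ δ(y)^γ + ρ^γ.
  have h3 : min (bdryDist Ω z ^ γ / R ^ γ) 1 * min (bdryDist Ω y ^ γ / ρ ^ γ) 1 ≤
      2 * 2 ^ γ * min (bdryDist Ω y ^ γ / r ^ γ) 1 := by
    have hm := cutoff_le_of_le (Ω := Ω) y hr hγ0 hrR
    rw [mul_assoc]
    refine le_trans ?_ (mul_le_mul_of_nonneg_left hm zero_le_two)
    rw [mul_min_of_nonneg (bdryDist Ω y ^ γ / R ^ γ) 1 zero_le_two]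
    have hz0 := cutoff_nonneg (Ω := Ω) (γ := γ) z hR.le
    have hy0 := cutoff_nonneg (Ω := Ω) (γ := γ) y hρ.le
    refine le_min ?_ ?_
    · calc _ ≤ (bdryDist Ω y ^ γ + ρ ^ γ) / R ^ γ * min (bdryDist Ω y ^ γ / ρ ^ γ) 1 := by
            gcongr
            exact (min_le_left _ _).trans (by gcongr)
        _ = bdryDist Ω y ^ γ / R ^ γ * min (bdryDist Ω y ^ γ / ρ ^ γ) 1 +
            ρ ^ γ / R ^ γ * min (bdryDist Ω y ^ γ / ρ ^ γ) 1 := by ring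
        _ ≤ bdryDist Ω y ^ γ / R ^ γ * 1 + ρ ^ γ / R ^ γ * (bdryDist Ω y ^ γ / ρ ^ γ) := by
            gcongr
            · exact min_le_right _ _
            · exact min_le_left _ _
        _ = _ := by
            field_simp
            ring
    · calc _ ≤ (1 : ℝ) * 1 := by
            gcongr
            · exact min_le_right _ _
            · exact min_le_right _ _
        _ ≤ _ := by norm_num
  have hx0 := cutoff_nonneg (Ω := Ω) (γ := γ) x hR.le
  have hx0' := cutoff_nonneg (Ω := Ω) (γ := γ) x hr.le
  have hy0' := cutoff_nonneg (Ω := Ω) (γ := γ) y hr.le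
  have hz0 := cutoff_nonneg (Ω := Ω) (γ := γ) z hR.le
  have hz0' := cutoff_nonneg (Ω := Ω) (γ := γ) z hρ.le
  have hy0 := cutoff_nonneg (Ω := Ω) (γ := γ) y hρ.le
  calc _ = R ^ (2 * s - n) * min (bdryDist Ω x ^ γ / R ^ γ) 1 *
        (min (bdryDist Ω z ^ γ / R ^ γ) 1 * min (bdryDist Ω y ^ γ / ρ ^ γ) 1) *
        ρ ^ (2 * s - n) * min (bdryDist Ω z ^ γ / ρ ^ γ) 1 := by ring
    _ ≤ (2 ^ (n - 2 * s) * r ^ (2 * s - n)) * (2 ^ γ * min (bdryDist Ω x ^ γ / r ^ γ) 1) *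
        (2 * 2 ^ γ * min (bdryDist Ω y ^ γ / r ^ γ) 1) * ρ ^ (2 * s - n) * 1 := by
        gcongr
        exact min_le_right _ _
    _ = _ := by ring

/-- The 3G inequality. -/
lemma modelKernel_mul_modelKernel_le {x y z : Eu n} (hsn : 2 * s ≤ n) (hγ0 : 0 ≤ γ)
    (hγ : γ ≤ 1) (hx : 0 < bdryDist Ω x) (hy : 0 < bdryDist Ω y) (hz : 0 < bdryDist Ω z)
    (hxy : x ≠ y) (hzx : z ≠ x) (hzy : z ≠ y) :
    modelKernel Ω s γ x z * modelKernel Ω s γ z y ≤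
      2 ^ (n - 2 * s) * 2 ^ γ * (2 * 2 ^ γ) *
        (modelKernel Ω s γ x y * (dist x z ^ (2 * s - n) + dist z y ^ (2 * s - n))) := by
  have hK := modelKernel_pos (s := s) (γ := γ) hx hy hxy
  rcases le_total (dist z y) (dist x z) with h | h
  · refine (modelKernel_mul_modelKernel_le_aux hsn hγ0 hγ hx hy hz hxy hzy h).trans ?_
    gcongr
    exact le_add_of_nonneg_left (by positivity)
  · have := modelKernel_mul_modelKernel_le_aux (s := s) (γ := γ) (x := y) (y := x) (z := z)
      hsn hγ0 hγ hy hx hz hxy.symm hzx (by rwa [dist_comm z x, dist_comm y z])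
    rw [modelKernel_comm z y, modelKernel_comm x z, modelKernel_comm x y, mul_comm,
      dist_comm x z]
    refine this.trans ?_
    have hK' := modelKernel_pos (s := s) (γ := γ) hy hx hxy.symm
    gcongr
    exact le_add_of_nonneg_right (by positivity)

lemma riesz_mul_riesz_le_aux {a b ε r ρ R N : ℝ} (hr : 0 < r) (hρ : 0 < ρ) (hρR : ρ ≤ R)
    (hrR : r ≤ 2 * R) (hεa : ε ≤ a) (hab : a + b - ε ≤ N) :
    ρ ^ (a - N) * R ^ (b - N) ≤ 2 ^ (N + ε - a - b) * r ^ (a + b - ε - N) * ρ ^ (ε - N) := by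
  have hR : 0 < R := hρ.trans_le hρR
  have h1 : R ^ (a + b - ε - N) ≤ 2 ^ (N + ε - a - b) * r ^ (a + b - ε - N) := by
    have : R ^ (a + b - ε - N) ≤ (r / 2) ^ (a + b - ε - N) :=
      Real.rpow_le_rpow_of_nonpos (by positivity) (by linarith) (by linarith)
    refine this.trans (le_of_eq ?_)
    rw [Real.div_rpow hr.le (by norm_num), div_eq_mul_inv, ← Real.rpow_neg (by norm_num),
      mul_comm]
    congr 2
    ring
  have h2 : R ^ (ε - a) ≤ ρ ^ (ε - a) := Real.rpow_le_rpow_of_nonpos hρ hρR (by linarith)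
  calc ρ ^ (a - N) * R ^ (b - N) = ρ ^ (a - N) * (R ^ (a + b - ε - N) * R ^ (ε - a)) := by
        rw [← Real.rpow_add hR]; congr 2; ring
    _ ≤ ρ ^ (a - N) * ((2 ^ (N + ε - a - b) * r ^ (a + b - ε - N)) * ρ ^ (ε - a)) := by gcongr
    _ = (2 ^ (N + ε - a - b) * r ^ (a + b - ε - N)) * (ρ ^ (a - N) * ρ ^ (ε - a)) := by ring
    _ = _ := by
        rw [← Real.rpow_add hρ]; congr 2; ring

/-- The pointwise core of the composition rule for Riesz kernels. An amount ε of the order is given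
up to leave an integrable singularity of order ε at x and at y, which also avoids a logarithm in the
borderline case a + b = n. -/
lemma riesz_mul_riesz_le {a b ε : ℝ} {x y z : Eu n} (hxy : x ≠ y) (hzx : z ≠ x) (hzy : z ≠ y)
    (hεa : ε ≤ a) (hεb : ε ≤ b) (hab : a + b - ε ≤ n) :
    dist x z ^ (a - n) * dist z y ^ (b - n) ≤ 2 ^ (n + ε - a - b) * dist x y ^ (a + b - ε - n) *
      (dist x z ^ (ε - n) + dist z y ^ (ε - n)) := by
  have hr := dist_pos.2 hxy
  have h1 := dist_pos.2 hzx.symm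
  have h2 := dist_pos.2 hzy
  have htri := dist_triangle x z y
  rcases le_total (dist x z) (dist z y) with h | h
  · refine (riesz_mul_riesz_le_aux hr h1 h (by linarith) hεa hab).trans ?_
    gcongr
    exact le_add_of_nonneg_right (by positivity)
  · rw [mul_comm]
    refine (riesz_mul_riesz_le_aux (a := b) (b := a) hr h2 h (by linarith) hεb
      (by linarith)).trans ?_
    rw [show (n : ℝ) + ε - b - a = n + ε - a - b by ring,
      show b + a - ε - (n : ℝ) = a + b - ε - n by ring]
    gcongr
    exact le_add_of_nonneg_left (by positivity)

end Real

/-! ### Green and Riesz operators on non-negative functions, and their iterates. -/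

/-- The Green operator with the kernel `|G|`, on functions with values in `[0, ∞]`. -/
def eGreen {n : ℕ} (Ω : Set (Eu n)) (G : Eu n → Eu n → ℝ) (f : Eu n → ℝ≥0∞) (x : Eu n) : ℝ≥0∞ :=
  ∫⁻ y in Ω, ‖G x y‖ₑ * f y

/-- The Riesz potential of order `b` on `Ω`. -/
def eRiesz {n : ℕ} (Ω : Set (Eu n)) (b : ℝ) (f : Eu n → ℝ≥0∞) (x : Eu n) : ℝ≥0∞ :=
  ∫⁻ y in Ω, ENNReal.ofReal (dist x y ^ (b - n)) * f y

lemma ae_mem_ne {n : ℕ} (hn : 1 ≤ n) {Ω : Set (Eu n)} (ho : MeasurableSet Ω) (x : Eu n) :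
    ∀ᵐ y ∂volume.restrict Ω, y ∈ Ω ∧ y ≠ x := by
  have : Nonempty (Fin n) := ⟨⟨0, hn⟩⟩
  have h1 : ∀ᵐ y ∂(volume : Measure (Eu n)), y ≠ x := by
    simp [ae_iff]
  filter_upwards [ae_restrict_mem ho, ae_restrict_of_ae h1] with y hy hyx using ⟨hy, hyx⟩

lemma eGreen_mono {n : ℕ} {Ω : Set (Eu n)} {G : Eu n → Eu n → ℝ} {f g : Eu n → ℝ≥0∞}
    (hfg : f ≤ᵐ[volume.restrict Ω] g) (x : Eu n) : eGreen Ω G f x ≤ eGreen Ω G g x := by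
  refine lintegral_mono_ae ?_
  filter_upwards [hfg] with y hy
  gcongr

lemma eGreen_const_mul {n : ℕ} {Ω : Set (Eu n)} {G : Eu n → Eu n → ℝ} {c : ℝ≥0∞} (hc : c ≠ ∞)
    (f : Eu n → ℝ≥0∞) (x : Eu n) : eGreen Ω G (fun y => c * f y) x = c * eGreen Ω G f x := by
  simp only [eGreen]
  rw [← lintegral_const_mul' _ _ hc]
  refine lintegral_congr fun y => ?_
  ring

lemma measurable_eRiesz {n : ℕ} {Ω : Set (Eu n)} {b : ℝ} {f : Eu n → ℝ≥0∞} (hf : Measurable f) :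
    Measurable (eRiesz Ω b f) :=
  Measurable.lintegral_prod_right' (f := fun z : Eu n × Eu n =>
    ENNReal.ofReal (dist z.1 z.2 ^ (b - n)) * f z.2) (by fun_prop)

namespace IsGreenKernel

variable {n : ℕ} {Ω : Set (Eu n)} {s γ C D : ℝ} {G : Eu n → Eu n → ℝ}

lemma measurableSet (h : IsGreenKernel Ω s γ C D G) : MeasurableSet Ω := h.isOpen.measurableSet

lemma ae_ne (h : IsGreenKernel Ω s γ C D G) (x : Eu n) :
    ∀ᵐ y ∂volume.restrict Ω, y ∈ Ω ∧ y ≠ x := ae_mem_ne h.one_le h.measurableSet x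

lemma isBounded (h : IsGreenKernel Ω s γ C D G) : Bornology.IsBounded Ω :=
  Metric.isBounded_iff.2 ⟨D, fun _ hx _ hy => h.dist_le _ hx _ hy⟩

lemma volume_lt_top (h : IsGreenKernel Ω s γ C D G) : volume Ω < ∞ := h.isBounded.measure_lt_top

lemma measurable_enorm (h : IsGreenKernel Ω s γ C D G) :
    Measurable fun z : Eu n × Eu n => ‖G z.1 z.2‖ₑ :=
  h.meas.enorm

lemma measurable_enorm_right (h : IsGreenKernel Ω s γ C D G) (x : Eu n) :
    Measurable fun y => ‖G x y‖ₑ :=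
  h.measurable_enorm.comp (by fun_prop : Measurable fun y => (x, y))

lemma measurable_enorm_left (h : IsGreenKernel Ω s γ C D G) (y : Eu n) :
    Measurable fun x => ‖G x y‖ₑ :=
  h.measurable_enorm.comp (by fun_prop : Measurable fun x => (x, y))

lemma measurable_eGreen (h : IsGreenKernel Ω s γ C D G) {f : Eu n → ℝ≥0∞} (hf : Measurable f) :
    Measurable (eGreen Ω G f) :=
  Measurable.lintegral_prod_right' (f := fun z : Eu n × Eu n => ‖G z.1 z.2‖ₑ * f z.2)
    (h.measurable_enorm.mul (hf.comp measurable_snd))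

lemma pos (h : IsGreenKernel Ω s γ C D G) {x y : Eu n} (hx : x ∈ Ω) (hy : y ∈ Ω) (hxy : x ≠ y) :
    0 < G x y :=
  (mul_pos (inv_pos.2 h.C_pos)
    (modelKernel_pos (h.delta_pos x hx) (h.delta_pos y hy) hxy)).trans_le (h.lower x hx y hy hxy)

lemma enorm_eq (h : IsGreenKernel Ω s γ C D G) {x y : Eu n} (hx : x ∈ Ω) (hy : y ∈ Ω)
    (hxy : x ≠ y) : ‖G x y‖ₑ = ENNReal.ofReal (G x y) :=
  Real.enorm_eq_ofReal (h.pos hx hy hxy).le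

lemma enorm_symm (h : IsGreenKernel Ω s γ C D G) {x y : Eu n} (hx : x ∈ Ω) (hy : y ∈ Ω) :
    ‖G x y‖ₑ = ‖G y x‖ₑ := by rw [h.symm x hx y hy]

lemma lintegral_riesz_le (h : IsGreenKernel Ω s γ C D G) {e : ℝ} (he : 0 < e) :
    ∃ M : ℝ≥0, ∀ x ∈ Ω, ∫⁻ y in Ω, ENNReal.ofReal (dist x y ^ (e - n)) ≤ M := by
  obtain ⟨A, hA, hball⟩ := lintegral_ball_dist_rpow_le h.one_le he
  refine ⟨(A * (D + 1) ^ e).toNNReal, fun x hx => ?_⟩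
  refine (lintegral_mono_set fun y hy => ?_).trans (hball x (D + 1) (by linarith [h.D_pos]))
  rw [Metric.mem_ball]
  linarith [h.dist_le y hy x hx]

lemma eGreen_le_eRiesz (h : IsGreenKernel Ω s γ C D G) (f : Eu n → ℝ≥0∞) {x : Eu n} (hx : x ∈ Ω) :
    eGreen Ω G f x ≤ ENNReal.ofReal C * eRiesz Ω (2 * s) f x := by
  rw [eRiesz, ← lintegral_const_mul' _ _ ENNReal.ofReal_ne_top]
  refine lintegral_mono_ae ?_
  filter_upwards [h.ae_ne x] with y hy
  rw [← mul_assoc, ← ENNReal.ofReal_mul h.C_pos.le, h.enorm_eq hx hy.1 hy.2.symm]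
  gcongr
  exact (h.upper x hx y hy.1 hy.2.symm).trans
    (mul_le_mul_of_nonneg_left (modelKernel_le_riesz x y) h.C_pos.le)

/-- Tonelli and the symmetry of the kernel. No integrability is needed, so bounds on 𝔾₀ applied to a
weight become weighted L¹ bounds for 𝔾₀. -/
lemma lintegral_mul_eGreen (h : IsGreenKernel Ω s γ C D G) {f g : Eu n → ℝ≥0∞} (hf : Measurable f)
    (hg : Measurable g) :
    ∫⁻ x in Ω, g x * eGreen Ω G f x = ∫⁻ x in Ω, f x * eGreen Ω G g x := by
  have hm := h.measurable_enorm
  have e1 : ∀ x, g x * eGreen Ω G f x = ∫⁻ y in Ω, g x * (‖G x y‖ₑ * f y) := fun x => by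
    have := h.measurable_enorm_right x
    rw [eGreen, lintegral_const_mul _ (by fun_prop)]
  simp_rw [e1]
  rw [lintegral_lintegral_swap]
  · refine setLIntegral_congr_fun h.measurableSet fun y hy => ?_
    simp only [eGreen]
    have := h.measurable_enorm_right y
    rw [← lintegral_const_mul _ (by fun_prop)]
    refine setLIntegral_congr_fun h.measurableSet fun x hx => ?_
    simp only [h.enorm_symm hx hy]
    ring
  · exact ((hg.comp measurable_fst).mul (hm.mul (hf.comp measurable_snd))).aemeasurable

/-- The 3G inequality integrated in z gives ∫ G(x,z) G(z,y) dz ≤ M G(x,y). Of the factor C³, two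
powers come from upper bounds and one from the lower bound. -/
lemma eGreen_eGreen_le (h : IsGreenKernel Ω s γ C D G) :
    ∃ M : ℝ≥0, ∀ f : Eu n → ℝ≥0∞, Measurable f → ∀ x ∈ Ω,
      eGreen Ω G (eGreen Ω G f) x ≤ M * eGreen Ω G f x := by
  obtain ⟨A, hA⟩ := h.lintegral_riesz_le (e := 2 * s) (by linarith [h.s_pos])
  set M₀ : ℝ := 2 ^ (n - 2 * s) * 2 ^ γ * (2 * 2 ^ γ) with hM₀
  have hM₀0 : 0 < M₀ := by positivity
  have hC := h.C_pos
  have hm := h.measurable_enorm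
  refine ⟨(C ^ 3 * M₀).toNNReal * (A + A), fun f hf x hx => ?_⟩
  have key : ∀ y ∈ Ω, y ≠ x → ∫⁻ z in Ω, ‖G x z‖ₑ * ‖G z y‖ₑ ≤
      ((C ^ 3 * M₀).toNNReal * (A + A) : ℝ≥0) * ‖G x y‖ₑ := fun y hy hyx => by
    calc ∫⁻ z in Ω, ‖G x z‖ₑ * ‖G z y‖ₑ
        ≤ ∫⁻ z in Ω, (ENNReal.ofReal (C ^ 3 * M₀) * ‖G x y‖ₑ) *
            (ENNReal.ofReal (dist x z ^ (2 * s - n)) + ENNReal.ofReal (dist y z ^ (2 * s - n))) := by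
          refine lintegral_mono_ae ?_
          filter_upwards [h.ae_ne x, h.ae_ne y] with z hz hzy
          rw [h.enorm_eq hx hz.1 hz.2.symm, h.enorm_eq hz.1 hy hzy.2, h.enorm_eq hx hy hyx.symm,
            ← ENNReal.ofReal_mul (h.pos hx hz.1 hz.2.symm).le,
            ← ENNReal.ofReal_mul (by positivity), ← ENNReal.ofReal_add (by positivity)
            (by positivity), ← ENNReal.ofReal_mul
            (mul_nonneg (by positivity) (h.pos hx hy hyx.symm).le)]
          refine ENNReal.ofReal_le_ofReal ?_
          have h3 := modelKernel_mul_modelKernel_le (s := s) (γ := γ) h.two_s_lt.le h.γ_pos.le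
            h.γ_le (h.delta_pos x hx) (h.delta_pos y hy) (h.delta_pos z hz.1) hyx.symm hz.2 hzy.2
          rw [← hM₀] at h3
          have hl := h.lower x hx y hy hyx.symm
          rw [inv_mul_le_iff₀ hC] at hl
          have hKz := modelKernel_pos (s := s) (γ := γ) (h.delta_pos x hx) (h.delta_pos z hz.1)
            hz.2.symm
          calc G x z * G z y ≤ (C * modelKernel Ω s γ x z) * (C * modelKernel Ω s γ z y) :=
                mul_le_mul (h.upper x hx z hz.1 hz.2.symm) (h.upper z hz.1 y hy hzy.2)
                  (h.pos hz.1 hy hzy.2).le (by positivity)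
            _ = C ^ 2 * (modelKernel Ω s γ x z * modelKernel Ω s γ z y) := by ring
            _ ≤ C ^ 2 * (M₀ * (modelKernel Ω s γ x y *
                  (dist x z ^ (2 * s - n) + dist z y ^ (2 * s - n)))) := by gcongr
            _ ≤ C ^ 2 * (M₀ * ((C * G x y) *
                  (dist x z ^ (2 * s - n) + dist z y ^ (2 * s - n)))) := by gcongr
            _ = _ := by rw [dist_comm z y]; ring
      _ = (ENNReal.ofReal (C ^ 3 * M₀) * ‖G x y‖ₑ) *
            ((∫⁻ z in Ω, ENNReal.ofReal (dist x z ^ (2 * s - n))) +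
              ∫⁻ z in Ω, ENNReal.ofReal (dist y z ^ (2 * s - n))) := by
          rw [lintegral_const_mul _ (by fun_prop), lintegral_add_left (by fun_prop)]
      _ ≤ (ENNReal.ofReal (C ^ 3 * M₀) * ‖G x y‖ₑ) * (A + A) := by
          gcongr
          · exact hA x hx
          · exact hA y hy
      _ = _ := by
          push_cast
          rw [ENNReal.ofReal]
          ring
  have e1 : eGreen Ω G (eGreen Ω G f) x =
      ∫⁻ y in Ω, (∫⁻ z in Ω, ‖G x z‖ₑ * ‖G z y‖ₑ) * f y := by
    have hx1 := h.measurable_enorm_right x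
    have e2 : ∀ z, ‖G x z‖ₑ * eGreen Ω G f z = ∫⁻ y in Ω, ‖G x z‖ₑ * (‖G z y‖ₑ * f y) := fun z => by
      have := h.measurable_enorm_right z
      rw [eGreen, lintegral_const_mul _ (by fun_prop)]
    change ∫⁻ z in Ω, ‖G x z‖ₑ * eGreen Ω G f z = _
    simp_rw [e2]
    rw [lintegral_lintegral_swap]
    · refine lintegral_congr fun y => ?_
      have := h.measurable_enorm_left y
      rw [← lintegral_mul_const _ (by fun_prop)]
      refine lintegral_congr fun z => ?_
      ring
    · exact ((hx1.comp measurable_fst).mul (hm.mul (hf.comp measurable_snd))).aemeasurable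
  rw [e1, eGreen, ← lintegral_const_mul' _ _ ENNReal.coe_ne_top]
  refine lintegral_mono_ae ?_
  filter_upwards [h.ae_ne x] with y hy
  rw [← mul_assoc]
  gcongr
  exact key y hy.1 hy.2

lemma eGreen_le_of_le (h : IsGreenKernel Ω s γ C D G) {f g : Eu n → ℝ≥0∞}
    (hfg : ∀ x ∈ Ω, f x ≤ g x) (x : Eu n) : eGreen Ω G f x ≤ eGreen Ω G g x :=
  eGreen_mono ((ae_restrict_iff' h.measurableSet).2 (Eventually.of_forall hfg)) x

/-- Domination starts with the first power; the identity is not dominated by the Green operator,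
hence the exponent `k + 1`. -/
lemma iterate_eGreen_le (h : IsGreenKernel Ω s γ C D G) (k : ℕ) :
    ∃ M : ℝ≥0, ∀ f : Eu n → ℝ≥0∞, Measurable f → ∀ x ∈ Ω,
      (eGreen Ω G)^[k + 1] f x ≤ M * eGreen Ω G f x := by
  obtain ⟨A, hA⟩ := h.eGreen_eGreen_le
  induction k with
  | zero => exact ⟨1, fun f _ x _ => by simp⟩
  | succ k ih =>
    obtain ⟨M, hM⟩ := ih
    refine ⟨M * A, fun f hf x hx => ?_⟩
    rw [Function.iterate_succ_apply']
    calc _ ≤ eGreen Ω G (fun y => M * eGreen Ω G f y) x := h.eGreen_le_of_le (hM f hf) x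
      _ = M * eGreen Ω G (eGreen Ω G f) x := eGreen_const_mul ENNReal.coe_ne_top _ _
      _ ≤ M * (A * eGreen Ω G f x) := by gcongr; exact hA f hf x hx
      _ = _ := by push_cast; ring

/-- On a bounded set the kernel is at least a multiple of δ^γ(x) δ^γ(y). This is what absorbs the
smooth remainder of the resolvent. -/
lemma le_eGreen (h : IsGreenKernel Ω s γ C D G) :
    ∃ M : ℝ≥0, ∀ f : Eu n → ℝ≥0∞, ∀ x ∈ Ω,
      ENNReal.ofReal (bdryDist Ω x ^ γ) * ∫⁻ y in Ω, ENNReal.ofReal (bdryDist Ω y ^ γ) * f y ≤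
        M * eGreen Ω G f x := by
  have hD := h.D_pos
  have hC := h.C_pos
  set c := D ^ (2 * s - n) / (D ^ γ) ^ 2 with hc
  have hc0 : 0 < c := by positivity
  refine ⟨(C * c⁻¹).toNNReal, fun f x hx => ?_⟩
  rw [eGreen, ← lintegral_const_mul' _ _ ENNReal.coe_ne_top,
    ← lintegral_const_mul' _ _ ENNReal.ofReal_ne_top]
  refine lintegral_mono_ae ?_
  filter_upwards [h.ae_ne x] with y hy
  have hx0 := h.delta_pos x hx
  have hy0 := h.delta_pos y hy.1
  rw [← mul_assoc, ← mul_assoc, h.enorm_eq hx hy.1 hy.2.symm,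
    ← ENNReal.ofReal_mul (by positivity)]
  change _ ≤ ENNReal.ofReal (C * c⁻¹) * _ * _
  rw [← ENNReal.ofReal_mul (by positivity)]
  refine mul_le_mul' (ENNReal.ofReal_le_ofReal ?_) le_rfl
  have h1 := le_modelKernel (s := s) h.two_s_lt.le h.γ_pos.le hx0 hy0 (h.delta_le x hx)
    (h.delta_le y hy.1) hy.2.symm (h.dist_le x hx y hy.1)
  have h2 := h.lower x hx y hy.1 hy.2.symm
  rw [inv_mul_le_iff₀ hC] at h2
  rw [← hc] at h1
  rw [mul_assoc, mul_left_comm, le_inv_mul_iff₀ hc0]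
  exact h1.trans h2

/-- Moves the weight through the kernel: δ^γ(x) G(x,y) ≤ 2C |x-y|^{2s-n} δ^γ(y). Interior estimates
and the finiteness of 𝔾₀(δ^α) depend on it. -/
lemma rpow_mul_eGreen_le (h : IsGreenKernel Ω s γ C D G) (f : Eu n → ℝ≥0∞) {x : Eu n}
    (hx : x ∈ Ω) : ENNReal.ofReal (bdryDist Ω x ^ γ) * eGreen Ω G f x ≤
      ENNReal.ofReal (2 * C) *
        eRiesz Ω (2 * s) (fun y => ENNReal.ofReal (bdryDist Ω y ^ γ) * f y) x := by
  have hC := h.C_pos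
  rw [eRiesz, eGreen, ← lintegral_const_mul' _ _ ENNReal.ofReal_ne_top,
    ← lintegral_const_mul' _ _ ENNReal.ofReal_ne_top]
  refine lintegral_mono_ae ?_
  filter_upwards [h.ae_ne x] with y hy
  have hx0 := h.delta_pos x hx
  have hy0 := h.delta_pos y hy.1
  rw [← mul_assoc, ← mul_assoc, ← mul_assoc, h.enorm_eq hx hy.1 hy.2.symm,
    ← ENNReal.ofReal_mul (by positivity), ← ENNReal.ofReal_mul (by positivity),
    ← ENNReal.ofReal_mul (by positivity)]
  refine mul_le_mul' (ENNReal.ofReal_le_ofReal ?_) le_rfl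
  have h1 := modelKernel_mul_rpow_le (s := s) (γ := γ) hy0 hy.2 h.γ_le h.γ_pos.le le_rfl
    (by linarith) (y := x)
  rw [modelKernel_comm y x, dist_comm y x, sub_zero, add_zero] at h1
  calc _ ≤ bdryDist Ω x ^ γ * (C * modelKernel Ω s γ x y) := by
        gcongr
        exact h.upper x hx y hy.1 hy.2.symm
    _ = C * (modelKernel Ω s γ x y * bdryDist Ω x ^ γ) := by ring
    _ ≤ C * (2 * (dist x y ^ (2 * s - n) * bdryDist Ω y ^ γ)) :=
        mul_le_mul_of_nonneg_left h1 hC.le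
    _ = _ := by ring

/-- A gain of ε powers of δ, with ε < 2s so that the remaining kernel is integrable. The case b = γ,
ε = 0 is 𝔾₀(δ^γ) ≤ M δ^γ. -/
lemma eGreen_rpow_le (h : IsGreenKernel Ω s γ C D G) {b ε : ℝ} (hb : 0 ≤ b) (hε : 0 ≤ ε)
    (hbε : b + ε ≤ γ) (hεs : ε < 2 * s) :
    ∃ M : ℝ≥0, ∀ x ∈ Ω, eGreen Ω G (fun y => ENNReal.ofReal (bdryDist Ω y ^ b)) x ≤
      M * ENNReal.ofReal (bdryDist Ω x ^ (b + ε)) := by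
  obtain ⟨A, hA⟩ := h.lintegral_riesz_le (e := 2 * s - ε) (by linarith)
  have hC := h.C_pos
  refine ⟨(2 * C).toNNReal * A, fun x hx => ?_⟩
  have hx0 := h.delta_pos x hx
  calc _ ≤ ∫⁻ y in Ω, ENNReal.ofReal (2 * C * bdryDist Ω x ^ (b + ε)) *
        ENNReal.ofReal (dist x y ^ (2 * s - ε - n)) := by
        refine lintegral_mono_ae ?_
        filter_upwards [h.ae_ne x] with y hy
        have hy0 := h.delta_pos y hy.1
        rw [h.enorm_eq hx hy.1 hy.2.symm, ← ENNReal.ofReal_mul (h.pos hx hy.1 hy.2.symm).le,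
          ← ENNReal.ofReal_mul (by positivity)]
        refine ENNReal.ofReal_le_ofReal ?_
        calc _ ≤ C * modelKernel Ω s γ x y * bdryDist Ω y ^ b := by
              gcongr
              exact h.upper x hx y hy.1 hy.2.symm
          _ = C * (modelKernel Ω s γ x y * bdryDist Ω y ^ b) := by ring
          _ ≤ C * (2 * (dist x y ^ (2 * s - ε - n) * bdryDist Ω x ^ (b + ε))) := by
              exact mul_le_mul_of_nonneg_left
                (modelKernel_mul_rpow_le hx0 hy.2.symm h.γ_le hb hε hbε) hC.le
          _ = _ := by ring
    _ = ENNReal.ofReal (2 * C * bdryDist Ω x ^ (b + ε)) *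
        ∫⁻ y in Ω, ENNReal.ofReal (dist x y ^ (2 * s - ε - n)) :=
        lintegral_const_mul' _ _ ENNReal.ofReal_ne_top
    _ ≤ ENNReal.ofReal (2 * C * bdryDist Ω x ^ (b + ε)) * A := by
        gcongr
        exact hA x hx
    _ = _ := by
        rw [ENNReal.ofReal_mul (by positivity), ENNReal.ofReal]
        push_cast
        ring

lemma eRiesz_eRiesz_le (h : IsGreenKernel Ω s γ C D G) {a b ε : ℝ} (hε : 0 < ε) (hεa : ε ≤ a)
    (hεb : ε ≤ b) (hab : a + b - ε ≤ n) :
    ∃ M : ℝ≥0, ∀ f : Eu n → ℝ≥0∞, Measurable f → ∀ x ∈ Ω,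
      eRiesz Ω a (eRiesz Ω b f) x ≤ M * eRiesz Ω (a + b - ε) f x := by
  obtain ⟨A, hA⟩ := h.lintegral_riesz_le hε
  set M₀ : ℝ := 2 ^ (n + ε - a - b) with hM₀
  have hM₀0 : 0 < M₀ := by positivity
  refine ⟨M₀.toNNReal * (A + A), fun f hf x hx => ?_⟩
  have key : ∀ y ∈ Ω, y ≠ x → ∫⁻ z in Ω, ENNReal.ofReal (dist x z ^ (a - n)) *
      ENNReal.ofReal (dist z y ^ (b - n)) ≤
      (M₀.toNNReal * (A + A) : ℝ≥0) * ENNReal.ofReal (dist x y ^ (a + b - ε - n)) :=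
    fun y hy hyx => by
    calc _ ≤ ∫⁻ z in Ω, ENNReal.ofReal (M₀ * dist x y ^ (a + b - ε - n)) *
            (ENNReal.ofReal (dist x z ^ (ε - n)) + ENNReal.ofReal (dist y z ^ (ε - n))) := by
          refine lintegral_mono_ae ?_
          filter_upwards [h.ae_ne x, h.ae_ne y] with z hz hzy
          rw [← ENNReal.ofReal_mul (by positivity), ← ENNReal.ofReal_add (by positivity)
            (by positivity), ← ENNReal.ofReal_mul (by positivity), dist_comm y z]
          exact ENNReal.ofReal_le_ofReal (riesz_mul_riesz_le hyx.symm hz.2 hzy.2 hεa hεb hab)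
      _ = ENNReal.ofReal (M₀ * dist x y ^ (a + b - ε - n)) *
            ((∫⁻ z in Ω, ENNReal.ofReal (dist x z ^ (ε - n))) +
              ∫⁻ z in Ω, ENNReal.ofReal (dist y z ^ (ε - n))) := by
          rw [lintegral_const_mul _ (by fun_prop), lintegral_add_left (by fun_prop)]
      _ ≤ ENNReal.ofReal (M₀ * dist x y ^ (a + b - ε - n)) * (A + A) := by
          gcongr
          · exact hA x hx
          · exact hA y hy
      _ = _ := by
          rw [ENNReal.ofReal_mul (by positivity), ENNReal.ofReal]
          push_cast
          ring
  have e1 : eRiesz Ω a (eRiesz Ω b f) x =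
      ∫⁻ y in Ω, (∫⁻ z in Ω, ENNReal.ofReal (dist x z ^ (a - n)) *
        ENNReal.ofReal (dist z y ^ (b - n))) * f y := by
    have e2 : ∀ z, ENNReal.ofReal (dist x z ^ (a - n)) * eRiesz Ω b f z =
        ∫⁻ y in Ω, ENNReal.ofReal (dist x z ^ (a - n)) *
          (ENNReal.ofReal (dist z y ^ (b - n)) * f y) := fun z => by
      rw [eRiesz, lintegral_const_mul _ (by fun_prop)]
    change ∫⁻ z in Ω, ENNReal.ofReal (dist x z ^ (a - n)) * eRiesz Ω b f z = _
    simp_rw [e2]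
    rw [lintegral_lintegral_swap (by fun_prop)]
    refine lintegral_congr fun y => ?_
    rw [← lintegral_mul_const _ (by fun_prop)]
    refine lintegral_congr fun z => ?_
    ring
  rw [e1, eRiesz, ← lintegral_const_mul' _ _ ENNReal.coe_ne_top]
  refine lintegral_mono_ae ?_
  filter_upwards [h.ae_ne x] with y hy
  rw [← mul_assoc]
  gcongr
  exact key y hy.1 hy.2

lemma iterate_eGreen_le_eRiesz (h : IsGreenKernel Ω s γ C D G) (k : ℕ) :
    ∃ M : ℝ≥0, ∀ f : Eu n → ℝ≥0∞, Measurable f → ∀ x ∈ Ω,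
      (eGreen Ω G)^[k + 1] f x ≤ M * eRiesz Ω (min ((k + 2) * s) n) f x := by
  have hs := h.s_pos
  have hsn := h.two_s_lt
  induction k with
  | zero =>
    refine ⟨C.toNNReal, fun f _ x hx => ?_⟩
    have : min (((0 : ℕ) + 2) * s) (n : ℝ) = 2 * s := by
      rw [min_eq_left (by push_cast; linarith)]; push_cast; ring
    rw [this]
    exact h.eGreen_le_eRiesz f hx
  | succ k ih =>
    obtain ⟨M, hM⟩ := ih
    set b := min ((k + 2) * s) (n : ℝ) with hb
    set b' := min (((k + 1 : ℕ) + 2) * s) (n : ℝ) with hb'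
    have hk : (0 : ℝ) ≤ k * s := by positivity
    have h1 : b' ≤ b + s := by
      rw [hb, hb', ← min_add_add_right]
      refine min_le_min (by push_cast; linarith) (by linarith)
    have h2 : b ≤ b' := by
      refine min_le_min ?_ le_rfl
      push_cast
      linarith
    have h3 : 2 * s ≤ b' := le_min (by push_cast; linarith) hsn.le
    have h4 : b' ≤ n := min_le_right _ _
    -- Each step raises the order by at most s, not 2s: then the loss ε is at least s > 0. The order
    -- stops at n, where the Riesz kernel is the constant 1.
    obtain ⟨A, hA⟩ := h.eRiesz_eRiesz_le (a := 2 * s) (b := b) (ε := 2 * s + b - b') (by linarith)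
      (by linarith) (by linarith) (by linarith)
    rw [sub_sub_cancel] at hA
    refine ⟨M * (C.toNNReal * A), fun f hf x hx => ?_⟩
    rw [Function.iterate_succ_apply']
    calc _ ≤ eGreen Ω G (fun y => M * eRiesz Ω b f y) x := h.eGreen_le_of_le (hM f hf) x
      _ = M * eGreen Ω G (eRiesz Ω b f) x := eGreen_const_mul ENNReal.coe_ne_top _ _
      _ ≤ M * (C.toNNReal * eRiesz Ω (2 * s) (eRiesz Ω b f) x) := by
          gcongr
          exact h.eGreen_le_eRiesz _ hx
      _ ≤ M * (C.toNNReal * (A * eRiesz Ω b' f x)) := by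
          gcongr
          exact hA f hf x hx
      _ = _ := by push_cast; ring

lemma iterate_eGreen_one_le (h : IsGreenKernel Ω s γ C D G) (k : ℕ) :
    ∃ M : ℝ≥0, ∀ x ∈ Ω, (eGreen Ω G)^[k] (fun _ => 1) x ≤
      M * ENNReal.ofReal (bdryDist Ω x ^ (min (k * s) γ)) := by
  have hs := h.s_pos
  have hγ := h.γ_pos
  induction k with
  | zero => exact ⟨1, fun x _ => by simp [hγ.le]⟩
  | succ k ih =>
    obtain ⟨M, hM⟩ := ih
    set b := min (k * s) γ with hb
    set b' := min ((k + 1 : ℕ) * s) γ with hb'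
    have h1 : b' ≤ b + s := by
      rw [hb, hb', ← min_add_add_right]
      refine min_le_min (by push_cast; linarith) (by linarith)
    have h2 : b ≤ b' := by
      refine min_le_min ?_ le_rfl
      push_cast
      linarith
    have h3 : 0 ≤ b := le_min (by positivity) hγ.le
    -- The gain b' - b is at most s, hence below the limit 2s.
    obtain ⟨A, hA⟩ := h.eGreen_rpow_le (b := b) (ε := b' - b) h3 (by linarith)
      (by rw [add_sub_cancel]; exact min_le_right _ _) (by linarith)
    rw [add_sub_cancel] at hA
    refine ⟨M * A, fun x hx => ?_⟩
    rw [Function.iterate_succ_apply']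
    calc _ ≤ eGreen Ω G (fun y => M * ENNReal.ofReal (bdryDist Ω y ^ b)) x :=
          h.eGreen_le_of_le hM x
      _ = M * eGreen Ω G (fun y => ENNReal.ofReal (bdryDist Ω y ^ b)) x :=
          eGreen_const_mul ENNReal.coe_ne_top _ _
      _ ≤ M * (A * ENNReal.ofReal (bdryDist Ω x ^ b')) := by
          gcongr
          exact hA x hx
      _ = _ := by push_cast; ring

lemma iterate_eGreen_const_mul (h : IsGreenKernel Ω s γ C D G) {c : ℝ≥0∞} (hc : c ≠ ∞) (k : ℕ)
    {f g : Eu n → ℝ≥0∞} (hfg : ∀ x ∈ Ω, f x ≤ c * g x) :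
    ∀ x ∈ Ω, (eGreen Ω G)^[k] f x ≤ c * (eGreen Ω G)^[k] g x := by
  induction k with
  | zero => exact hfg
  | succ k ih =>
    intro x _
    rw [Function.iterate_succ_apply', Function.iterate_succ_apply', ← eGreen_const_mul hc]
    exact h.eGreen_le_of_le ih x

/-- High powers of the Green operator map `L¹(Ω)` to `δ^γ L^∞(Ω)`. -/
theorem exists_iterate_eGreen_le (h : IsGreenKernel Ω s γ C D G) :
    ∃ N : ℕ, ∀ m : ℕ, N ≤ m → ∃ M : ℝ≥0, ∀ f : Eu n → ℝ≥0∞, Measurable f → ∫⁻ y in Ω, f y < ∞ →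
      ∀ x ∈ Ω, (eGreen Ω G)^[m] f x ≤
        M * ENNReal.ofReal (bdryDist Ω x ^ γ) * ∫⁻ y in Ω, f y := by
  have hs := h.s_pos
  obtain ⟨N₁, hN₁⟩ := exists_nat_ge (n / s)
  obtain ⟨N₂, hN₂⟩ := exists_nat_ge (γ / s)
  rw [div_le_iff₀ hs] at hN₁ hN₂
  -- The first N₁ + 1 applications reach the constant kernel, that is L¹ to L^∞; the other N₂ + j
  -- turn a constant into δ^γ.
  refine ⟨N₂ + (N₁ + 1), fun m hm => ?_⟩
  obtain ⟨j, rfl⟩ := Nat.exists_eq_add_of_le hm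
  obtain ⟨M₁, hM₁⟩ := h.iterate_eGreen_le_eRiesz N₁
  obtain ⟨M₂, hM₂⟩ := h.iterate_eGreen_one_le (N₂ + j)
  rw [min_eq_right (by linarith)] at hM₁
  rw [min_eq_right (by push_cast; nlinarith [Nat.cast_nonneg (α := ℝ) j])] at hM₂
  refine ⟨M₁ * M₂, fun f hf hfin x hx => ?_⟩
  rw [show N₂ + (N₁ + 1) + j = (N₂ + j) + (N₁ + 1) by ring, Function.iterate_add_apply]
  have hbd : ∀ y ∈ Ω, (eGreen Ω G)^[N₁ + 1] f y ≤ (M₁ * ∫⁻ y in Ω, f y) * 1 := fun y hy => by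
    refine (hM₁ f hf y hy).trans ?_
    simp [eRiesz]
  refine (h.iterate_eGreen_const_mul (ENNReal.mul_ne_top ENNReal.coe_ne_top hfin.ne) _ hbd x
    hx).trans ?_
  calc _ ≤ (M₁ * ∫⁻ y in Ω, f y) * (M₂ * ENNReal.ofReal (bdryDist Ω x ^ γ)) := by
        gcongr
        exact hM₂ x hx
    _ = _ := by push_cast; ring

end IsGreenKernel

/-! ### A spectral theorem for operators with a Hilbert–Schmidt power. -/

section Spectral

/-- Ties of f are broken by an injection into ℕ. In the resulting strict order every element has
finitely many predecessors; their number is an injective rank, and listing the values of the rank in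
increasing order enumerates the index set. -/
lemma exists_equiv_monotone {ι : Type*} [Infinite ι] {f : ι → ℝ}
    (hf : ∀ R : ℝ, {i | f i ≤ R}.Finite) : ∃ e : ℕ ≃ ι, Monotone (f ∘ e) := by
  classical
  have hcount : Countable ι := by
    have : (⋃ k : ℕ, {i | f i ≤ (k : ℝ)}) = Set.univ := by
      ext i
      simpa using exists_nat_ge (f i)
    rw [← Set.countable_univ_iff, ← this]
    exact Set.countable_iUnion fun k => (hf k).countable
  obtain ⟨c, hc⟩ := Countable.exists_injective_nat ι
  let key : ι → ℝ ×ₗ ℕ := fun i => toLex (f i, c i)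
  have hkey : Function.Injective key := fun i j hij => by
    have := toLex.injective hij
    exact hc (Prod.ext_iff.1 this).2
  have hkf : ∀ {i j}, key i ≤ key j → f i ≤ f j := fun {i j} hij => by
    rcases Prod.Lex.le_iff.1 hij with h | h
    · exact h.le
    · exact h.1.le
  have hfin : ∀ i, {j | key j < key i}.Finite := fun i =>
    (hf (f i)).subset fun j hj => hkf (le_of_lt hj)
  let r : ι → ℕ := fun i => {j | key j < key i}.ncard
  have hr : ∀ {i j}, key i < key j → r i < r j := fun {i j} hij =>
    Set.ncard_lt_ncard ⟨fun k hk => lt_trans hk hij, fun h => lt_irrefl (key i) (show key i < key i from h hij)⟩ (hfin j)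
  have hrinj : Function.Injective r := fun i j hij => by
    by_contra hne
    rcases lt_or_gt_of_ne (fun h => hne (hkey h)) with h | h
    · exact (hr h).ne hij
    · exact (hr h).ne' hij
  have hrle : ∀ {i j}, r i ≤ r j → f i ≤ f j := fun {i j} hij => by
    refine hkf (not_lt.1 fun h => ?_)
    exact absurd (hr h) (not_lt.2 hij)
  have : Infinite (Set.range r) := Set.infinite_coe_iff.2 (Set.infinite_range_of_injective hrinj)
  let o := Nat.Subtype.orderIsoOfNat (Set.range r)
  let e : ℕ ≃ ι := o.toEquiv.trans (Equiv.ofInjective r hrinj).symm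
  have he : ∀ k, r (e k) = o k := fun k => Equiv.apply_ofInjective_symm hrinj (o k)
  refine ⟨e, fun a b hab => hrle ?_⟩
  rw [he, he]
  exact o.monotone hab

variable {H : Type*} [NormedAddCommGroup H] [InnerProductSpace ℝ H]

lemma sum_norm_sq_le_of_orthonormal {A : H →L[ℝ] H} {S : ℝ}
    (hS : ∀ (k : ℕ) (e : Fin k → H), Orthonormal ℝ e → ∑ i, ‖A (e i)‖ ^ 2 ≤ S)
    {ι : Type*} {v : ι → H} (hv : Orthonormal ℝ v) (t : Finset ι) :
    ∑ i ∈ t, ‖A (v i)‖ ^ 2 ≤ S := by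
  rw [← Finset.sum_coe_sort, ← Equiv.sum_comp t.equivFin.symm]
  exact hS _ (fun i => v (t.equivFin.symm i))
    (hv.comp _ (Subtype.val_injective.comp t.equivFin.symm.injective))

/-- For symmetric B, ‖By‖² = ⟨B²y, y⟩ ≤ ‖B²y‖ ‖y‖; repeated squaring gives the claim. Smallness of a
power of T thus passes to T itself. -/
lemma norm_apply_pow_two_pow_le {T : H →L[ℝ] H} (hT : T.IsSymmetric) (j : ℕ) (y : H) :
    ‖T y‖ ^ 2 ^ j ≤ ‖(T ^ 2 ^ j) y‖ * ‖y‖ ^ (2 ^ j - 1) := by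
  induction j with
  | zero => simp
  | succ j ih =>
    set B := T ^ 2 ^ j with hB
    have hBsymm : B.IsSymmetric := by
      have := LinearMap.IsSymmetric.pow hT (2 ^ j)
      rwa [← ContinuousLinearMap.toLinearMap_pow] at this
    have hB2 : T ^ 2 ^ (j + 1) = B * B := by
      rw [hB, ← pow_add, pow_succ, mul_two]
    have h1 : ‖B y‖ ^ 2 ≤ ‖(B * B) y‖ * ‖y‖ := by
      rw [← real_inner_self_eq_norm_sq]
      have : inner ℝ (B y) (B y) = inner ℝ ((B * B) y) y := (hBsymm (B y) y).symm
      rw [this]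
      exact real_inner_le_norm _ _
    have h2 : 1 ≤ 2 ^ j := Nat.one_le_two_pow
    calc ‖T y‖ ^ 2 ^ (j + 1) = (‖T y‖ ^ 2 ^ j) ^ 2 := by rw [← pow_mul, pow_succ]
      _ ≤ (‖B y‖ * ‖y‖ ^ (2 ^ j - 1)) ^ 2 := by gcongr
      _ = ‖B y‖ ^ 2 * ‖y‖ ^ (2 * (2 ^ j - 1)) := by rw [mul_pow, ← pow_mul, mul_comm 2]
      _ ≤ (‖(B * B) y‖ * ‖y‖) * ‖y‖ ^ (2 * (2 ^ j - 1)) := by gcongr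
      _ = _ := by
          rw [hB2, mul_assoc, ← pow_succ']
          congr 2
          rw [pow_succ]
          omega

variable [CompleteSpace H]

/-- A symmetric operator is compact if one of its powers `T ^ 2 ^ j` is Hilbert–Schmidt. -/
theorem isCompactOperator_of_pow_hilbertSchmidt {T : H →L[ℝ] H} (hT : T.IsSymmetric) {j : ℕ}
    {S : ℝ} (hS : ∀ (k : ℕ) (e : Fin k → H), Orthonormal ℝ e →
      ∑ i, ‖(T ^ 2 ^ j) (e i)‖ ^ 2 ≤ S) : IsCompactOperator T := by
  classical
  obtain ⟨w, b, -⟩ := exists_hilbertBasis ℝ H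
  set A := T ^ 2 ^ j with hA
  let P : Finset w → H →L[ℝ] H := fun F =>
    ∑ i ∈ F, (innerSL ℝ (b i)).smulRight (b i)
  have hPapp : ∀ F x, P F x = ∑ i ∈ F, inner ℝ (b i) x • b i := fun F x => by
    simp [P]
  have hcomp : ∀ F, IsCompactOperator (T ∘L P F) := fun F => by
    have h1 : IsCompactOperator (P F) := by
      have : P F ∈ compactOperator (RingHom.id ℝ) H H := by
        refine Submodule.sum_mem _ fun i _ => ?_
        have h2 : IsCompactOperator (innerSL ℝ (b i)) :=
          isCompactOperator_of_locallyCompactSpace_dom (innerSL ℝ (b i))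
        exact h2.clm_comp (ContinuousLinearMap.toSpanSingleton ℝ (b i))
      exact this
    exact h1.clm_comp T
  have hsum : Summable fun i => ‖A (b i)‖ ^ 2 :=
    summable_of_sum_le (fun i => by positivity)
      (fun t => sum_norm_sq_le_of_orthonormal hS b.orthonormal t)
  -- By Cauchy–Schwarz, A restricted to the orthogonal complement of finitely many basis vectors is
  -- controlled by the tail of ∑ ‖A b_i‖².
  have htail : ∀ ε > 0, ∃ F₀ : Finset w, ∀ F, F₀ ⊆ F → ∀ x, ‖A (x - P F x)‖ ≤ ε * ‖x‖ := by
    intro ε hε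
    obtain ⟨F₀, hF₀⟩ := summable_iff_vanishing_norm.1 hsum (ε ^ 2) (by positivity)
    refine ⟨F₀, fun F hF x => ?_⟩
    have hlim : Tendsto (fun F' : Finset w => ‖A (∑ i ∈ F', inner ℝ (b i) x • b i - P F x)‖) atTop
        (𝓝 ‖A (x - P F x)‖) := by
      have h1 : Tendsto (fun F' : Finset w => ∑ i ∈ F', inner ℝ (b i) x • b i) atTop (𝓝 x) := by
        have := b.hasSum_repr x
        simp_rw [b.repr_apply_apply] at this
        exact this
      exact ((A.continuous.tendsto _).comp (h1.sub_const _)).norm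
    refine le_of_tendsto hlim ?_
    filter_upwards [eventually_ge_atTop F] with F' hF'
    rw [hPapp, ← Finset.sum_sdiff_eq_sub hF', map_sum]
    simp_rw [map_smul]
    have hdisj : Disjoint (F' \ F) F₀ :=
      Finset.disjoint_of_subset_right hF Finset.sdiff_disjoint
    have h2 := hF₀ _ hdisj
    rw [Real.norm_of_nonneg (Finset.sum_nonneg fun i _ => by positivity)] at h2
    have h3 : ∑ i ∈ F' \ F, |inner ℝ (b i) x| ^ 2 ≤ ‖x‖ ^ 2 := by
      have := b.orthonormal.sum_inner_products_le (s := F' \ F) x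
      simpa only [Real.norm_eq_abs] using this
    refine (norm_sum_le _ _).trans (abs_le_of_sq_le_sq' ?_ (by positivity)).2
    simp_rw [norm_smul, Real.norm_eq_abs]
    refine (Finset.sum_mul_sq_le_sq_mul_sq _ _ _).trans ?_
    rw [mul_pow, mul_comm]
    gcongr
  refine isCompactOperator_of_tendsto (l := atTop) (F := fun F => T ∘L P F) ?_
    (Eventually.of_forall hcomp)
  rw [Metric.tendsto_nhds]
  intro ε hε
  -- The power 2^j is undone by the root taken when passing from T^{2^j} back to T.
  obtain ⟨F₀, hF₀⟩ := htail ((ε / 2) ^ 2 ^ j) (by positivity)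
  filter_upwards [eventually_ge_atTop F₀] with F hF
  refine lt_of_le_of_lt ?_ (half_lt_self hε)
  rw [dist_comm, dist_eq_norm]
  refine ContinuousLinearMap.opNorm_le_bound _ (by positivity) fun x => ?_
  have h0 : (T - T ∘L P F) x = T (x - P F x) := by simp
  rw [h0]
  have hne : 2 ^ j ≠ 0 := by positivity
  refine (pow_le_pow_iff_left₀ (norm_nonneg _) (by positivity) hne).1 ?_
  have hQ : ‖x - P F x‖ ≤ ‖x‖ := by
    have h1 : inner ℝ (x - P F x) (P F x) = 0 := by
      rw [hPapp, inner_sum]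
      refine Finset.sum_eq_zero fun i hi => ?_
      rw [inner_smul_right, inner_sub_left, sum_inner]
      have : ∑ k ∈ F, inner ℝ (inner ℝ (b k) x • b k) (b i) = inner ℝ (b i) x := by
        rw [Finset.sum_eq_single i]
        · rw [real_inner_smul_left, real_inner_self_eq_norm_sq, b.orthonormal.1 i]; ring
        · intro k _ hki
          rw [real_inner_smul_left, b.orthonormal.2 hki, mul_zero]
        · exact fun h => absurd hi h
      rw [this, real_inner_comm]
      ring
    have h2 := norm_add_sq_real (x - P F x) (P F x)
    rw [h1, sub_add_cancel] at h2
    nlinarith [norm_nonneg (x - P F x), norm_nonneg x, sq_nonneg ‖P F x‖]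
  calc ‖T (x - P F x)‖ ^ 2 ^ j ≤ ‖A (x - P F x)‖ * ‖x - P F x‖ ^ (2 ^ j - 1) :=
        norm_apply_pow_two_pow_le hT j _
    _ ≤ ((ε / 2) ^ 2 ^ j * ‖x‖) * ‖x‖ ^ (2 ^ j - 1) := by
        gcongr
        exact hF₀ F hF x
    _ = (ε / 2 * ‖x‖) ^ 2 ^ j := by
        rw [mul_assoc, ← pow_succ', Nat.sub_add_cancel Nat.one_le_two_pow, mul_pow]

/-- The spectral theorem for a positive injective symmetric operator with a Hilbert–Schmidt power,
on an infinite-dimensional space. -/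
theorem exists_eigenbasis {T : H →L[ℝ] H} (hT : T.IsSymmetric) (hinf : ¬ FiniteDimensional ℝ H)
    (hpos : ∀ x, 0 ≤ inner ℝ (T x) x) (hinj : ∀ x, T x = 0 → x = 0) {j : ℕ}
    {S : ℝ} (hS : ∀ (k : ℕ) (e : Fin k → H), Orthonormal ℝ e →
      ∑ i, ‖(T ^ 2 ^ j) (e i)‖ ^ 2 ≤ S) :
    ∃ (lam : ℕ → ℝ) (φ : HilbertBasis ℕ ℝ H), (∀ k, 0 < lam k) ∧ Monotone lam ∧
      Tendsto lam atTop atTop ∧ ∀ k, φ k = T (lam k • φ k) := by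
  have hc := isCompactOperator_of_pow_hilbertSchmidt hT hS
  let E : ℝ → Submodule ℝ H := fun μ => Module.End.eigenspace (T : H →ₗ[ℝ] H) μ
  have hE : ∀ {μ x}, x ∈ E μ ↔ T x = μ • x := fun {μ x} => Module.End.mem_eigenspace_iff
  have hfd : ∀ μ, FiniteDimensional ℝ (E μ) := fun μ => by
    rcases eq_or_ne μ 0 with rfl | hμ
    · have : E 0 = ⊥ := by
        rw [Submodule.eq_bot_iff]
        intro x hx
        exact hinj x (by rw [hE.1 hx, zero_smul])
      rw [this]
      infer_instance
    · exact ContinuousLinearMap.finite_dimensional_eigenspace hc μ hμ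
  -- One index per eigenvalue and basis vector of its eigenspace, so multiplicities are counted; a
  -- real number that is not an eigenvalue has an empty fibre.
  let ι := Σ μ : ℝ, Fin (Module.finrank ℝ (E μ))
  let v : ι → H := fun i => (stdOrthonormalBasis ℝ (E i.1) i.2 : H)
  have hv : Orthonormal ℝ v :=
    hT.orthogonalFamily_eigenspaces.orthonormal_sigma_orthonormal
      (fun μ => (stdOrthonormalBasis ℝ (E μ)).orthonormal)
  have hTv : ∀ i, T (v i) = i.1 • v i := fun i => hE.1 (stdOrthonormalBasis ℝ (E i.1) i.2).2
  have hspan : (Submodule.span ℝ (Set.range v))ᗮ = ⊥ := by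
    rw [eq_bot_iff, ← ContinuousLinearMap.orthogonalComplement_iSup_eigenspaces_eq_bot hc hT]
    refine Submodule.orthogonal_le (iSup_le fun μ x hx => ?_)
    have h1 := (stdOrthonormalBasis ℝ (E μ)).sum_repr ⟨x, hx⟩
    have h2 := congrArg (Subtype.val : E μ → H) h1
    rw [Submodule.coe_sum] at h2
    change _ = x at h2
    rw [← h2]
    refine Submodule.sum_mem _ fun i _ => ?_
    rw [Submodule.coe_smul]
    exact Submodule.smul_mem _ _ (Submodule.subset_span ⟨⟨μ, i⟩, rfl⟩)
  let b : HilbertBasis ι ℝ H := HilbertBasis.mkOfOrthogonalEqBot hv hspan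
  have hb : ⇑b = v := HilbertBasis.coe_mkOfOrthogonalEqBot hv hspan
  have hμpos : ∀ i : ι, 0 < i.1 := fun i => by
    have h1 := hpos (v i)
    rw [hTv, real_inner_smul_left, real_inner_self_eq_norm_sq, hv.1 i, one_pow, mul_one] at h1
    refine lt_of_le_of_ne h1 fun h0 => ?_
    have h2 := hinj (v i) (by rw [hTv, ← h0, zero_smul])
    have h3 := hv.1 i
    rw [h2, norm_zero] at h3
    exact zero_ne_one h3
  have hι : Infinite ι := by
    by_contra hfin
    rw [not_infinite_iff_finite] at hfin
    have := Fintype.ofFinite ι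
    exact hinf (Module.Finite.of_basis b.toOrthonormalBasis.toBasis)
  have hAv : ∀ i m, (T ^ m) (v i) = i.1 ^ m • v i := fun i m => by
    induction m with
    | zero => simp
    | succ m ih => rw [pow_succ', mul_apply_eq_comp, ih, map_smul, hTv, smul_smul,
        pow_succ]
  -- Every eigenvector with eigenvalue at least 1/R contributes at least c to the Hilbert–Schmidt
  -- sum, so there are at most S/c of them.
  have hfinite : ∀ R : ℝ, {i : ι | (i.1)⁻¹ ≤ R}.Finite := fun R => by
    by_contra hcon
    have hinfS : {i : ι | (i.1)⁻¹ ≤ R}.Infinite := hcon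
    obtain ⟨i₀, hi₀⟩ := hinfS.nonempty
    have hR : 0 < R := (inv_pos.2 (hμpos i₀)).trans_le hi₀
    set c := ((R⁻¹) ^ 2 ^ j) ^ 2 with hcdef
    have hc0 : 0 < c := by positivity
    obtain ⟨k, hk⟩ := exists_nat_gt (S / c)
    obtain ⟨t, ht, htk⟩ := hinfS.exists_subset_card_eq k
    have h1 := sum_norm_sq_le_of_orthonormal hS hv t
    have h2 : ∑ i ∈ t, c ≤ ∑ i ∈ t, ‖(T ^ 2 ^ j) (v i)‖ ^ 2 := by
      refine Finset.sum_le_sum fun i hi => ?_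
      have h3 : (i.1)⁻¹ ≤ R := ht hi
      have h4 : R⁻¹ ≤ i.1 := inv_le_of_inv_le₀ (hμpos i) h3
      rw [hAv, norm_smul, hv.1 i, mul_one, Real.norm_of_nonneg (pow_nonneg (hμpos i).le _), hcdef]
      gcongr
    rw [Finset.sum_const, htk, nsmul_eq_mul] at h2
    rw [div_lt_iff₀ hc0] at hk
    linarith
  obtain ⟨e, he⟩ := exists_equiv_monotone hfinite
  have hφon : Orthonormal ℝ (fun k => v (e k)) := hv.comp _ e.injective
  have hφspan : (Submodule.span ℝ (Set.range fun k => v (e k)))ᗮ = ⊥ := by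
    have : (Set.range fun k => v (e k)) = Set.range v := e.surjective.range_comp v
    rw [this, hspan]
  refine ⟨fun k => ((e k).1)⁻¹, HilbertBasis.mkOfOrthogonalEqBot hφon hφspan,
    fun k => inv_pos.2 (hμpos _), he, ?_, fun k => ?_⟩
  · have h1 : Tendsto (fun i : ι => (i.1)⁻¹) cofinite atTop := by
      rw [tendsto_atTop]
      intro R
      refine (hfinite R).subset fun i hi => ?_
      exact (not_le.1 (show ¬ R ≤ (i.1)⁻¹ from hi)).le
    have h2 := h1.comp e.injective.tendsto_cofinite
    rwa [Nat.cofinite_eq_atTop] at h2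
  · rw [HilbertBasis.coe_mkOfOrthogonalEqBot, map_smul, hTv, smul_smul,
      inv_mul_cancel₀ (hμpos _).ne', one_smul]

end Spectral

/-! ### The Green operator on L². -/

/-- The sum of `‖A e_i‖²` over a finite orthonormal family is bounded if `A` maps `L²` to `L^∞`. -/
theorem sum_norm_sq_le_of_ae_bound {α : Type*} [MeasurableSpace α] {μ : Measure α}
    [IsFiniteMeasure μ] {A : Lp ℝ 2 μ →L[ℝ] Lp ℝ 2 μ} {M : ℝ}
    (hA : ∀ f : Lp ℝ 2 μ, ∀ᵐ x ∂μ, ‖A f x‖ ≤ M * ‖f‖) {k : ℕ} {e : Fin k → Lp ℝ 2 μ}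
    (he : Orthonormal ℝ e) : ∑ i, ‖A (e i)‖ ^ 2 ≤ M ^ 2 * μ.real Set.univ := by
  -- One null set must serve all coefficient vectors: rational ones are countably many, and real
  -- ones follow by density at each fixed x.
  have hrat : ∀ᵐ x ∂μ, ∀ c : Fin k → ℚ,
      |∑ i, (c i : ℝ) * A (e i) x| ≤ M * √(∑ i, (c i : ℝ) ^ 2) := by
    rw [ae_all_iff]
    intro c
    have hnorm : ‖∑ i, (c i : ℝ) • e i‖ = √(∑ i, (c i : ℝ) ^ 2) := by
      rw [← Real.sqrt_sq (norm_nonneg _), ← real_inner_self_eq_norm_sq, he.inner_sum]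
      congr 1
      refine Finset.sum_congr rfl fun i _ => ?_
      simp [sq]
    have h1 := hA (∑ i, (c i : ℝ) • e i)
    rw [hnorm, map_sum] at h1
    have h2 : ∀ t : Finset (Fin k), ∀ᵐ x ∂μ, (∑ i ∈ t, A ((c i : ℝ) • e i) : Lp ℝ 2 μ) x =
        ∑ i ∈ t, (c i : ℝ) * A (e i) x := fun t => by
      induction t using Finset.induction_on with
      | empty =>
        filter_upwards [Lp.coeFn_zero ℝ 2 μ] with x hx
        simpa using hx
      | insert i t hi ih =>
        rw [Finset.sum_insert hi, map_smul]
        filter_upwards [ih, Lp.coeFn_add ((c i : ℝ) • A (e i)) (∑ i ∈ t, A ((c i : ℝ) • e i)),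
          Lp.coeFn_smul (c i : ℝ) (A (e i))] with x hx1 hx2 hx3
        rw [hx2, Pi.add_apply, hx1, hx3, Finset.sum_insert hi]
        rfl
    filter_upwards [h1, h2 Finset.univ] with x hx1 hx2
    rwa [hx2] at hx1
  have hpt : ∀ᵐ x ∂μ, ∑ i, (A (e i) x) ^ 2 ≤ M ^ 2 := by
    filter_upwards [hrat] with x hx
    have hreal : ∀ c : Fin k → ℝ, |∑ i, c i * A (e i) x| ≤ M * √(∑ i, c i ^ 2) := by
      have hcl : IsClosed {c : Fin k → ℝ | |∑ i, c i * A (e i) x| ≤ M * √(∑ i, c i ^ 2)} :=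
        isClosed_le (by fun_prop) (by fun_prop)
      have hdense : DenseRange (Pi.map fun (_ : Fin k) (q : ℚ) => (q : ℝ)) :=
        DenseRange.piMap fun _ => Rat.denseRange_cast
      intro c
      have hsub : Set.range (Pi.map fun (_ : Fin k) (q : ℚ) => (q : ℝ)) ⊆
          {c : Fin k → ℝ | |∑ i, c i * A (e i) x| ≤ M * √(∑ i, c i ^ 2)} := by
        rintro _ ⟨q, rfl⟩
        exact hx q
      have := hcl.closure_subset_iff.2 hsub
      rw [hdense.closure_range] at this
      exact this (Set.mem_univ c)
    -- Taking the values A e_i(x) themselves as coefficients gives Q ≤ M √Q, hence Q ≤ M².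
    have h1 := hreal fun i => A (e i) x
    simp_rw [← sq] at h1
    set Q := ∑ i, (A (e i) x) ^ 2 with hQ
    have hQ0 : 0 ≤ Q := Finset.sum_nonneg fun i _ => sq_nonneg _
    rw [abs_of_nonneg hQ0] at h1
    rcases hQ0.eq_or_lt with h0 | h0
    · rw [← h0]; positivity
    · have h2 : 0 < √Q := Real.sqrt_pos.2 h0
      have h3 : √Q * √Q = Q := Real.mul_self_sqrt hQ0
      have h4 : √Q ≤ M := by
        refine le_of_mul_le_mul_right ?_ h2
        rw [h3]; exact h1
      nlinarith
  have hnormsq : ∀ f : Lp ℝ 2 μ, ‖f‖ ^ 2 = ∫ x, (f x) ^ 2 ∂μ := fun f => by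
    rw [← real_inner_self_eq_norm_sq, L2.inner_def]
    simp [sq]
  have hint : ∀ f : Lp ℝ 2 μ, Integrable (fun x => (f x) ^ 2) μ := fun f => by
    have := L2.integrable_inner (𝕜 := ℝ) f f
    simpa [sq] using this
  simp_rw [hnormsq]
  rw [← integral_finsetSum _ fun i _ => hint _]
  calc ∫ x, ∑ i, (A (e i) x) ^ 2 ∂μ ≤ ∫ _, M ^ 2 ∂μ :=
        integral_mono_ae (integrable_finsetSum _ fun i _ => hint _) (integrable_const _) hpt
    _ = _ := by rw [integral_const, smul_eq_mul, mul_comm]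

lemma enorm_greenOp_le {n : ℕ} {Ω : Set (Eu n)} {G : Eu n → Eu n → ℝ} (f : Eu n → ℝ) (x : Eu n) :
    ‖greenOp Ω G f x‖ₑ ≤ eGreen Ω G (fun y => ‖f y‖ₑ) x := by
  refine (enorm_integral_le_lintegral_enorm _).trans (le_of_eq ?_)
  simp only [enorm_mul]
  rfl

lemma greenOp_congr {n : ℕ} {Ω : Set (Eu n)} {G : Eu n → Eu n → ℝ} {f g : Eu n → ℝ}
    (hfg : f =ᵐ[volume.restrict Ω] g) (x : Eu n) : greenOp Ω G f x = greenOp Ω G g x := by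
  refine integral_congr_ae ?_
  filter_upwards [hfg] with y hy
  rw [hy]

lemma measurable_enorm_Lp {α : Type*} [MeasurableSpace α] {μ : Measure α} {p : ℝ≥0∞}
    (f : Lp ℝ p μ) : Measurable fun x => ‖f x‖ₑ :=
  (Lp.stronglyMeasurable f).measurable.enorm

lemma eLpNorm_two_eq {α : Type*} [MeasurableSpace α] {μ : Measure α} (f : α → ℝ) :
    eLpNorm f 2 μ = (∫⁻ x, ‖f x‖ₑ ^ (2 : ℝ) ∂μ) ^ (1 / 2 : ℝ) := by
  rw [eLpNorm_eq_lintegral_rpow_enorm_toReal two_ne_zero ENNReal.ofNat_ne_top]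
  simp

namespace IsGreenKernel

variable {n : ℕ} {Ω : Set (Eu n)} {s γ C D : ℝ} {G : Eu n → Eu n → ℝ}

lemma isFiniteMeasure (h : IsGreenKernel Ω s γ C D G) : IsFiniteMeasure (volume.restrict Ω) :=
  isFiniteMeasure_restrict.2 h.volume_lt_top.ne

lemma lintegral_enorm_le (h : IsGreenKernel Ω s γ C D G) :
    ∃ A : ℝ≥0, ∀ x ∈ Ω, ∫⁻ y in Ω, ‖G x y‖ₑ ≤ A := by
  obtain ⟨A, hA⟩ := h.lintegral_riesz_le (e := 2 * s) (by linarith [h.s_pos])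
  refine ⟨C.toNNReal * A, fun x hx => ?_⟩
  have h1 := h.eGreen_le_eRiesz (fun _ => 1) hx
  simp only [eGreen, eRiesz, mul_one] at h1
  refine h1.trans ?_
  rw [ENNReal.coe_mul]
  exact mul_le_mul' le_rfl (hA x hx)

/-- Schur's test: Jensen in y, then symmetry, with the same bound A for the row and column integrals
of the kernel. -/
lemma lintegral_eGreen_rpow_le (h : IsGreenKernel Ω s γ C D G) {p : ℝ} (hp : 1 ≤ p) :
    ∃ M : ℝ≥0, ∀ f : Eu n → ℝ≥0∞, Measurable f →
      ∫⁻ x in Ω, (eGreen Ω G f x) ^ p ≤ M * ∫⁻ x in Ω, f x ^ p := by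
  obtain ⟨A, hA⟩ := h.lintegral_enorm_le
  refine ⟨A ^ (p - 1) * A, fun f hf => ?_⟩
  have hp1 : 0 ≤ p - 1 := by linarith
  calc ∫⁻ x in Ω, (eGreen Ω G f x) ^ p
      -- The factor 1 is the function against which the duality identity is applied below.
      ≤ ∫⁻ x in Ω, (A : ℝ≥0∞) ^ (p - 1) * (1 * eGreen Ω G (fun y => f y ^ p) x) := by
        refine setLIntegral_mono' h.measurableSet fun x hx => ?_
        rw [one_mul]
        refine (lintegral_mul_rpow_le (h.measurable_enorm_right x).aemeasurable hf.aemeasurable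
          hp).trans ?_
        gcongr
        · exact hA x hx
        · exact le_rfl
    _ = (A : ℝ≥0∞) ^ (p - 1) * ∫⁻ x in Ω, 1 * eGreen Ω G (fun y => f y ^ p) x :=
        lintegral_const_mul' _ _ (ENNReal.rpow_ne_top_of_nonneg hp1 ENNReal.coe_ne_top)
    _ = (A : ℝ≥0∞) ^ (p - 1) * ∫⁻ x in Ω, f x ^ p * eGreen Ω G (fun _ => 1) x := by
        rw [h.lintegral_mul_eGreen (hf.pow_const p) measurable_const]
    _ ≤ (A : ℝ≥0∞) ^ (p - 1) * ∫⁻ x in Ω, f x ^ p * A := by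
        refine mul_le_mul' le_rfl (setLIntegral_mono' h.measurableSet fun x hx => ?_)
        gcongr
        simpa [eGreen] using hA x hx
    _ = _ := by
        rw [lintegral_mul_const _ (hf.pow_const p), ENNReal.coe_mul,
          ENNReal.coe_rpow_of_nonneg _ hp1]
        ring

lemma lintegral_enorm_le_L2 (h : IsGreenKernel Ω s γ C D G) :
    ∃ M : ℝ≥0, ∀ f : L2Space Ω, ∫⁻ x in Ω, ‖f x‖ₑ ≤ M * ‖f‖ₑ := by
  have := h.isFiniteMeasure
  refine ⟨((volume.restrict Ω Set.univ) ^ (1 / (1 : ℝ≥0∞).toReal - 1 / (2 : ℝ≥0∞).toReal)).toNNReal,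
    fun f => ?_⟩
  rw [ENNReal.coe_toNNReal, Lp.enorm_def, ← eLpNorm_one_eq_lintegral_enorm, mul_comm]
  · exact eLpNorm_le_eLpNorm_mul_rpow_measure_univ (by norm_num)
      (Lp.stronglyMeasurable f).aestronglyMeasurable
  · exact ENNReal.rpow_ne_top_of_nonneg (by norm_num) (measure_ne_top _ _)

lemma lintegral_enorm_lt_top (h : IsGreenKernel Ω s γ C D G) (f : L2Space Ω) :
    ∫⁻ x in Ω, ‖f x‖ₑ < ∞ := by
  obtain ⟨M, hM⟩ := h.lintegral_enorm_le_L2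
  exact (hM f).trans_lt (ENNReal.mul_lt_top ENNReal.coe_lt_top enorm_lt_top)

lemma ae_eGreen_lt_top (h : IsGreenKernel Ω s γ C D G) {f : Eu n → ℝ≥0∞} (hf : Measurable f)
    (hfin : ∫⁻ x in Ω, f x < ∞) : ∀ᵐ x ∂volume.restrict Ω, eGreen Ω G f x < ∞ := by
  obtain ⟨M, hM⟩ := h.lintegral_eGreen_rpow_le le_rfl
  have h1 := hM f hf
  simp only [ENNReal.rpow_one] at h1
  exact ae_lt_top (h.measurable_eGreen hf)
    (h1.trans_lt (ENNReal.mul_lt_top ENNReal.coe_lt_top hfin)).ne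

lemma integrable_of_eGreen_lt_top (h : IsGreenKernel Ω s γ C D G) {f : Eu n → ℝ}
    (hf : AEStronglyMeasurable f (volume.restrict Ω)) {x : Eu n}
    (hx : eGreen Ω G (fun y => ‖f y‖ₑ) x < ∞) :
    Integrable (fun y => G x y * f y) (volume.restrict Ω) := by
  refine ⟨(h.meas.comp (by fun_prop : Measurable fun y => (x, y))).aestronglyMeasurable.mul hf, ?_⟩
  rw [hasFiniteIntegral_iff_enorm]
  simp only [enorm_mul]
  exact hx

lemma stronglyMeasurable_greenOp (h : IsGreenKernel Ω s γ C D G) {f : Eu n → ℝ}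
    (hf : StronglyMeasurable f) : StronglyMeasurable (greenOp Ω G f) :=
  StronglyMeasurable.integral_prod_right (f := fun x y => G x y * f y)
    (h.meas.stronglyMeasurable.mul (hf.comp_measurable measurable_snd))

lemma exists_eLpNorm_greenOp_le (h : IsGreenKernel Ω s γ C D G) :
    ∃ M : ℝ≥0, ∀ f : L2Space Ω,
      eLpNorm (greenOp Ω G f) 2 (volume.restrict Ω) ≤ M * ‖f‖ₑ := by
  obtain ⟨M, hM⟩ := h.lintegral_eGreen_rpow_le (p := 2) one_le_two
  refine ⟨M ^ (1 / 2 : ℝ), fun f => ?_⟩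
  rw [Lp.enorm_def, eLpNorm_two_eq, eLpNorm_two_eq, ENNReal.coe_rpow_of_nonneg _ (by norm_num),
    ← ENNReal.mul_rpow_of_nonneg _ _ (by norm_num)]
  refine ENNReal.rpow_le_rpow (le_trans (lintegral_mono fun x => ?_)
    (hM _ (measurable_enorm_Lp f))) (by norm_num)
  exact ENNReal.rpow_le_rpow (enorm_greenOp_le f x) (by norm_num)

/-- The Green operator as a bounded operator on `L²(Ω)`. -/
theorem exists_greenCLM (h : IsGreenKernel Ω s γ C D G) :
    ∃ T : L2Space Ω →L[ℝ] L2Space Ω, ∀ f : L2Space Ω,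
      T f =ᵐ[volume.restrict Ω] greenOp Ω G f := by
  obtain ⟨M, hM⟩ := h.exists_eLpNorm_greenOp_le
  have hmem : ∀ f : L2Space Ω, MemLp (greenOp Ω G f) 2 (volume.restrict Ω) := fun f =>
    ⟨(h.stronglyMeasurable_greenOp (Lp.stronglyMeasurable f)).aestronglyMeasurable,
      (hM f).trans_lt (ENNReal.mul_lt_top ENNReal.coe_lt_top enorm_lt_top)⟩
  have hint : ∀ f : L2Space Ω, ∀ᵐ x ∂volume.restrict Ω,
      Integrable (fun y => G x y * f y) (volume.restrict Ω) := fun f => by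
    filter_upwards [h.ae_eGreen_lt_top (measurable_enorm_Lp f) (h.lintegral_enorm_lt_top f)]
      with x hx
    exact h.integrable_of_eGreen_lt_top (Lp.stronglyMeasurable f).aestronglyMeasurable hx
  let T₀ : L2Space Ω →ₗ[ℝ] L2Space Ω :=
    { toFun := fun f => (hmem f).toLp
      map_add' := fun f g => by
        refine Lp.ext ?_
        filter_upwards [(hmem (f + g)).coeFn_toLp, (hmem f).coeFn_toLp, (hmem g).coeFn_toLp,
          Lp.coeFn_add (hmem f).toLp (hmem g).toLp, hint f, hint g] with x h1 h2 h3 h4 h5 h6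
        rw [h1, h4, Pi.add_apply, h2, h3, greenOp_congr (Lp.coeFn_add f g) x, greenOp, greenOp,
          greenOp, ← integral_add h5 h6]
        refine integral_congr_ae (Eventually.of_forall fun y => ?_)
        simp only [Pi.add_apply]
        ring
      map_smul' := fun c f => by
        refine Lp.ext ?_
        filter_upwards [(hmem (c • f)).coeFn_toLp, (hmem f).coeFn_toLp,
          Lp.coeFn_smul c (hmem f).toLp] with x h1 h2 h3
        rw [h1, RingHom.id_apply, h3, Pi.smul_apply, h2, greenOp_congr (Lp.coeFn_smul c f) x,
          greenOp, greenOp, smul_eq_mul, ← integral_const_mul]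
        refine integral_congr_ae (Eventually.of_forall fun y => ?_)
        simp only [Pi.smul_apply, smul_eq_mul]
        ring }
  refine ⟨T₀.mkContinuous M fun f => ?_, fun f => (hmem f).coeFn_toLp⟩
  have h1 : ‖T₀ f‖ₑ ≤ M * ‖f‖ₑ := by
    change ‖(hmem f).toLp‖ₑ ≤ _
    rw [Lp.enorm_toLp]
    exact hM f
  have h2 := ENNReal.toReal_mono (ENNReal.mul_ne_top ENNReal.coe_ne_top enorm_ne_top) h1
  simpa using h2

section Operator

variable {T : L2Space Ω →L[ℝ] L2Space Ω}

lemma enorm_apply_le (hT : ∀ f : L2Space Ω, T f =ᵐ[volume.restrict Ω] greenOp Ω G f)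
    (f : L2Space Ω) : ∀ᵐ x ∂volume.restrict Ω, ‖T f x‖ₑ ≤ eGreen Ω G (fun y => ‖f y‖ₑ) x := by
  filter_upwards [hT f] with x hx
  rw [hx]
  exact enorm_greenOp_le f x

lemma enorm_pow_apply_le (hT : ∀ f : L2Space Ω, T f =ᵐ[volume.restrict Ω] greenOp Ω G f)
    (k : ℕ) (f : L2Space Ω) : ∀ᵐ x ∂volume.restrict Ω,
      ‖(T ^ k) f x‖ₑ ≤ (eGreen Ω G)^[k] (fun y => ‖f y‖ₑ) x := by
  induction k with
  | zero => simp
  | succ k ih =>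
    filter_upwards [enorm_apply_le hT ((T ^ k) f)] with x hx
    rw [pow_succ', mul_apply_eq_comp, Function.iterate_succ_apply']
    exact hx.trans (eGreen_mono ih x)

/-- Fubini and the symmetry of the kernel. Absolute integrability follows from Cauchy–Schwarz and
the L² bound for the kernel |G|. -/
lemma isSymmetric (h : IsGreenKernel Ω s γ C D G)
    (hT : ∀ f : L2Space Ω, T f =ᵐ[volume.restrict Ω] greenOp Ω G f) : T.IsSymmetric := by
  intro f g
  change inner ℝ (T f) g = inner ℝ f (T g)
  obtain ⟨M, hM⟩ := h.lintegral_eGreen_rpow_le (p := 2) one_le_two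
  have hsq : ∀ f : L2Space Ω, ∫⁻ x in Ω, ‖f x‖ₑ ^ (2 : ℝ) < ∞ := fun f => by
    have h1 := (Lp.memLp f).2
    rw [eLpNorm_two_eq] at h1
    exact (ENNReal.rpow_lt_top_iff_of_pos (by norm_num)).1 h1
  have hfin : ∫⁻ x in Ω, ‖g x‖ₑ * eGreen Ω G (fun y => ‖f y‖ₑ) x < ∞ := by
    have h1 := ENNReal.lintegral_mul_le_Lp_mul_Lq (volume.restrict Ω) Real.HolderConjugate.two_two
      (measurable_enorm_Lp g).aemeasurable
      (h.measurable_eGreen (measurable_enorm_Lp f)).aemeasurable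
    refine h1.trans_lt (ENNReal.mul_lt_top ?_ ?_)
    · exact ENNReal.rpow_lt_top_of_nonneg (by norm_num) (hsq g).ne
    · exact ENNReal.rpow_lt_top_of_nonneg (by norm_num) ((hM _ (measurable_enorm_Lp f)).trans_lt
        (ENNReal.mul_lt_top ENNReal.coe_lt_top (hsq f))).ne
  have hint : Integrable (Function.uncurry fun x y => g x * (G x y * f y))
      ((volume.restrict Ω).prod (volume.restrict Ω)) := by
    have hm : StronglyMeasurable (Function.uncurry fun x y => g x * (G x y * f y)) :=
      ((Lp.stronglyMeasurable g).comp_measurable measurable_fst).mul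
        (h.meas.stronglyMeasurable.mul ((Lp.stronglyMeasurable f).comp_measurable measurable_snd))
    refine ⟨hm.aestronglyMeasurable, ?_⟩
    rw [hasFiniteIntegral_iff_enorm, lintegral_prod _ hm.measurable.enorm.aemeasurable]
    refine lt_of_le_of_lt (lintegral_mono fun x => ?_) hfin
    have := h.measurable_enorm_right x
    have := measurable_enorm_Lp f
    rw [eGreen, ← lintegral_const_mul _ (by fun_prop)]
    simp only [Function.uncurry_apply_pair, enorm_mul]
    exact le_rfl
  rw [L2.inner_def, L2.inner_def]
  calc ∫ x in Ω, inner ℝ (T f x) (g x) = ∫ x in Ω, ∫ y in Ω, g x * (G x y * f y) := by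
        refine integral_congr_ae ?_
        filter_upwards [hT f] with x hx
        rw [hx, greenOp, integral_const_mul]
        simp
    _ = ∫ y in Ω, ∫ x in Ω, g x * (G x y * f y) := integral_integral_swap hint
    _ = ∫ y in Ω, inner ℝ (f y) (T g y) := by
        refine integral_congr_ae ?_
        filter_upwards [hT g, ae_restrict_mem h.measurableSet] with y hy hyΩ
        have : (inner ℝ (f y) (T g y) : ℝ) = T g y * f y := by simp
        rw [this, hy, greenOp, ← integral_mul_const]
        refine setIntegral_congr_fun h.measurableSet fun x hx => ?_
        simp only [h.symm x hx y hyΩ]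
        ring

/-- High powers of the Green operator map `L²(Ω)` to `δ^γ L^∞(Ω)`. -/
lemma exists_enorm_pow_apply_le (h : IsGreenKernel Ω s γ C D G)
    (hT : ∀ f : L2Space Ω, T f =ᵐ[volume.restrict Ω] greenOp Ω G f) :
    ∃ N : ℕ, ∀ m : ℕ, N ≤ m → ∃ M : ℝ≥0, ∀ f : L2Space Ω, ∀ᵐ x ∂volume.restrict Ω,
      ‖(T ^ m) f x‖ₑ ≤ M * ENNReal.ofReal (bdryDist Ω x ^ γ) * ‖f‖ₑ := by
  obtain ⟨N, hN⟩ := h.exists_iterate_eGreen_le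
  obtain ⟨A, hA⟩ := h.lintegral_enorm_le_L2
  refine ⟨N, fun m hm => ?_⟩
  obtain ⟨M, hM⟩ := hN m hm
  refine ⟨M * A, fun f => ?_⟩
  filter_upwards [enorm_pow_apply_le hT m f, ae_restrict_mem h.measurableSet] with x hx hxΩ
  refine hx.trans ((hM _ (measurable_enorm_Lp f) (h.lintegral_enorm_lt_top f) x hxΩ).trans ?_)
  calc _ ≤ M * ENNReal.ofReal (bdryDist Ω x ^ γ) * (A * ‖f‖ₑ) := by
        gcongr
        exact hA f
    _ = _ := by push_cast; ring

lemma exists_norm_pow_apply_le (h : IsGreenKernel Ω s γ C D G)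
    (hT : ∀ f : L2Space Ω, T f =ᵐ[volume.restrict Ω] greenOp Ω G f) :
    ∃ (j : ℕ) (M : ℝ), ∀ f : L2Space Ω, ∀ᵐ x ∂volume.restrict Ω,
      ‖(T ^ 2 ^ j) f x‖ ≤ M * ‖f‖ := by
  obtain ⟨N, hN⟩ := h.exists_enorm_pow_apply_le hT
  -- The compactness criterion needs an exponent that is a power of two, and N < 2^N.
  obtain ⟨M, hM⟩ := hN (2 ^ N) N.lt_two_pow_self.le
  refine ⟨N, M * D ^ γ, fun f => ?_⟩
  filter_upwards [hM f, ae_restrict_mem h.measurableSet] with x hx hxΩ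
  have hD := h.D_pos
  have h1 : ‖(T ^ 2 ^ N) f x‖ₑ ≤ M * ENNReal.ofReal (D ^ γ) * ‖f‖ₑ := by
    refine hx.trans ?_
    gcongr
    · exact bdryDist_nonneg _ _
    · exact h.γ_pos.le
    · exact h.delta_le x hxΩ
  have h2 := ENNReal.toReal_mono
    (ENNReal.mul_ne_top (ENNReal.mul_ne_top ENNReal.coe_ne_top ENNReal.ofReal_ne_top) enorm_ne_top) h1
  simpa [ENNReal.toReal_ofReal (Real.rpow_nonneg hD.le γ)] using h2

/-- In finite dimension the injective power T^{2^j} would be invertible, so every f would satisfy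
‖f‖_∞ ≤ K ‖f‖₂. Indicators of small balls then give 1 ≤ K² |B_r|, which fails as r → 0. -/
lemma not_finiteDimensional (h : IsGreenKernel Ω s γ C D G)
    (hT : ∀ f : L2Space Ω, T f =ᵐ[volume.restrict Ω] greenOp Ω G f)
    (hinj : ∀ f, T f = 0 → f = 0) : ¬ FiniteDimensional ℝ (L2Space Ω) := by
  intro hfd
  obtain ⟨j, M, hM⟩ := h.exists_norm_pow_apply_le hT
  have hinjpow : ∀ k : ℕ, Function.Injective ⇑(T ^ k) := fun k => by
    induction k with
    | zero => exact fun _ _ h => h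
    | succ k ih =>
      rw [pow_succ]
      exact ih.comp ((injective_iff_map_eq_zero T).2 hinj)
  let e := LinearEquiv.ofInjectiveEndo ((T ^ 2 ^ j : L2Space Ω →L[ℝ] L2Space Ω) :
    L2Space Ω →ₗ[ℝ] L2Space Ω) (hinjpow _)
  let S : L2Space Ω →L[ℝ] L2Space Ω := LinearMap.toContinuousLinearMap e.symm.toLinearMap
  have hS : ∀ f, (T ^ 2 ^ j) (S f) = f := fun f => e.apply_symm_apply f
  have hbound : ∀ f : L2Space Ω, ∀ᵐ x ∂volume.restrict Ω, ‖f x‖ ≤ (|M| * ‖S‖) * ‖f‖ := fun f => by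
    filter_upwards [hM (S f)] with x hx
    rw [hS] at hx
    refine hx.trans ?_
    rw [mul_assoc]
    exact mul_le_mul (le_abs_self M) (S.le_opNorm f) (norm_nonneg _) (abs_nonneg _)
  obtain ⟨x₀, hx₀⟩ := h.nonempty
  obtain ⟨r₀, hr₀, hball⟩ := Metric.isOpen_iff.1 h.isOpen x₀ hx₀
  set K := |M| * ‖S‖ with hK
  have hK0 : 0 ≤ K := by positivity
  have hn : Nonempty (Fin n) := ⟨⟨0, h.one_le⟩⟩
  have hlow : ∀ r, 0 < r → r < r₀ → 1 ≤ K ^ 2 * (volume (Metric.ball x₀ r)).toReal :=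
    fun r hr hrr => by
    have hsub : Metric.ball x₀ r ⊆ Ω := (Metric.ball_subset_ball hrr.le).trans hball
    have hres : (volume.restrict Ω) (Metric.ball x₀ r) = volume (Metric.ball x₀ r) :=
      Measure.restrict_eq_self _ hsub
    have hfin : (volume.restrict Ω) (Metric.ball x₀ r) ≠ ∞ := by
      rw [hres]; exact measure_ball_lt_top.ne
    set f : L2Space Ω := indicatorConstLp 2 measurableSet_ball hfin (1 : ℝ) with hf
    have h1 := hbound f
    have h2 : ∀ᵐ x ∂volume.restrict Ω, x ∈ Metric.ball x₀ r → 1 ≤ K * ‖f‖ := by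
      filter_upwards [h1, indicatorConstLp_coeFn (p := 2) (hs := measurableSet_ball) (hμs := hfin)
        (c := (1 : ℝ))] with x hx1 hx2 hx
      rw [← hf] at hx2
      rwa [hx2, Set.indicator_of_mem hx, norm_one] at hx1
    have h3 : 1 ≤ K * ‖f‖ := by
      by_contra hcon
      have h4 : ∀ᵐ x ∂volume.restrict Ω, x ∉ Metric.ball x₀ r := by
        filter_upwards [h2] with x hx hx'
        exact hcon (hx hx')
      have h5 : (volume.restrict Ω) (Metric.ball x₀ r) = 0 := by
        rw [ae_iff] at h4
        simp only [not_not] at h4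
        exact h4
      rw [hres] at h5
      exact (Metric.measure_ball_pos volume x₀ hr).ne' h5
    have h4 : ‖f‖ ^ 2 = (volume (Metric.ball x₀ r)).toReal := by
      rw [hf, norm_indicatorConstLp two_ne_zero ENNReal.ofNat_ne_top, norm_one, one_mul,
        Measure.real, hres, ENNReal.toReal_ofNat, ← Real.rpow_natCast,
        ← Real.rpow_mul ENNReal.toReal_nonneg]
      norm_num
    rw [← h4, ← mul_pow]
    exact one_le_pow₀ h3
  have hlim : Tendsto (fun r : ℝ => K ^ 2 * (volume (Metric.ball x₀ r)).toReal) (𝓝[>] 0) (𝓝 0) := by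
    have h1 : ∀ r : ℝ, 0 ≤ r → (volume (Metric.ball x₀ r)).toReal =
        r ^ n * (volume (Metric.ball (0 : Eu n) 1)).toReal := fun r hr => by
      rw [Measure.addHaar_ball _ _ hr, ENNReal.toReal_mul, finrank_euclideanSpace_fin,
        ENNReal.toReal_ofReal (by positivity)]
    have h2 : Tendsto (fun r : ℝ => K ^ 2 * (r ^ n * (volume (Metric.ball (0 : Eu n) 1)).toReal))
        (𝓝[>] 0) (𝓝 0) := by
      have hc : Continuous fun r : ℝ =>
          K ^ 2 * (r ^ n * (volume (Metric.ball (0 : Eu n) 1)).toReal) := by fun_prop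
      have := (hc.tendsto 0).mono_left (nhdsWithin_le_nhds (s := Set.Ioi 0))
      have hn0 : n ≠ 0 := by have := h.one_le; omega
      simpa [hn0] using this
    refine h2.congr' ?_
    filter_upwards [self_mem_nhdsWithin] with r hr
    rw [h1 r (le_of_lt hr)]
  have hev : ∀ᶠ r in 𝓝[>] (0 : ℝ), 1 ≤ K ^ 2 * (volume (Metric.ball x₀ r)).toReal := by
    filter_upwards [Ioo_mem_nhdsGT hr₀] with r hr using hlow r hr.1 hr.2
  exact absurd (ge_of_tendsto hlim hev) (by norm_num)

end Operator

end IsGreenKernel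

/-! ### Diagonal operators and the spectral parameters. -/

section Diagonal

variable {H : Type*} [NormedAddCommGroup H] [InnerProductSpace ℝ H]

lemma HilbertBasis.ext_inner {ι : Type*} (b : HilbertBasis ι ℝ H) {x y : H}
    (hxy : ∀ j, inner ℝ (b j) x = inner ℝ (b j) y) : x = y := by
  refine b.repr.injective (lp.ext (funext fun j => ?_))
  rw [b.repr_apply_apply, b.repr_apply_apply, hxy]

lemma HilbertBasis.hasSum_sq_inner {ι : Type*} (b : HilbertBasis ι ℝ H) (x : H) :
    HasSum (fun j => inner ℝ (b j) x ^ 2) (‖x‖ ^ 2) := by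
  have := b.hasSum_inner_mul_inner x x
  rw [real_inner_self_eq_norm_sq] at this
  refine this.congr_fun ?_
  intro j
  rw [sq, real_inner_comm x]

/-- The bounded operator that is diagonal in a Hilbert basis. -/
theorem HilbertBasis.exists_diagonal {ι : Type*} (b : HilbertBasis ι ℝ H) {c : ι → ℝ} {K : ℝ}
    (hK0 : 0 ≤ K) (hK : ∀ j, |c j| ≤ K) :
    ∃ R : H →L[ℝ] H, (∀ f, HasSum (fun j => (c j * inner ℝ (b j) f) • b j) (R f)) ∧
      (∀ f j, inner ℝ (b j) (R f) = c j * inner ℝ (b j) f) ∧ ∀ f, ‖R f‖ ≤ K * ‖f‖ := by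
  classical
  have hsq : ∀ f j, (c j * inner ℝ (b j) f) ^ 2 ≤ K ^ 2 * inner ℝ (b j) f ^ 2 := fun f j => by
    rw [mul_pow]
    refine mul_le_mul_of_nonneg_right (sq_le_sq' ?_ ?_) (sq_nonneg _)
    · linarith [neg_abs_le (c j), hK j]
    · exact (le_abs_self _).trans (hK j)
  have hmem : ∀ f, Memℓp (fun j => c j * inner ℝ (b j) f) 2 := fun f => by
    refine memℓp_gen ?_
    refine Summable.of_nonneg_of_le (fun j => by positivity) (fun j => ?_)
      ((b.hasSum_sq_inner f).summable.mul_left (K ^ 2))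
    have := hsq f j
    simpa [mul_pow] using this
  have hsum : ∀ f, ∃ g, HasSum (fun j => (c j * inner ℝ (b j) f) • b j) g := fun f =>
    ⟨_, b.hasSum_repr_symm ⟨_, hmem f⟩⟩
  choose R₀ hR₀ using hsum
  have hinner : ∀ f j, inner ℝ (b j) (R₀ f) = c j * inner ℝ (b j) f := fun f j => by
    have h1 := (hR₀ f).mapL (innerSL ℝ (b j))
    have h2 : HasSum (fun k => (innerSL ℝ (b j)) ((c k * inner ℝ (b k) f) • b k))
        (c j * inner ℝ (b j) f) := by
      convert hasSum_single j _ using 1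
      · simp [b.orthonormal.1 j]
      · intro k hk
        simp [b.orthonormal.2 hk.symm]
    exact h1.unique h2
  have hnorm : ∀ f, ‖R₀ f‖ ≤ K * ‖f‖ := fun f => by
    refine (abs_le_of_sq_le_sq' ?_ (by positivity)).2
    rw [mul_pow]
    refine hasSum_le (fun j => ?_) (b.hasSum_sq_inner (R₀ f))
      ((b.hasSum_sq_inner f).mul_left (K ^ 2))
    rw [hinner]
    exact hsq f j
  let R₁ : H →ₗ[ℝ] H :=
    { toFun := R₀
      map_add' := fun f g => b.ext_inner fun j => by
        simp only [inner_add_right, hinner]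
        ring
      map_smul' := fun a f => b.ext_inner fun j => by
        simp only [inner_smul_right, hinner, RingHom.id_apply]
        ring }
  exact ⟨R₁.mkContinuous K hnorm, hR₀, hinner, hnorm⟩

end Diagonal

section Spectrum

variable {lam : ℕ → ℝ} {z : ℝ}

lemma spectralDist_le (j : ℕ) : spectralDist lam z ≤ |lam j - z| :=
  ciInf_le ⟨0, by rintro _ ⟨k, rfl⟩; exact abs_nonneg _⟩ j

lemma spectralDist_pos (hlam : Tendsto lam atTop atTop) (hz : z ∉ Set.range lam) :
    0 < spectralDist lam z := by
  have h1 : Tendsto (fun j => |lam j - z|) cofinite atTop := by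
    rw [Nat.cofinite_eq_atTop]
    exact tendsto_abs_atTop_atTop.comp (tendsto_atTop_add_const_right _ (-z) hlam)
  obtain ⟨j, hj⟩ := h1.exists_forall_le
  have h2 : 0 < |lam j - z| := abs_pos.2 fun h0 => hz ⟨j, by linarith⟩
  exact h2.trans_le (le_ciInf hj)

lemma le_nextEigenvalue (hlam : Tendsto lam atTop atTop) (hmono : Monotone lam) (hpos : ∀ j, 0 < lam j) :
    z ≤ nextEigenvalue lam z ∧ 0 < nextEigenvalue lam z := by
  refine ⟨?_, hpos _⟩
  have hne : {j : ℕ | z ≤ lam j ∧ lam j < lam (j + 1)}.Nonempty := by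
    by_contra hcon
    rw [Set.not_nonempty_iff_eq_empty, Set.eq_empty_iff_forall_notMem] at hcon
    obtain ⟨J, hJ⟩ := (hlam.eventually_ge_atTop z).exists
    have hle : ∀ k, lam (J + k) ≤ lam J := fun k => by
      induction k with
      | zero => exact le_rfl
      | succ k ih =>
        exact (not_lt.1 fun hlt => hcon (J + k)
          ⟨hJ.trans (hmono (Nat.le_add_right J k)), hlt⟩).trans ih
    obtain ⟨k, hk⟩ := ((tendsto_add_atTop_iff_nat J).2 hlam).eventually_gt_atTop (lam J) |>.exists
    rw [add_comm] at hk
    linarith [hle k]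
  have h := Nat.sInf_mem hne
  exact h.1.trans h.2.le

/-- If z ≥ 0 then z ≤ z̄. If z < 0, positivity of the eigenvalues gives |z| ≤ d. Thus the two
parameters control |z|. -/
lemma abs_le_nextEigenvalue_add (hlam : Tendsto lam atTop atTop) (hmono : Monotone lam) (hpos : ∀ j, 0 < lam j)
    (hz : z ∉ Set.range lam) : |z| ≤ nextEigenvalue lam z + spectralDist lam z := by
  have h1 := le_nextEigenvalue (z := z) hlam hmono hpos
  have h2 := spectralDist_pos hlam hz
  rw [abs_le]
  refine ⟨?_, by linarith⟩
  rcases le_or_gt 0 z with h | h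
  · linarith
  · have : -z ≤ spectralDist lam z := le_ciInf fun j => by
      have := le_abs_self (lam j - z)
      linarith [hpos j]
    linarith

end Spectrum

/-! ### Domination of the resolvent by the Green operator. -/

namespace IsGreenKernel

variable {n : ℕ} {Ω : Set (Eu n)} {s γ C D : ℝ} {G : Eu n → Eu n → ℝ}
  {T : L2Space Ω →L[ℝ] L2Space Ω} {lam : ℕ → ℝ} {φ : HilbertBasis ℕ ℝ (L2Space Ω)}

lemma exists_resolvent (φ : HilbertBasis ℕ ℝ (L2Space Ω)) (hdiv : Tendsto lam atTop atTop) {z : ℝ}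
    (hz : z ∉ Set.range lam) :
    ∃ R : L2Space Ω →L[ℝ] L2Space Ω, (∀ f, spectralSol lam φ z f = R f) ∧
      (∀ f, HasSum (fun j => (inner ℝ f (φ j) / (lam j - z)) • φ j) (R f)) ∧
      (∀ f j, inner ℝ (φ j) (R f) = (lam j - z)⁻¹ * inner ℝ (φ j) f) ∧
      ∀ f, ‖R f‖ ≤ (spectralDist lam z)⁻¹ * ‖f‖ := by
  have hd := spectralDist_pos hdiv hz
  obtain ⟨R, h1, h2, h3⟩ := φ.exists_diagonal (c := fun j => (lam j - z)⁻¹)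
    (K := (spectralDist lam z)⁻¹) (by positivity) (fun j => by
      rw [abs_inv]
      exact inv_anti₀ hd (spectralDist_le j))
  have h4 : ∀ f, HasSum (fun j => (inner ℝ f (φ j) / (lam j - z)) • φ j) (R f) := fun f => by
    refine (h1 f).congr_fun fun j => ?_
    rw [real_inner_comm, div_eq_mul_inv, mul_comm]
  exact ⟨R, fun f => (h4 f).tsum_eq, h4, h2, h3⟩

lemma inner_eigen (h : IsGreenKernel Ω s γ C D G)
    (hT : ∀ f : L2Space Ω, T f =ᵐ[volume.restrict Ω] greenOp Ω G f) (hpos : ∀ j, 0 < lam j)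
    (heig : ∀ j, φ j = T (lam j • φ j)) (f : L2Space Ω) (j : ℕ) :
    inner ℝ (φ j) (T f) = (lam j)⁻¹ * inner ℝ (φ j) f := by
  have h1 : inner ℝ (T (φ j)) f = inner ℝ (φ j) (T f) := h.isSymmetric hT (φ j) f
  have h2 : T (φ j) = (lam j)⁻¹ • φ j := by
    conv_rhs => rw [heig j]
    rw [map_smul, smul_smul, inv_mul_cancel₀ (hpos j).ne', one_smul]
  rw [← h1, h2, real_inner_smul_left]

/-- On each eigenfunction, R = T + zTR reads 1/(λ-z) = 1/λ + z/(λ(λ-z)). It is iterated 2N times,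
and then N of the factors T are commuted to the right of R, so that the remainder is smoothed on
both sides. -/
lemma resolvent_expansion (h : IsGreenKernel Ω s γ C D G)
    (hT : ∀ f : L2Space Ω, T f =ᵐ[volume.restrict Ω] greenOp Ω G f) (hpos : ∀ j, 0 < lam j)
    (heig : ∀ j, φ j = T (lam j • φ j)) {z : ℝ} (hz : z ∉ Set.range lam)
    {R : L2Space Ω →L[ℝ] L2Space Ω}
    (hR : ∀ f j, inner ℝ (φ j) (R f) = (lam j - z)⁻¹ * inner ℝ (φ j) f) (N : ℕ) (f : L2Space Ω) :
    R f = ∑ k ∈ Finset.range (N + N), z ^ k • (T ^ (k + 1)) f +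
      z ^ (N + N) • (T ^ N) (R ((T ^ N) f)) := by
  have hTφ := h.inner_eigen hT hpos heig
  have hcomm : ∀ f, R (T f) = T (R f) := fun f => φ.ext_inner fun j => by
    rw [hR, hTφ, hTφ, hR]
    ring
  have hcommN : ∀ f, R ((T ^ N) f) = (T ^ N) (R f) := by
    induction N with
    | zero => intro f; rfl
    | succ N ih =>
      intro f
      rw [pow_succ', mul_apply_eq_comp, hcomm, ih]
      rfl
  have hstep : ∀ f, R f = T f + z • T (R f) := fun f => φ.ext_inner fun j => by
    have h1 : lam j - z ≠ 0 := fun h0 => hz ⟨j, by linarith⟩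
    have h2 := (hpos j).ne'
    rw [inner_add_right, inner_smul_right, hR, hTφ, hTφ, hR]
    field_simp
    ring
  have hm : ∀ m, R f = ∑ k ∈ Finset.range m, z ^ k • (T ^ (k + 1)) f +
      z ^ m • (T ^ m) (R f) := fun m => by
    induction m with
    | zero => simp
    | succ m ih =>
      conv_lhs => rw [ih, hstep f]
      rw [Finset.sum_range_succ, map_add, map_smul, smul_add, smul_smul, ← add_assoc, ← pow_succ,
        pow_succ T m]
      rfl
  rw [hcommN, ← mul_apply_eq_comp, ← pow_add]
  exact hm (N + N)

/-- The dual of the smoothing T^N : L² → δ^γ L^∞, obtained from ‖g‖² = ⟨f, T^N g⟩ with g = T^N f. -/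
lemma norm_pow_apply_le_lintegral (h : IsGreenKernel Ω s γ C D G)
    (hT : ∀ f : L2Space Ω, T f =ᵐ[volume.restrict Ω] greenOp Ω G f) {N : ℕ} {M : ℝ≥0}
    (hM : ∀ f : L2Space Ω, ∀ᵐ x ∂volume.restrict Ω,
      ‖(T ^ N) f x‖ₑ ≤ M * ENNReal.ofReal (bdryDist Ω x ^ γ) * ‖f‖ₑ) (f : L2Space Ω) :
    ‖(T ^ N) f‖ₑ ≤ M * ∫⁻ x in Ω, ENNReal.ofReal (bdryDist Ω x ^ γ) * ‖f x‖ₑ := by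
  set g := (T ^ N) f with hg
  rcases eq_or_ne g 0 with h0 | h0
  · simp [h0]
  have hsymm : (T ^ N).IsSymmetric := by
    have := LinearMap.IsSymmetric.pow (h.isSymmetric hT) N
    rwa [← ContinuousLinearMap.toLinearMap_pow] at this
  have h1 : ‖g‖ₑ * ‖g‖ₑ = ‖(inner ℝ f ((T ^ N) g) : ℝ)‖ₑ := by
    have h2 : inner ℝ f ((T ^ N) g) = ‖g‖ ^ 2 := by
      rw [← real_inner_self_eq_norm_sq]
      exact (hsymm f g).symm
    rw [h2, sq, enorm_mul, enorm_norm]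
  have h3 : ‖(inner ℝ f ((T ^ N) g) : ℝ)‖ₑ ≤
      (M * ∫⁻ x in Ω, ENNReal.ofReal (bdryDist Ω x ^ γ) * ‖f x‖ₑ) * ‖g‖ₑ := by
    rw [L2.inner_def]
    refine (enorm_integral_le_lintegral_enorm _).trans ?_
    have hf := measurable_enorm_Lp f
    calc _ ≤ ∫⁻ x in Ω, (M * ‖g‖ₑ) * (ENNReal.ofReal (bdryDist Ω x ^ γ) * ‖f x‖ₑ) := by
          refine lintegral_mono_ae ?_
          filter_upwards [hM g] with x hx
          have : (inner ℝ (f x) ((T ^ N) g x) : ℝ) = (T ^ N) g x * f x := by simp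
          rw [this, enorm_mul]
          calc _ ≤ M * ENNReal.ofReal (bdryDist Ω x ^ γ) * ‖g‖ₑ * ‖f x‖ₑ := by gcongr
            _ = _ := by ring
      _ = _ := by
          rw [lintegral_const_mul _ (by fun_prop)]
          ring
  rw [← h1] at h3
  exact (ENNReal.mul_le_mul_iff_left (by simpa using h0) enorm_ne_top).1 h3

/-- The resolvent is dominated by the Green operator. -/
theorem exists_enorm_spectralSol_le (h : IsGreenKernel Ω s γ C D G)
    (hT : ∀ f : L2Space Ω, T f =ᵐ[volume.restrict Ω] greenOp Ω G f) (hpos : ∀ j, 0 < lam j)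
    (hmono : Monotone lam) (hdiv : Tendsto lam atTop atTop) (heig : ∀ j, φ j = T (lam j • φ j)) :
    ∃ A : ℝ → ℝ → ℝ≥0, ∀ z ∉ Set.range lam, ∀ f : L2Space Ω, ∀ᵐ x ∂volume.restrict Ω,
      ‖spectralSol lam φ z f x‖ₑ ≤
        A (nextEigenvalue lam z) (spectralDist lam z) * eGreen Ω G (fun y => ‖f y‖ₑ) x := by
  obtain ⟨N, hN⟩ := h.exists_enorm_pow_apply_le hT
  obtain ⟨M, hM⟩ := hN N le_rfl
  obtain ⟨M', hM'⟩ := h.le_eGreen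
  choose B hB using h.iterate_eGreen_le
  -- Here a + d bounds |z| and d⁻¹ bounds the resolvent. M appears twice, for T^N on either side of
  -- it, and M' returns from δ^γ(x) ∫ δ^γ |f| to the Green operator.
  refine ⟨fun a d => ∑ k ∈ Finset.range (N + N), (a + d).toNNReal ^ k * B k +
    (a + d).toNNReal ^ (N + N) * (M * d⁻¹.toNNReal * M * M'), fun z hz f => ?_⟩
  obtain ⟨R, hR1, -, hR3, hR4⟩ := exists_resolvent φ hdiv hz
  set d := spectralDist lam z with hd
  set a := nextEigenvalue lam z with ha
  have hz' : ‖z‖ₑ ≤ ((a + d).toNNReal : ℝ≥0∞) := by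
    rw [Real.enorm_eq_ofReal_abs]
    exact ENNReal.ofReal_le_ofReal (abs_le_nextEigenvalue_add hdiv hmono hpos hz)
  have hexp := h.resolvent_expansion hT hpos heig hz hR3 N f
  set g := R ((T ^ N) f) with hg
  have hsum : ∀ m, ∀ᵐ x ∂volume.restrict Ω,
      ‖(∑ k ∈ Finset.range m, z ^ k • (T ^ (k + 1)) f : L2Space Ω) x‖ₑ ≤
        ∑ k ∈ Finset.range m, ‖z‖ₑ ^ k * ‖(T ^ (k + 1)) f x‖ₑ := fun m => by
    induction m with
    | zero =>
      filter_upwards [Lp.coeFn_zero ℝ 2 (volume.restrict Ω)] with x hx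
      simp only [Finset.range_zero, Finset.sum_empty]
      rw [hx]
      simp
    | succ m ih =>
      filter_upwards [ih, Lp.coeFn_add (∑ k ∈ Finset.range m, z ^ k • (T ^ (k + 1)) f)
        (z ^ m • (T ^ (m + 1)) f), Lp.coeFn_smul (z ^ m) ((T ^ (m + 1)) f)] with x h1 h2 h3
      rw [Finset.sum_range_succ, Finset.sum_range_succ, h2, Pi.add_apply, h3]
      refine (enorm_add_le _ _).trans (add_le_add h1 (le_of_eq ?_))
      rw [Pi.smul_apply, smul_eq_mul, enorm_mul, enorm_pow]
  have hpow : ∀ᵐ x ∂volume.restrict Ω, ∀ k,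
      ‖(T ^ (k + 1)) f x‖ₑ ≤ B k * eGreen Ω G (fun y => ‖f y‖ₑ) x := by
    rw [ae_all_iff]
    intro k
    filter_upwards [enorm_pow_apply_le hT (k + 1) f, ae_restrict_mem h.measurableSet] with x hx hxΩ
    exact hx.trans (hB k _ (measurable_enorm_Lp f) x hxΩ)
  have hgnorm : ‖g‖ₑ ≤ d⁻¹.toNNReal * (M * ∫⁻ x in Ω,
      ENNReal.ofReal (bdryDist Ω x ^ γ) * ‖f x‖ₑ) := by
    have h1 : ‖g‖ₑ ≤ d⁻¹.toNNReal * ‖(T ^ N) f‖ₑ := by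
      rw [← ofReal_norm, ← ofReal_norm]
      have hd0 : 0 ≤ d⁻¹ := inv_nonneg.2 (spectralDist_pos hdiv hz).le
      change _ ≤ ENNReal.ofReal d⁻¹ * _
      rw [← ENNReal.ofReal_mul hd0]
      exact ENNReal.ofReal_le_ofReal (hR4 _)
    refine h1.trans ?_
    gcongr
    exact h.norm_pow_apply_le_lintegral hT hM f
  rw [hR1, hexp]
  filter_upwards [hsum (N + N), hpow, hM g, ae_restrict_mem h.measurableSet,
    Lp.coeFn_add (∑ k ∈ Finset.range (N + N), z ^ k • (T ^ (k + 1)) f) (z ^ (N + N) • (T ^ N) g),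
    Lp.coeFn_smul (z ^ (N + N)) ((T ^ N) g)] with x h1 h2 h3 hxΩ h4 h5
  rw [h4, Pi.add_apply, h5, Pi.smul_apply, smul_eq_mul]
  refine (enorm_add_le _ _).trans ?_
  rw [enorm_mul, enorm_pow]
  have hlow := hM' (fun y => ‖f y‖ₑ) x hxΩ
  set E := eGreen Ω G (fun y => ‖f y‖ₑ) x with hE
  have e1 : ‖(∑ k ∈ Finset.range (N + N), z ^ k • (T ^ (k + 1)) f : L2Space Ω) x‖ₑ ≤
      (∑ k ∈ Finset.range (N + N), ((a + d).toNNReal : ℝ≥0∞) ^ k * B k) * E := by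
    refine h1.trans ?_
    rw [Finset.sum_mul]
    refine Finset.sum_le_sum fun k _ => ?_
    rw [mul_assoc]
    gcongr
    exact h2 k
  have e2 : ‖(T ^ N) g x‖ₑ ≤ (M * d⁻¹.toNNReal * M * M') * E := by
    calc _ ≤ M * ENNReal.ofReal (bdryDist Ω x ^ γ) * ‖g‖ₑ := h3
      _ ≤ M * ENNReal.ofReal (bdryDist Ω x ^ γ) * (d⁻¹.toNNReal * (M * ∫⁻ x in Ω,
            ENNReal.ofReal (bdryDist Ω x ^ γ) * ‖f x‖ₑ)) := by gcongr
      _ = (M * d⁻¹.toNNReal * M) * (ENNReal.ofReal (bdryDist Ω x ^ γ) * ∫⁻ x in Ω,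
            ENNReal.ofReal (bdryDist Ω x ^ γ) * ‖f x‖ₑ) := by ring
      _ ≤ (M * d⁻¹.toNNReal * M) * (M' * E) := by gcongr
      _ = _ := by ring
  calc _ ≤ (∑ k ∈ Finset.range (N + N), ((a + d).toNNReal : ℝ≥0∞) ^ k * B k) * E +
        ((a + d).toNNReal : ℝ≥0∞) ^ (N + N) * ((M * d⁻¹.toNNReal * M * M') * E) := by
        gcongr
    _ = _ := by
        push_cast
        ring

end IsGreenKernel

/-! ### Extension of the solution operator to L¹(Ω; δ^γ). -/

section Weighted

variable {n : ℕ} {Ω : Set (Eu n)} {w : Eu n → ℝ}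

lemma wMeasure_absolutelyContinuous : wMeasure Ω w ≪ volume.restrict Ω :=
  withDensity_absolutelyContinuous _ _

lemma absolutelyContinuous_wMeasure (hw : AEMeasurable w (volume.restrict Ω))
    (hpos : ∀ᵐ x ∂volume.restrict Ω, 0 < w x) : volume.restrict Ω ≪ wMeasure Ω w := by
  refine withDensity_absolutelyContinuous' hw.ennreal_ofReal ?_
  filter_upwards [hpos] with x hx
  simpa using hx

lemma lintegral_wMeasure (hw : AEMeasurable w (volume.restrict Ω)) (f : Eu n → ℝ≥0∞) :
    ∫⁻ x, f x ∂wMeasure Ω w = ∫⁻ x in Ω, ENNReal.ofReal (w x) * f x := by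
  rw [wMeasure, lintegral_withDensity_eq_lintegral_mul_non_measurable₀ _ hw.ennreal_ofReal
    (Eventually.of_forall fun _ => ENNReal.ofReal_lt_top)]
  rfl

lemma wL1Norm_eq (hw : AEMeasurable w (volume.restrict Ω)) (f : Eu n → ℝ) :
    wL1Norm Ω w f = ∫⁻ x in Ω, ENNReal.ofReal (w x) * ‖f x‖ₑ := by
  rw [wL1Norm, eLpNorm_one_eq_lintegral_enorm, lintegral_wMeasure hw]

end Weighted

namespace IsGreenKernel

variable {n : ℕ} {Ω : Set (Eu n)} {s γ C D : ℝ} {G : Eu n → Eu n → ℝ}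
  {lam : ℕ → ℝ} {φ : HilbertBasis ℕ ℝ (L2Space Ω)} {z : ℝ}

lemma ae_rpow_pos (h : IsGreenKernel Ω s γ C D G) (α : ℝ) :
    ∀ᵐ x ∂volume.restrict Ω, 0 < bdryDist Ω x ^ α := by
  filter_upwards [ae_restrict_mem h.measurableSet] with x hx
  exact Real.rpow_pos_of_pos (h.delta_pos x hx) _

lemma ac_wMeasure (h : IsGreenKernel Ω s γ C D G) (α : ℝ) :
    volume.restrict Ω ≪ wMeasure Ω fun x => bdryDist Ω x ^ α :=
  absolutelyContinuous_wMeasure (by fun_prop) (h.ae_rpow_pos α)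

lemma enorm_L1 (f : L1Space Ω γ) :
    ‖f‖ₑ = ∫⁻ x in Ω, ENNReal.ofReal (bdryDist Ω x ^ γ) * ‖f x‖ₑ := by
  rw [Lp.enorm_def, ← wL1Norm_eq (by fun_prop)]
  rfl

lemma memLp_one_wMeasure (h : IsGreenKernel Ω s γ C D G) (f : L2Space Ω) :
    MemLp f 1 (wMeasure Ω fun x => bdryDist Ω x ^ γ) := by
  refine ⟨(Lp.aestronglyMeasurable f).mono_ac wMeasure_absolutelyContinuous, ?_⟩
  change wL1Norm _ _ _ < ∞
  rw [wL1Norm_eq (by fun_prop)]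
  have hf := measurable_enorm_Lp f
  calc _ ≤ ∫⁻ x in Ω, ENNReal.ofReal (D ^ γ) * ‖f x‖ₑ := by
        refine setLIntegral_mono' h.measurableSet fun x hx => ?_
        gcongr
        exacts [(h.delta_pos x hx).le, h.γ_pos.le, h.delta_le x hx]
    _ < ∞ := by
        rw [lintegral_const_mul _ hf]
        exact ENNReal.mul_lt_top ENNReal.ofReal_lt_top (h.lintegral_enorm_lt_top f)

/-- The inclusion of `L²(Ω)` in `L¹(Ω; δ^γ)`. -/
lemma exists_inclusion (h : IsGreenKernel Ω s γ C D G) :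
    ∃ ι : L2Space Ω →ₗ[ℝ] L1Space Ω γ, DenseRange ι ∧
      ∀ f, (ι f : Eu n → ℝ) =ᵐ[volume.restrict Ω] f := by
  have hc : ∀ f : L2Space Ω, ((h.memLp_one_wMeasure f).toLp f : L1Space Ω γ)
      =ᵐ[volume.restrict Ω] f := fun f => (h.ac_wMeasure γ).ae_eq (MemLp.coeFn_toLp _)
  have hw : wMeasure Ω (fun x => bdryDist Ω x ^ γ) ≪ volume.restrict Ω :=
    wMeasure_absolutelyContinuous
  refine ⟨{ toFun := fun f => (h.memLp_one_wMeasure f).toLp f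
            map_add' := fun f g => ?_
            map_smul' := fun c f => ?_ }, ?_, hc⟩
  · rw [← MemLp.toLp_add, MemLp.toLp_eq_toLp_iff]
    exact hw.ae_eq (Lp.coeFn_add f g)
  · rw [RingHom.id_apply, ← MemLp.toLp_const_smul, MemLp.toLp_eq_toLp_iff]
    exact hw.ae_eq (Lp.coeFn_smul c f)
  -- Simple functions are dense in L¹(Ω; δ^γ), and they are in L²(Ω) because Ω has finite measure.
  · refine (Lp.simpleFunc.denseRange (E := ℝ) (p := 1)
      (μ := wMeasure Ω fun x => bdryDist Ω x ^ γ) ENNReal.one_ne_top).mono ?_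
    rintro _ ⟨f, rfl⟩
    have := h.isFiniteMeasure
    have hf := SimpleFunc.memLp_of_isFiniteMeasure (Lp.simpleFunc.toSimpleFunc f) 2
      (volume.restrict Ω)
    refine ⟨hf.toLp _, Lp.ext ?_⟩
    exact ((MemLp.coeFn_toLp (h.memLp_one_wMeasure _)).trans (hw.ae_eq hf.coeFn_toLp)).trans
      (Lp.simpleFunc.toSimpleFunc_eq_toFun f)

/-- The Green operator is bounded on `L¹(Ω; δ^γ)`. -/
lemma lintegral_rpow_mul_eGreen_le (h : IsGreenKernel Ω s γ C D G) :
    ∃ M : ℝ≥0, ∀ f : Eu n → ℝ≥0∞, Measurable f →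
      ∫⁻ x in Ω, ENNReal.ofReal (bdryDist Ω x ^ γ) * eGreen Ω G f x ≤
        M * ∫⁻ x in Ω, ENNReal.ofReal (bdryDist Ω x ^ γ) * f x := by
  obtain ⟨M, hM⟩ := h.eGreen_rpow_le h.γ_pos.le le_rfl (add_zero γ).le (by linarith [h.s_pos])
  rw [add_zero] at hM
  refine ⟨M, fun f hf => ?_⟩
  rw [h.lintegral_mul_eGreen hf (by fun_prop), ← lintegral_const_mul _ (by fun_prop)]
  refine setLIntegral_mono' h.measurableSet fun x hx => ?_
  calc _ ≤ f x * (M * ENNReal.ofReal (bdryDist Ω x ^ γ)) := by gcongr; exact hM x hx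
    _ = _ := by ring

lemma L1_ext {f g : L1Space Ω γ} (hfg : (f : Eu n → ℝ) =ᵐ[volume.restrict Ω] g) : f = g :=
  Lp.ext (wMeasure_absolutelyContinuous.ae_eq hfg)

/-- The solution operator extends uniquely to `L¹(Ω; δ^γ)`. -/
theorem existsUnique_isSolutionOperator (h : IsGreenKernel Ω s γ C D G)
    (hdiv : Tendsto lam atTop atTop) (hz : z ∉ Set.range lam) {A : ℝ≥0}
    (hA : ∀ f : L2Space Ω, ∀ᵐ x ∂volume.restrict Ω,
      ‖spectralSol lam φ z f x‖ₑ ≤ A * eGreen Ω G (fun y => ‖f y‖ₑ) x) :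
    ∃! T : L1Space Ω γ →L[ℝ] L1Space Ω γ, IsSolutionOperator lam φ z T := by
  obtain ⟨R, hR, -⟩ := exists_resolvent φ hdiv hz
  obtain ⟨ι, hι, hιf⟩ := h.exists_inclusion
  obtain ⟨M, hM⟩ := h.lintegral_rpow_mul_eGreen_le
  -- Domination and the bound for 𝔾₀ make the resolvent continuous for the weaker norm of L¹(Ω;
  -- δ^γ), as the extension by density requires.
  have hnorm : ∀ f : L2Space Ω, ‖ι.comp R.toLinearMap f‖ ≤ (A * M : ℝ≥0) * ‖ι f‖ := fun f => by
    have key : ‖ι (R f)‖ₑ ≤ (A * M : ℝ≥0) * ‖ι f‖ₑ := by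
      have hf := measurable_enorm_Lp f
      have hG := h.measurable_eGreen hf
      rw [enorm_L1, enorm_L1]
      calc _ ≤ ∫⁻ x in Ω, A * (ENNReal.ofReal (bdryDist Ω x ^ γ) *
              eGreen Ω G (fun y => ‖f y‖ₑ) x) := by
            refine lintegral_mono_ae ?_
            filter_upwards [hιf (R f), hA f] with x h1 h2
            rw [h1, ← hR, mul_left_comm]
            gcongr
        _ ≤ A * (M * ∫⁻ x in Ω, ENNReal.ofReal (bdryDist Ω x ^ γ) * ‖f x‖ₑ) := by
            rw [lintegral_const_mul _ (by fun_prop)]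
            gcongr
            exact hM _ hf
        _ = _ := by
            rw [ENNReal.coe_mul, mul_assoc]
            congr 2
            refine lintegral_congr_ae ?_
            filter_upwards [hιf f] with x h1
            rw [h1]
    have := ENNReal.toReal_mono (by finiteness) key
    simpa using this
  refine ⟨(ι.comp R.toLinearMap).extendOfNorm ι, fun f g hfg => ?_, fun T hT => ?_⟩
  · have h1 : g = ι f := L1_ext (hfg.trans (hιf f).symm)
    rw [h1, LinearMap.extendOfNorm_eq hι ⟨_, hnorm⟩, hR]
    exact hιf _
  · refine ContinuousLinearMap.ext fun g => ?_
    refine congrFun (hι.equalizer T.continuous (ContinuousLinearMap.continuous _) ?_) g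
    funext f
    rw [Function.comp_apply, Function.comp_apply, LinearMap.extendOfNorm_eq hι ⟨_, hnorm⟩]
    refine L1_ext ((hT f (ι f) (hιf f)).trans ?_)
    rw [hR]
    exact (hιf _).symm

/-- The pointwise domination by the Green operator passes to `L¹(Ω; δ^γ)`. -/
theorem enorm_solution_le (h : IsGreenKernel Ω s γ C D G) {A : ℝ≥0}
    (hA : ∀ f : L2Space Ω, ∀ᵐ x ∂volume.restrict Ω,
      ‖spectralSol lam φ z f x‖ₑ ≤ A * eGreen Ω G (fun y => ‖f y‖ₑ) x)
    {T : L1Space Ω γ →L[ℝ] L1Space Ω γ} (hT : IsSolutionOperator lam φ z T) (f : L1Space Ω γ) :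
    ∀ᵐ x ∂volume.restrict Ω, ‖T f x‖ₑ ≤ A * eGreen Ω G (fun y => ‖f y‖ₑ) x := by
  obtain ⟨ι, hι, hιf⟩ := h.exists_inclusion
  obtain ⟨M, hM⟩ := h.lintegral_rpow_mul_eGreen_le
  have hf := measurable_enorm_Lp f
  have hTf := measurable_enorm_Lp (T f)
  have hGf := h.measurable_eGreen hf
  -- Subtraction in [0,∞] is truncated, so E is the excess over the desired bound. Its weighted
  -- integral is at most a constant times ‖f - g‖ for every g in L², and density makes it zero.
  set E := fun x => ‖T f x‖ₑ - A * eGreen Ω G (fun y => ‖f y‖ₑ) x with hE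
  have hEm : Measurable E := by fun_prop
  have hle : ∀ g : L2Space Ω, ∫⁻ x in Ω, ENNReal.ofReal (bdryDist Ω x ^ γ) * E x ≤
      (‖T‖ₑ + A * M) * ‖f - ι g‖ₑ := fun g => by
    have hd := measurable_enorm_Lp (f - ι g)
    have hTd := measurable_enorm_Lp (T (f - ι g))
    have hGd := h.measurable_eGreen hd
    have h1 : ∀ x, eGreen Ω G (fun y => ‖g y‖ₑ) x ≤
        eGreen Ω G (fun y => ‖f y‖ₑ) x + eGreen Ω G (fun y => ‖(f - ι g) y‖ₑ) x := fun x => by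
      have h0 := h.measurable_enorm_right x
      rw [eGreen, eGreen, eGreen, ← lintegral_add_left (by fun_prop)]
      refine lintegral_mono_ae ?_
      filter_upwards [hιf g, h.ac_wMeasure γ (Lp.coeFn_sub f (ι g))] with y h1 h2
      rw [← mul_add, ← h1]
      gcongr
      have : ι g y = f y - (f - ι g : L1Space Ω γ) y := by
        have : (f - ι g : L1Space Ω γ) y = f y - ι g y := h2
        rw [this]; ring
      rw [this]
      exact enorm_sub_le
    calc _ ≤ ∫⁻ x in Ω, ENNReal.ofReal (bdryDist Ω x ^ γ) * ‖T (f - ι g) x‖ₑ +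
          A * (ENNReal.ofReal (bdryDist Ω x ^ γ) * eGreen Ω G (fun y => ‖(f - ι g) y‖ₑ) x) := by
          refine lintegral_mono_ae ?_
          filter_upwards [hT g (ι g) (hιf g), hA g,
            h.ac_wMeasure γ (Lp.coeFn_sub (T f) (T (ι g)))] with x h2 h3 h4
          rw [mul_left_comm (A : ℝ≥0∞), ← mul_add]
          gcongr
          rw [hE, tsub_le_iff_right]
          have h5 : T f x = T (f - ι g) x + T (ι g) x := by
            have : (T f - T (ι g) : L1Space Ω γ) x = T f x - T (ι g) x := h4
            rw [map_sub, this]; ring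
          calc ‖T f x‖ₑ ≤ ‖T (f - ι g) x‖ₑ + ‖T (ι g) x‖ₑ := by
                rw [h5]
                exact enorm_add_le _ _
            _ ≤ ‖T (f - ι g) x‖ₑ + A * (eGreen Ω G (fun y => ‖f y‖ₑ) x +
                  eGreen Ω G (fun y => ‖(f - ι g) y‖ₑ) x) := by
                gcongr
                rw [h2]
                refine h3.trans ?_
                gcongr
                exact h1 x
            _ = _ := by ring
      _ ≤ ‖T (f - ι g)‖ₑ + A * (M * ‖f - ι g‖ₑ) := by
          rw [lintegral_add_left (by fun_prop), lintegral_const_mul _ (by fun_prop),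
            enorm_L1 (T (f - ι g)), enorm_L1 (f - ι g)]
          gcongr
          exact hM _ hd
      _ ≤ _ := by
          rw [add_mul, mul_assoc]
          gcongr
          exact T.le_opENorm _
  have h0 : ∫⁻ x in Ω, ENNReal.ofReal (bdryDist Ω x ^ γ) * E x = 0 := by
    by_contra hne
    set I := ∫⁻ x in Ω, ENNReal.ofReal (bdryDist Ω x ^ γ) * E x
    have hIfin : I < ∞ := (hle 0).trans_lt (by finiteness)
    have hc : Continuous fun u : L1Space Ω γ => (‖T‖ₑ + A * M) * ‖f - u‖ₑ :=
      (ENNReal.continuous_const_mul (by finiteness)).comp (by fun_prop)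
    have : (fun u : L1Space Ω γ => (‖T‖ₑ + A * M) * ‖f - u‖ₑ) f < I := by
      simpa using pos_iff_ne_zero.2 hne
    obtain ⟨g, hg⟩ := hι.exists_mem_open (hc.isOpen_preimage _ isOpen_Iio) ⟨f, this⟩
    exact absurd (hle g) (not_le.2 hg)
  rw [lintegral_eq_zero_iff (by fun_prop)] at h0
  filter_upwards [h0, h.ae_rpow_pos γ] with x hx hpos
  have : E x = 0 := by
    refine (mul_eq_zero.1 hx).resolve_left ?_
    simpa using hpos
  exact tsub_eq_zero_iff_le.1 this

end IsGreenKernel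

/-! ### Weighted sup norms and weak-dual solutions. -/

section WeightedSup

variable {n : ℕ} {Ω : Set (Eu n)} {w f : Eu n → ℝ}

lemma ae_enorm_le_wSupNorm_mul (hw : ∀ᵐ x ∂volume.restrict Ω, 0 < w x) :
    ∀ᵐ x ∂volume.restrict Ω, ‖f x‖ₑ ≤ wSupNorm Ω w f * ENNReal.ofReal (w x) := by
  filter_upwards [hw, enorm_ae_le_eLpNormEssSup (fun x => f x / w x) (volume.restrict Ω)]
    with x hx h1
  rw [wSupNorm, eLpNorm_exponent_top]
  calc ‖f x‖ₑ = ‖f x / w x‖ₑ * ENNReal.ofReal (w x) := by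
        rw [← Real.enorm_of_nonneg hx.le, ← enorm_mul, div_mul_cancel₀ _ hx.ne']
    _ ≤ _ := by gcongr

lemma wSupNorm_le {c : ℝ≥0∞} (hw : ∀ᵐ x ∂volume.restrict Ω, 0 < w x)
    (h : ∀ᵐ x ∂volume.restrict Ω, ‖f x‖ₑ ≤ c * ENNReal.ofReal (w x)) : wSupNorm Ω w f ≤ c := by
  rw [wSupNorm, eLpNorm_exponent_top]
  refine eLpNormEssSup_le_of_ae_enorm_bound ?_
  filter_upwards [hw, h] with x hx h1
  rw [div_eq_mul_inv, enorm_mul, enorm_inv hx.ne', Real.enorm_of_nonneg hx.le]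
  rw [← div_eq_mul_inv]
  exact ENNReal.div_le_of_le_mul h1

end WeightedSup

namespace IsGreenKernel

variable {n : ℕ} {Ω : Set (Eu n)} {s γ C D : ℝ} {G : Eu n → Eu n → ℝ}
  {lam : ℕ → ℝ} {φ : HilbertBasis ℕ ℝ (L2Space Ω)} {z : ℝ}

lemma aestronglyMeasurable_L1 (h : IsGreenKernel Ω s γ C D G) (f : L1Space Ω γ) :
    AEStronglyMeasurable f (volume.restrict Ω) :=
  (Lp.aestronglyMeasurable f).mono_ac (h.ac_wMeasure γ)

/-- Functions in `δ^γ L^∞(Ω)` act on `L¹(Ω; δ^γ)`. -/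
lemma exists_pairing (h : IsGreenKernel Ω s γ C D G) {ψ : Eu n → ℝ}
    (hψ : AEStronglyMeasurable ψ (volume.restrict Ω)) {c : ℝ≥0∞} (hc : c < ∞)
    (hψc : ∀ᵐ x ∂volume.restrict Ω, ‖ψ x‖ₑ ≤ c * ENNReal.ofReal (bdryDist Ω x ^ γ)) :
    ∃ P : L1Space Ω γ →L[ℝ] ℝ, ∀ u : L1Space Ω γ,
      IntegrableOn (fun x => u x * ψ x) Ω ∧ P u = ∫ x in Ω, u x * ψ x := by
  have hle : ∀ u : L1Space Ω γ, ∫⁻ x in Ω, ‖u x * ψ x‖ₑ ≤ c * ‖u‖ₑ := fun u => by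
    have hu := measurable_enorm_Lp u
    rw [enorm_L1, ← lintegral_const_mul _ (by fun_prop)]
    refine lintegral_mono_ae ?_
    filter_upwards [hψc] with x hx
    calc _ ≤ ‖u x‖ₑ * (c * ENNReal.ofReal (bdryDist Ω x ^ γ)) := by
          rw [enorm_mul]
          gcongr
      _ = _ := by ring
  have hint : ∀ u : L1Space Ω γ, IntegrableOn (fun x => u x * ψ x) Ω := fun u =>
    ⟨(h.aestronglyMeasurable_L1 u).mul hψ, (hle u).trans_lt (by finiteness)⟩
  refine ⟨LinearMap.mkContinuous
    { toFun := fun u => ∫ x in Ω, u x * ψ x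
      map_add' := fun u v => ?_
      map_smul' := fun a u => ?_ } c.toReal fun u => ?_, fun u => ⟨hint u, rfl⟩⟩
  · rw [← integral_add (hint u) (hint v)]
    refine integral_congr_ae ?_
    filter_upwards [h.ac_wMeasure γ (Lp.coeFn_add u v)] with x hx
    have : (u + v : L1Space Ω γ) x = u x + v x := hx
    rw [this, add_mul]
  · rw [RingHom.id_apply, smul_eq_mul, ← integral_const_mul]
    refine integral_congr_ae ?_
    filter_upwards [h.ac_wMeasure γ (Lp.coeFn_smul a u)] with x hx
    have : (a • u : L1Space Ω γ) x = a * u x := hx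
    rw [this, mul_assoc]
  · have := ENNReal.toReal_mono (by finiteness)
      ((enorm_integral_le_lintegral_enorm (fun x => u x * ψ x)).trans (hle u))
    simpa using this

lemma inner_resolvent_comm {R : L2Space Ω →L[ℝ] L2Space Ω}
    (hR : ∀ f j, inner ℝ (φ j) (R f) = (lam j - z)⁻¹ * inner ℝ (φ j) f) (f g : L2Space Ω) :
    inner ℝ (R f) g = inner ℝ f (R g) := by
  rw [← φ.tsum_inner_mul_inner, ← φ.tsum_inner_mul_inner]
  congr 1
  funext j
  rw [real_inner_comm, hR, hR, real_inner_comm]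
  ring

/-- The test function δ^γ sign(u - v) is admissible, and it turns equality of the pairings into ∫
δ^γ |u - v| = 0. -/
lemma eq_of_forall_integral_eq (h : IsGreenKernel Ω s γ C D G) {u v : L1Space Ω γ}
    (huv : ∀ ψ : L2Space Ω, wSupNorm Ω (fun x => bdryDist Ω x ^ γ) ψ < ∞ →
      ∫ x in Ω, u x * ψ x = ∫ x in Ω, v x * ψ x) : u = v := by
  have := h.isFiniteMeasure
  set σ : Eu n → ℝ := fun x => bdryDist Ω x ^ γ * (SignType.sign (u x - v x) : ℝ) with hσ
  have hsign : Measurable fun r : ℝ => ((SignType.sign r : SignType) : ℝ) := by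
    have : (fun r : ℝ => ((SignType.sign r : SignType) : ℝ)) =
        fun r => if 0 < r then 1 else if r < 0 then -1 else 0 := by
      funext r
      rcases lt_trichotomy r 0 with hr | hr | hr
      · simp [hr, hr.le]
      · simp [hr]
      · simp [hr]
    rw [this]
    exact Measurable.ite measurableSet_Ioi measurable_const
      (Measurable.ite measurableSet_Iio measurable_const measurable_const)
  have hσm : AEStronglyMeasurable σ (volume.restrict Ω) := by
    refine AEStronglyMeasurable.mul (by fun_prop : Measurable _).aestronglyMeasurable ?_
    exact (hsign.comp_aemeasurable ((h.aestronglyMeasurable_L1 u).sub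
      (h.aestronglyMeasurable_L1 v)).aemeasurable).aestronglyMeasurable
  have hσle : ∀ x, ‖σ x‖ ≤ bdryDist Ω x ^ γ := fun x => by
    have h0 : 0 ≤ bdryDist Ω x ^ γ := Real.rpow_nonneg (bdryDist_nonneg Ω x) γ
    rw [hσ, norm_mul, Real.norm_of_nonneg h0]
    refine mul_le_of_le_one_right h0 ?_
    rcases SignType.sign (u x - v x) <;> simp
  have hσ2 : MemLp σ 2 (volume.restrict Ω) := by
    refine MemLp.of_bound hσm (D ^ γ) ?_
    filter_upwards [ae_restrict_mem h.measurableSet] with x hx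
    exact (hσle x).trans
      (Real.rpow_le_rpow (h.delta_pos x hx).le (h.delta_le x hx) h.γ_pos.le)
  have hσc : ∀ᵐ x ∂volume.restrict Ω,
      ‖hσ2.toLp σ x‖ₑ ≤ 1 * ENNReal.ofReal (bdryDist Ω x ^ γ) := by
    filter_upwards [hσ2.coeFn_toLp] with x hx
    rw [hx, one_mul, ← ofReal_norm]
    exact ENNReal.ofReal_le_ofReal (hσle x)
  have hsup : wSupNorm Ω (fun x => bdryDist Ω x ^ γ) (hσ2.toLp σ) < ∞ :=
    (wSupNorm_le (h.ae_rpow_pos γ) hσc).trans_lt ENNReal.one_lt_top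
  obtain ⟨P, hP⟩ := h.exists_pairing (Lp.aestronglyMeasurable (hσ2.toLp σ)) ENNReal.one_lt_top hσc
  have h1 : P (u - v) = 0 := by
    rw [map_sub, (hP u).2, (hP v).2, huv _ hsup, sub_self]
  have h2 : ∀ᵐ x ∂volume.restrict Ω, (u - v : L1Space Ω γ) x * hσ2.toLp σ x =
      bdryDist Ω x ^ γ * |u x - v x| := by
    filter_upwards [hσ2.coeFn_toLp, h.ac_wMeasure γ (Lp.coeFn_sub u v)] with x h3 h4
    have : (u - v : L1Space Ω γ) x = u x - v x := h4
    rw [this, h3, hσ, mul_left_comm, self_mul_sign]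
  rw [(hP _).2, integral_eq_zero_iff_of_nonneg_ae _ (hP _).1] at h1
  · refine L1_ext ?_
    filter_upwards [h1, h2, h.ae_rpow_pos γ] with x h3 h4 h5
    rw [h4] at h3
    have := (mul_eq_zero.1 h3).resolve_left h5.ne'
    linarith [abs_eq_zero.1 this]
  · filter_upwards [h2] with x hx
    rw [hx]
    exact mul_nonneg (Real.rpow_nonneg (bdryDist_nonneg Ω x) γ) (abs_nonneg _)

/-- `𝔾_z(f)` is the unique weak-dual solution. -/
theorem isWeakDualSolution_iff (h : IsGreenKernel Ω s γ C D G)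
    (hdiv : Tendsto lam atTop atTop) (hz : z ∉ Set.range lam) {A : ℝ≥0}
    (hA : ∀ f : L2Space Ω, ∀ᵐ x ∂volume.restrict Ω,
      ‖spectralSol lam φ z f x‖ₑ ≤ A * eGreen Ω G (fun y => ‖f y‖ₑ) x)
    {T : L1Space Ω γ →L[ℝ] L1Space Ω γ} (hT : IsSolutionOperator lam φ z T) (f u : L1Space Ω γ) :
    IsWeakDualSolution lam φ z f u ↔ u = T f := by
  obtain ⟨R, hR, -, hRφ, -⟩ := exists_resolvent φ hdiv hz
  obtain ⟨ι, hι, hιf⟩ := h.exists_inclusion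
  obtain ⟨M, hM⟩ := h.eGreen_rpow_le h.γ_pos.le le_rfl (add_zero γ).le (by linarith [h.s_pos])
  rw [add_zero] at hM
  have key : ∀ ψ : L2Space Ω, wSupNorm Ω (fun x => bdryDist Ω x ^ γ) ψ < ∞ → ∀ u : L1Space Ω γ,
      IntegrableOn (fun x => u x * ψ x) Ω ∧
      IntegrableOn (fun x => f x * spectralSol lam φ z ψ x) Ω ∧
      ∫ x in Ω, T f x * ψ x = ∫ x in Ω, f x * spectralSol lam φ z ψ x := fun ψ hψ u => by
    set c := wSupNorm Ω (fun x => bdryDist Ω x ^ γ) ψ with hc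
    have h1 : ∀ᵐ x ∂volume.restrict Ω, ‖ψ x‖ₑ ≤ c * ENNReal.ofReal (bdryDist Ω x ^ γ) :=
      ae_enorm_le_wSupNorm_mul (h.ae_rpow_pos γ)
    have h2 : ∀ᵐ x ∂volume.restrict Ω, ‖spectralSol lam φ z ψ x‖ₑ ≤
        (A * (c * M)) * ENNReal.ofReal (bdryDist Ω x ^ γ) := by
      filter_upwards [hA ψ, ae_restrict_mem h.measurableSet] with x hx hxΩ
      refine hx.trans ?_
      rw [mul_assoc, mul_assoc]
      gcongr
      calc _ ≤ eGreen Ω G (fun y => c * ENNReal.ofReal (bdryDist Ω y ^ γ)) x := eGreen_mono h1 x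
        _ = c * eGreen Ω G (fun y => ENNReal.ofReal (bdryDist Ω y ^ γ)) x :=
            eGreen_const_mul hψ.ne _ _
        _ ≤ _ := by gcongr; exact hM x hxΩ
    obtain ⟨P, hP⟩ := h.exists_pairing (Lp.aestronglyMeasurable ψ) hψ h1
    obtain ⟨Q, hQ⟩ := h.exists_pairing (Lp.aestronglyMeasurable (spectralSol lam φ z ψ))
      (by finiteness) h2
    refine ⟨(hP u).1, (hQ f).1, ?_⟩
    rw [← (hP _).2, ← (hQ _).2]
    -- Both sides are continuous in f on L¹(Ω; δ^γ), so it suffices to compare them on L², where the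
    -- identity is the symmetry of the resolvent.
    refine congrFun (hι.equalizer (P.continuous.comp T.continuous) Q.continuous ?_) f
    funext g
    change P (T (ι g)) = Q (ι g)
    rw [(hP _).2, (hQ _).2]
    calc ∫ x in Ω, T (ι g) x * ψ x = inner ℝ (R g) ψ := by
          rw [L2.inner_def]
          refine integral_congr_ae ?_
          filter_upwards [hT g (ι g) (hιf g)] with x hx
          rw [hx, hR]
          simp [mul_comm]
      _ = inner ℝ g (R ψ) := inner_resolvent_comm hRφ g ψ
      _ = _ := by
          rw [L2.inner_def]
          refine integral_congr_ae ?_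
          filter_upwards [hιf g] with x hx
          rw [hx, hR]
          simp [mul_comm]
  refine ⟨fun hu => h.eq_of_forall_integral_eq fun ψ hψ => ?_, ?_⟩
  · rw [(hu ψ hψ).2.2, (key ψ hψ u).2.2]
  · rintro rfl ψ hψ
    exact key ψ hψ (T f)

end IsGreenKernel

/-! ### Riesz potentials between Lebesgue spaces on Ω. -/

lemma eLpNorm_ofReal_eq {α ε : Type*} [MeasurableSpace α] [ENorm ε] {μ : Measure α} {p : ℝ}
    (hp : 0 < p) (f : α → ε) :
    eLpNorm f (ENNReal.ofReal p) μ = (∫⁻ x, ‖f x‖ₑ ^ p ∂μ) ^ (1 / p) := by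
  rw [eLpNorm_eq_lintegral_rpow_enorm_toReal (by simpa using hp) ENNReal.ofReal_ne_top,
    ENNReal.toReal_ofReal hp.le]

/-- The Riesz potential of order `2 s` maps `L^p(Ω)` to `L^q(Ω)` continuously. -/
def RieszMapsBoundedly {n : ℕ} (Ω : Set (Eu n)) (s : ℝ) (p q : ℝ≥0∞) : Prop :=
  ∃ M : ℝ≥0, ∀ F : Eu n → ℝ≥0∞, Measurable F → eLpNorm F p (volume.restrict Ω) < ∞ →
    eLpNorm (eRiesz Ω (2 * s) F) q (volume.restrict Ω) ≤ M * eLpNorm F p (volume.restrict Ω)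

namespace IsGreenKernel

variable {n : ℕ} {Ω : Set (Eu n)} {s γ C D : ℝ} {G : Eu n → Eu n → ℝ}

lemma riesz_rpow_le (h : IsGreenKernel Ω s γ C D G) {p : ℝ} (hp : 1 ≤ p)
    (hp1 : p < n / (n - 2 * s)) :
    ∃ M : ℝ≥0, ∀ x ∈ Ω, ∫⁻ y in Ω, ENNReal.ofReal (dist x y ^ (2 * s - n)) ^ p ≤ M := by
  have h1 : (0 : ℝ) < n - 2 * s := by linarith [h.two_s_lt]
  rw [lt_div_iff₀ h1] at hp1
  obtain ⟨M, hM⟩ := h.lintegral_riesz_le (e := n - p * (n - 2 * s)) (by linarith)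
  refine ⟨M, fun x hx => le_of_eq_of_le (lintegral_congr fun y => ?_) (hM x hx)⟩
  rw [ENNReal.ofReal_rpow_of_nonneg (by positivity) (by linarith), ← Real.rpow_mul dist_nonneg]
  ring_nf

/-- Jensen with F in the role of the measure gives (∫ kF)^p ≤ (∫ F)^{p-1} ∫ F k^p. Tonelli then
needs only the p-th power of the kernel to be integrable, which is the condition p < n/(n-2s). -/
lemma rieszMapsBoundedly_one (h : IsGreenKernel Ω s γ C D G) {p : ℝ} (hp : 1 ≤ p)
    (hp1 : p < n / (n - 2 * s)) : RieszMapsBoundedly Ω s 1 (ENNReal.ofReal p) := by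
  obtain ⟨M, hM⟩ := h.riesz_rpow_le hp hp1
  have hp0 : 0 < p := by linarith
  refine ⟨(M ^ (1 / p)), fun F hF hfin => ?_⟩
  rw [eLpNorm_one_eq_lintegral_enorm] at hfin ⊢
  rw [eLpNorm_ofReal_eq hp0]
  simp only [enorm_eq_self] at hfin ⊢
  set I := ∫⁻ x in Ω, F x with hI
  have hk : ∀ x : Eu n, Measurable fun y : Eu n => ENNReal.ofReal (dist x y ^ (2 * s - n)) :=
    fun x => by fun_prop
  have h1 : ∀ x, eRiesz Ω (2 * s) F x ^ p ≤
      I ^ (p - 1) * ∫⁻ y in Ω, F y * ENNReal.ofReal (dist x y ^ (2 * s - n)) ^ p := fun x => by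
    have := lintegral_mul_rpow_le (μ := volume.restrict Ω) hF.aemeasurable (hk x).aemeasurable hp
    rw [eRiesz]
    simpa only [mul_comm (F _)] using this
  have h2 : ∫⁻ x in Ω, eRiesz Ω (2 * s) F x ^ p ≤ I ^ (p - 1) * (M * I) := by
    refine (lintegral_mono fun x => h1 x).trans ?_
    rw [lintegral_const_mul' _ _ (ENNReal.rpow_ne_top_of_nonneg (by linarith) hfin.ne)]
    gcongr
    rw [lintegral_lintegral_swap]
    · rw [hI, ← lintegral_const_mul _ hF]
      refine setLIntegral_mono' h.measurableSet fun y hy => ?_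
      rw [lintegral_const_mul _ ((by fun_prop))]
      rw [mul_comm]
      gcongr
      simpa only [dist_comm y] using hM y hy
    · have := measurable_rieszKernel (n := n) (2 * s - n)
      exact ((hF.comp measurable_snd).mul (this.pow_const p)).aemeasurable
  calc _ ≤ (I ^ (p - 1) * (M * I)) ^ (1 / p) := by gcongr
    _ = (M * I ^ p) ^ (1 / p) := by
        congr 1
        rcases eq_or_ne I 0 with h0 | h0
        · simp [h0, hp0]
        · rw [ENNReal.rpow_sub _ _ h0 hfin.ne, ENNReal.rpow_one, mul_left_comm,
            ENNReal.div_mul_cancel h0 hfin.ne]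
    _ = _ := by
        rw [ENNReal.mul_rpow_of_nonneg _ _ (by positivity), ← ENNReal.rpow_mul,
          mul_one_div_cancel hp0.ne', ENNReal.rpow_one,
          ENNReal.coe_rpow_of_nonneg _ (by positivity)]

lemma exponent_pos (h : IsGreenKernel Ω s γ C D G) {p q : ℝ} (hp : 1 < p) (hpn : p < n / (2 * s))
    (hpq : 1 / q = 1 / p - 2 * s / n) : p < q := by
  have hn : (0 : ℝ) < n := by have := h.one_le; positivity
  have hs := h.s_pos
  have h1 : 0 < 2 * s / n := by positivity
  have h2 : 0 < 1 / q := by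
    rw [hpq, sub_pos, div_lt_div_iff₀ hn (by linarith)]
    rw [lt_div_iff₀ (by positivity)] at hpn
    linarith
  have h3 : 0 < q := one_div_pos.1 h2
  exact (one_div_lt_one_div h3 (by linarith)).1 (by linarith)

lemma rieszMapsBoundedly_sobolev (h : IsGreenKernel Ω s γ C D G) {p q : ℝ} (hp : 1 < p)
    (hpn : p < n / (2 * s)) (hpq : 1 / q = 1 / p - 2 * s / n) :
    RieszMapsBoundedly Ω s (ENNReal.ofReal p) (ENNReal.ofReal q) := by
  have hq : 0 < q := by linarith [h.exponent_pos hp hpn hpq]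
  have hp0 : 0 < p := by linarith
  obtain ⟨M, hM⟩ := hardy_littlewood_sobolev h.one_le (a := 2 * s) (by linarith [h.s_pos]) hp hq hpq
  refine ⟨M, fun F hF hfin => ?_⟩
  rw [eLpNorm_ofReal_eq hp0] at hfin ⊢
  rw [eLpNorm_ofReal_eq hq]
  simp only [enorm_eq_self] at hfin ⊢
  have e : ∫⁻ x, Ω.indicator F x ^ p = ∫⁻ x in Ω, F x ^ p := by
    rw [← lintegral_indicator h.measurableSet]
    refine lintegral_congr fun x => ?_
    by_cases hx : x ∈ Ω <;> simp [hx, hp0]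
  have hfin' : ∫⁻ x in Ω, F x ^ p < ∞ := by
    by_contra hne
    rw [not_lt, top_le_iff] at hne
    rw [hne, ENNReal.top_rpow_of_pos (by positivity)] at hfin
    exact absurd hfin (lt_irrefl _)
  have := hM (Ω.indicator F) (hF.indicator h.measurableSet) (by rwa [e])
  rw [e] at this
  refine le_trans ?_ this
  refine ENNReal.rpow_le_rpow ?_ (by positivity)
  refine (lintegral_mono fun x => ?_).trans (setLIntegral_le_lintegral Ω _)
  refine ENNReal.rpow_le_rpow ?_ hq.le
  rw [eRiesz, ← lintegral_indicator h.measurableSet]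
  refine le_of_eq (lintegral_congr fun y => ?_)
  by_cases hy : y ∈ Ω <;> simp [hy]

lemma rieszMapsBoundedly_top_of_ae (h : IsGreenKernel Ω s γ C D G) {p : ℝ≥0∞} {M : ℝ≥0}
    (hM : ∀ F : Eu n → ℝ≥0∞, Measurable F → ∀ x ∈ Ω,
      eRiesz Ω (2 * s) F x ≤ M * eLpNorm F p (volume.restrict Ω)) :
    RieszMapsBoundedly Ω s p ∞ := by
  refine ⟨M, fun F hF _ => ?_⟩
  rw [eLpNorm_exponent_top]
  refine eLpNormEssSup_le_of_ae_enorm_bound ?_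
  filter_upwards [ae_restrict_mem h.measurableSet] with x hx
  exact hM F hF x hx

/-- Hölder: the exponent conjugate to q is below n/(n-2s) because q > n/(2s), so the kernel is
uniformly in its Lebesgue space. -/
lemma rieszMapsBoundedly_top (h : IsGreenKernel Ω s γ C D G) {q : ℝ} (hq : n / (2 * s) < q) :
    RieszMapsBoundedly Ω s (ENNReal.ofReal q) ∞ := by
  have hs := h.s_pos
  have hlt := h.two_s_lt
  have h1 : (1 : ℝ) < n / (2 * s) := by rwa [one_lt_div (by positivity)]
  have hq1 : 1 < q := h1.trans hq
  have hconj : (Real.conjExponent q).HolderConjugate q := (Real.HolderConjugate.conjExponent hq1).symm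
  set p := Real.conjExponent q with hp
  have hp1 : p < n / (n - 2 * s) := by
    rw [hp, Real.conjExponent, div_lt_div_iff₀ (by linarith) (by linarith)]
    rw [div_lt_iff₀ (by positivity)] at hq
    nlinarith
  obtain ⟨M, hM⟩ := h.riesz_rpow_le hconj.lt.le hp1
  refine h.rieszMapsBoundedly_top_of_ae (M := M ^ (1 / p)) fun F hF x hx => ?_
  rw [eLpNorm_ofReal_eq (by linarith)]
  simp only [enorm_eq_self]
  have hk : Measurable fun y : Eu n => ENNReal.ofReal (dist x y ^ (2 * s - n)) := by fun_prop
  refine (ENNReal.lintegral_mul_le_Lp_mul_Lq (volume.restrict Ω) hconj hk.aemeasurable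
    hF.aemeasurable).trans ?_
  have hpp : 0 ≤ 1 / p := one_div_nonneg.2 hconj.nonneg
  rw [ENNReal.coe_rpow_of_nonneg _ hpp]
  gcongr
  exact hM x hx

lemma rieszMapsBoundedly_top_top (h : IsGreenKernel Ω s γ C D G) : RieszMapsBoundedly Ω s ∞ ∞ := by
  obtain ⟨M, hM⟩ := h.lintegral_riesz_le (e := 2 * s) (by linarith [h.s_pos])
  refine h.rieszMapsBoundedly_top_of_ae (M := M) fun F hF x hx => ?_
  have hk : Measurable fun y : Eu n => ENNReal.ofReal (dist x y ^ (2 * s - n)) := by fun_prop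
  calc eRiesz Ω (2 * s) F x ≤ ∫⁻ y in Ω, ENNReal.ofReal (dist x y ^ (2 * s - n)) *
        eLpNorm F ∞ (volume.restrict Ω) := by
        refine lintegral_mono_ae ?_
        filter_upwards [enorm_ae_le_eLpNormEssSup F (volume.restrict Ω)] with y hy
        rw [eLpNorm_exponent_top]
        gcongr
        exact hy
    _ ≤ _ := by
        rw [lintegral_mul_const _ hk]
        gcongr
        exact hM x hx

end IsGreenKernel

/-! ### Global mapping properties. -/

namespace IsGreenKernel

variable {n : ℕ} {Ω : Set (Eu n)} {s γ C D : ℝ} {G : Eu n → Eu n → ℝ}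
  {lam : ℕ → ℝ} {φ : HilbertBasis ℕ ℝ (L2Space Ω)}

lemma wL1Norm_lt_top_of_eLpNorm (h : IsGreenKernel Ω s γ C D G) {p : ℝ≥0∞} (hp : 1 ≤ p)
    {f : Eu n → ℝ} (hf : AEStronglyMeasurable f (volume.restrict Ω))
    (hfp : LpNormOn p Ω f < ∞) : wL1Norm Ω (fun x => bdryDist Ω x ^ γ) f < ∞ := by
  have := h.isFiniteMeasure
  have h1 : eLpNorm f 1 (volume.restrict Ω) < ∞ :=
    (MemLp.mono_exponent (⟨hf, hfp⟩ : MemLp f p (volume.restrict Ω)) hp).2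
  rw [eLpNorm_one_eq_lintegral_enorm] at h1
  rw [wL1Norm_eq (by fun_prop)]
  calc _ ≤ ∫⁻ x in Ω, ENNReal.ofReal (D ^ γ) * ‖f x‖ₑ := by
        refine setLIntegral_mono' h.measurableSet fun x hx => ?_
        gcongr
        exacts [(h.delta_pos x hx).le, h.γ_pos.le, h.delta_le x hx]
    _ < ∞ := by
        rw [lintegral_const_mul' _ _ ENNReal.ofReal_ne_top]
        exact ENNReal.mul_lt_top ENNReal.ofReal_lt_top h1

/-- Transfer principle: given the domination, a bound for functions dominated by a 𝔾₀|f| suffices.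
The norm must respect almost everywhere equality since f is replaced by its class in L¹(Ω; δ^γ). -/
lemma solMapsBoundedly_of_le (h : IsGreenKernel Ω s γ C D G) {A : ℝ → ℝ → ℝ≥0}
    (hA : ∀ z ∉ Set.range lam, ∀ T : L1Space Ω γ →L[ℝ] L1Space Ω γ, IsSolutionOperator lam φ z T →
      ∀ f : L1Space Ω γ, ∀ᵐ x ∂volume.restrict Ω, ‖T f x‖ₑ ≤
        A (nextEigenvalue lam z) (spectralDist lam z) * eGreen Ω G (fun y => ‖f y‖ₑ) x)
    {NX NY : (Eu n → ℝ) → ℝ≥0∞} (hNX : ∀ f g, f =ᵐ[volume.restrict Ω] g → NX f = NX g)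
    (hX : ∀ f, AEStronglyMeasurable f (volume.restrict Ω) → NX f < ∞ →
      wL1Norm Ω (fun x => bdryDist Ω x ^ γ) f < ∞)
    {M : ℝ≥0} (hY : ∀ f u : L1Space Ω γ, NX f < ∞ → ∀ a : ℝ≥0,
      (∀ᵐ x ∂volume.restrict Ω, ‖u x‖ₑ ≤ a * eGreen Ω G (fun y => ‖f y‖ₑ) x) →
        NY u ≤ (a * M : ℝ≥0) * NX f) :
    SolMapsBoundedly γ lam φ NX NY := by
  refine ⟨fun a d => A a d * M, fun z hz T hT f hf hfin => ?_⟩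
  have hmem : MemLp f 1 (wMeasure Ω fun x => bdryDist Ω x ^ γ) :=
    ⟨hf.mono_ac wMeasure_absolutelyContinuous, hX f hf hfin⟩
  have hfg : NX (hmem.toLp f) = NX f := hNX _ _ ((h.ac_wMeasure γ).ae_eq hmem.coeFn_toLp)
  refine ⟨hmem, ?_⟩
  rw [← hfg] at hfin ⊢
  exact hY _ _ hfin _ (hA z hz T hT _)

lemma solMapsBoundedly_of_riesz (h : IsGreenKernel Ω s γ C D G) {A : ℝ → ℝ → ℝ≥0}
    (hA : ∀ z ∉ Set.range lam, ∀ T : L1Space Ω γ →L[ℝ] L1Space Ω γ, IsSolutionOperator lam φ z T →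
      ∀ f : L1Space Ω γ, ∀ᵐ x ∂volume.restrict Ω, ‖T f x‖ₑ ≤
        A (nextEigenvalue lam z) (spectralDist lam z) * eGreen Ω G (fun y => ‖f y‖ₑ) x)
    {p q : ℝ≥0∞} (hp : 1 ≤ p) (hpq : RieszMapsBoundedly Ω s p q) :
    SolMapsBoundedly γ lam φ (LpNormOn p Ω) (LpNormOn q Ω) := by
  obtain ⟨M, hM⟩ := hpq
  refine h.solMapsBoundedly_of_le hA (fun f g hfg => eLpNorm_congr_ae hfg)
    (fun f hf => h.wL1Norm_lt_top_of_eLpNorm hp hf) (M := C.toNNReal * M) fun f u hfin a hu => ?_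
  have hF : eLpNorm (fun y => ‖f y‖ₑ) p (volume.restrict Ω) =
      eLpNorm f p (volume.restrict Ω) := eLpNorm_enorm f
  have hMf := hM _ (measurable_enorm_Lp f) (by rw [hF]; exact hfin)
  rw [hF] at hMf
  calc LpNormOn q Ω u ≤ (a * C.toNNReal : ℝ≥0) *
        eLpNorm (eRiesz Ω (2 * s) fun y => ‖f y‖ₑ) q (volume.restrict Ω) := by
        refine eLpNorm_le_mul_eLpNorm_of_ae_le_mul' ?_ q
        filter_upwards [hu, ae_restrict_mem h.measurableSet] with x hx hxΩ
        rw [enorm_eq_self, ENNReal.coe_mul, mul_assoc]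
        exact hx.trans (mul_le_mul' le_rfl (h.eGreen_le_eRiesz _ hxΩ))
    _ ≤ (a * C.toNNReal : ℝ≥0) * (M * LpNormOn p Ω f) := by
        gcongr
        exact hMf
    _ = _ := by
        push_cast
        ring

/-! ### Boundary weights -/

/-- Split at distance δ(x)/2 from x. Closer to x the weight is bounded and the kernel is integrable;
farther away the kernel is bounded and the weight is integrable. -/
lemma eRiesz_bdryDist_rpow_lt_top (h : IsGreenKernel Ω s γ C D G) {β : ℝ}
    (hβ : ∫⁻ x in Ω, ENNReal.ofReal (bdryDist Ω x ^ β) < ∞) {x : Eu n} (hx : x ∈ Ω) :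
    eRiesz Ω (2 * s) (fun y => ENNReal.ofReal (bdryDist Ω y ^ β)) x < ∞ := by
  have hδ := h.delta_pos x hx
  set a := bdryDist Ω x / 2 with ha
  have ha0 : 0 < a := by positivity
  obtain ⟨M, hM⟩ := h.lintegral_riesz_le (e := 2 * s) (by linarith [h.s_pos])
  have hk : Measurable fun y : Eu n => ENNReal.ofReal (dist x y ^ (2 * s - n)) := by fun_prop
  have hle : ∀ᵐ y ∂volume.restrict Ω,
      ENNReal.ofReal (dist x y ^ (2 * s - n)) * ENNReal.ofReal (bdryDist Ω y ^ β) ≤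
        ENNReal.ofReal (dist x y ^ (2 * s - n)) * ENNReal.ofReal (a ^ β + D ^ β) +
        ENNReal.ofReal (a ^ (2 * s - n)) * ENNReal.ofReal (bdryDist Ω y ^ β) := by
    filter_upwards [ae_restrict_mem h.measurableSet] with y hy
    rcases lt_or_ge (dist x y) a with hd | hd
    · refine le_add_right (mul_le_mul' le_rfl (ENNReal.ofReal_le_ofReal ?_))
      have h1 : a ≤ bdryDist Ω y := by linarith [bdryDist_le_add Ω x y]
      have hy0 := h.delta_pos y hy
      have hD := h.D_pos
      -- On the near part a ≤ δ(y) ≤ D; the sum a^β + D^β covers either sign of β.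
      rcases le_total 0 β with hb | hb
      · have := Real.rpow_le_rpow hy0.le (h.delta_le y hy) hb
        have : 0 ≤ a ^ β := by positivity
        linarith
      · have := Real.rpow_le_rpow_of_nonpos ha0 h1 hb
        have : 0 ≤ D ^ β := by positivity
        linarith
    · refine le_add_left (mul_le_mul' (ENNReal.ofReal_le_ofReal ?_) le_rfl)
      exact Real.rpow_le_rpow_of_nonpos ha0 hd (by linarith [h.two_s_lt])
  refine (lintegral_mono_ae hle).trans_lt ?_
  rw [lintegral_add_left (by fun_prop), lintegral_mul_const _ hk,
    lintegral_const_mul _ (by fun_prop)]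
  have := hM x hx
  exact ENNReal.add_lt_top.2 ⟨ENNReal.mul_lt_top (this.trans_lt ENNReal.coe_lt_top)
    ENNReal.ofReal_lt_top, ENNReal.mul_lt_top ENNReal.ofReal_lt_top hβ⟩

lemma eGreen_bdryDist_rpow_lt_top (h : IsGreenKernel Ω s γ C D G) {α : ℝ}
    (hα : ∫⁻ x in Ω, ENNReal.ofReal (bdryDist Ω x ^ (γ + α)) < ∞) {x : Eu n} (hx : x ∈ Ω) :
    eGreen Ω G (fun y => ENNReal.ofReal (bdryDist Ω y ^ α)) x < ∞ := by
  have h1 := h.rpow_mul_eGreen_le (fun y => ENNReal.ofReal (bdryDist Ω y ^ α)) hx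
  have h2 : eRiesz Ω (2 * s) (fun y => ENNReal.ofReal (bdryDist Ω y ^ γ) *
      ENNReal.ofReal (bdryDist Ω y ^ α)) x < ∞ := by
    refine lt_of_eq_of_lt ?_ (h.eRiesz_bdryDist_rpow_lt_top hα hx)
    refine setLIntegral_congr_fun h.measurableSet fun y hy => ?_
    simp only
    have hy0 := h.delta_pos y hy
    rw [← ENNReal.ofReal_mul (by positivity), ← Real.rpow_add hy0]
  have h3 := h1.trans_lt (ENNReal.mul_lt_top ENNReal.ofReal_lt_top h2)
  refine ENNReal.lt_top_of_mul_ne_top_right h3.ne ?_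
  simpa using Real.rpow_pos_of_pos (h.delta_pos x hx) γ

lemma ofReal_greenOp_bdryDist_rpow (h : IsGreenKernel Ω s γ C D G) {α : ℝ}
    (hα : ∫⁻ x in Ω, ENNReal.ofReal (bdryDist Ω x ^ (γ + α)) < ∞) {x : Eu n} (hx : x ∈ Ω) :
    ENNReal.ofReal (greenOp Ω G (fun y => bdryDist Ω y ^ α) x) =
      eGreen Ω G (fun y => ENNReal.ofReal (bdryDist Ω y ^ α)) x := by
  have hG : Measurable (G x) := h.meas.of_uncurry_left
  have hae : ∀ᵐ y ∂volume.restrict Ω, 0 ≤ G x y * bdryDist Ω y ^ α ∧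
      ENNReal.ofReal (G x y * bdryDist Ω y ^ α) =
        ‖G x y‖ₑ * ENNReal.ofReal (bdryDist Ω y ^ α) := by
    filter_upwards [h.ae_ne x] with y hy
    have h1 := (h.pos hx hy.1 hy.2.symm).le
    have h2 : 0 ≤ bdryDist Ω y ^ α := Real.rpow_nonneg (bdryDist_nonneg Ω y) α
    exact ⟨mul_nonneg h1 h2, by rw [ENNReal.ofReal_mul h1, Real.enorm_of_nonneg h1]⟩
  rw [greenOp, integral_eq_lintegral_of_nonneg_ae (hae.mono fun y hy => hy.1)
    (by fun_prop : Measurable _).aestronglyMeasurable,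
    lintegral_congr_ae (hae.mono fun y hy => hy.2)]
  -- Finiteness matters: otherwise the real-valued integral would be 0 by convention and the two
  -- sides would differ.
  exact ENNReal.ofReal_toReal (h.eGreen_bdryDist_rpow_lt_top hα hx).ne

lemma exists_rpow_le_eGreen_rpow (h : IsGreenKernel Ω s γ C D G) (α : ℝ) :
    ∃ M : ℝ≥0, ∀ x ∈ Ω, ENNReal.ofReal (bdryDist Ω x ^ γ) ≤
      M * eGreen Ω G (fun y => ENNReal.ofReal (bdryDist Ω y ^ α)) x := by
  obtain ⟨M, hM⟩ := h.le_eGreen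
  set I := ∫⁻ y in Ω, ENNReal.ofReal (bdryDist Ω y ^ γ) * ENNReal.ofReal (bdryDist Ω y ^ α) with hI
  have hI0 : I ≠ 0 := by
    rw [hI, Ne, lintegral_eq_zero_iff (by fun_prop)]
    intro h0
    have h1 : ∀ᵐ y ∂volume.restrict Ω, False := by
      filter_upwards [h0, h.ae_rpow_pos γ, h.ae_rpow_pos α] with y h2 h3 h4
      simp only [Pi.zero_apply, mul_eq_zero, ENNReal.ofReal_eq_zero] at h2
      rcases h2 with h2 | h2 <;> linarith
    rw [eventually_false_iff_eq_bot, ae_eq_bot, Measure.restrict_eq_zero] at h1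
    exact (h.isOpen.measure_pos volume h.nonempty).ne' h1
  -- A finite positive number below I replaces I, which need not be finite.
  obtain ⟨c, hc0, hcI⟩ : ∃ c : ℝ≥0, c ≠ 0 ∧ (c : ℝ≥0∞) ≤ I := by
    obtain ⟨c, hc0, hc⟩ := ENNReal.lt_iff_exists_nnreal_btwn.1 (pos_iff_ne_zero.2 hI0)
    exact ⟨c, by simpa using hc0.ne', hc.le⟩
  refine ⟨c⁻¹ * M, fun x hx => ?_⟩
  have h1 := hM (fun y => ENNReal.ofReal (bdryDist Ω y ^ α)) x hx
  have h2 : ENNReal.ofReal (bdryDist Ω x ^ γ) * c ≤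
      M * eGreen Ω G (fun y => ENNReal.ofReal (bdryDist Ω y ^ α)) x :=
    (mul_le_mul' le_rfl hcI).trans h1
  rw [ENNReal.coe_mul, ENNReal.coe_inv hc0, mul_assoc, mul_comm, ← div_eq_mul_inv]
  exact (ENNReal.le_div_iff_mul_le (by simp [hc0]) (by simp)).2 h2

lemma ae_greenOp_bdryDist_rpow_pos (h : IsGreenKernel Ω s γ C D G) {α : ℝ}
    (hα : ∫⁻ x in Ω, ENNReal.ofReal (bdryDist Ω x ^ (γ + α)) < ∞) :
    ∀ᵐ x ∂volume.restrict Ω, 0 < greenOp Ω G (fun y => bdryDist Ω y ^ α) x := by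
  obtain ⟨M, hM⟩ := h.exists_rpow_le_eGreen_rpow α
  filter_upwards [ae_restrict_mem h.measurableSet] with x hx
  have h1 := hM x hx
  rw [← h.ofReal_greenOp_bdryDist_rpow hα hx] at h1
  by_contra h0
  rw [ENNReal.ofReal_of_nonpos (not_lt.1 h0), mul_zero, nonpos_iff_eq_zero,
    ENNReal.ofReal_eq_zero] at h1
  exact absurd (Real.rpow_pos_of_pos (h.delta_pos x hx) γ) (not_lt.2 h1)

lemma measurable_greenOp_bdryDist_rpow (h : IsGreenKernel Ω s γ C D G) (α : ℝ) :
    Measurable (greenOp Ω G fun y => bdryDist Ω y ^ α) :=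
  (h.stronglyMeasurable_greenOp (by fun_prop : Measurable _).stronglyMeasurable).measurable

/-- Duality: ∫ δ^α 𝔾₀|f| = ∫ 𝔾₀(δ^α) |f|. The inclusion in L¹(Ω; δ^γ) holds because δ^γ ≤ M 𝔾₀(δ^α).
-/
lemma solMapsBoundedly_wL1 (h : IsGreenKernel Ω s γ C D G) {A : ℝ → ℝ → ℝ≥0}
    (hA : ∀ z ∉ Set.range lam, ∀ T : L1Space Ω γ →L[ℝ] L1Space Ω γ, IsSolutionOperator lam φ z T →
      ∀ f : L1Space Ω γ, ∀ᵐ x ∂volume.restrict Ω, ‖T f x‖ₑ ≤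
        A (nextEigenvalue lam z) (spectralDist lam z) * eGreen Ω G (fun y => ‖f y‖ₑ) x)
    {α : ℝ} (hα : ∫⁻ x in Ω, ENNReal.ofReal (bdryDist Ω x ^ (γ + α)) < ∞) :
    SolMapsBoundedly γ lam φ (wL1Norm Ω (greenOp Ω G fun x => bdryDist Ω x ^ α))
      (wL1Norm Ω fun x => bdryDist Ω x ^ α) := by
  have hGm := h.measurable_greenOp_bdryDist_rpow α
  have hX : ∀ f : Eu n → ℝ, wL1Norm Ω (greenOp Ω G fun x => bdryDist Ω x ^ α) f =
      ∫⁻ x in Ω, eGreen Ω G (fun y => ENNReal.ofReal (bdryDist Ω y ^ α)) x * ‖f x‖ₑ := fun f => by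
    rw [wL1Norm_eq hGm.aemeasurable]
    exact setLIntegral_congr_fun h.measurableSet fun x hx => by
      simp only [h.ofReal_greenOp_bdryDist_rpow hα hx]
  refine h.solMapsBoundedly_of_le hA (fun f g hfg => ?_) (fun f hf hfin => ?_) (M := 1)
    fun f u hfin a hu => ?_
  · exact eLpNorm_congr_ae (wMeasure_absolutelyContinuous.ae_eq hfg)
  · obtain ⟨M, hM⟩ := h.exists_rpow_le_eGreen_rpow α
    rw [hX] at hfin
    rw [wL1Norm_eq (by fun_prop)]
    calc _ ≤ ∫⁻ x in Ω, M *
          (eGreen Ω G (fun y => ENNReal.ofReal (bdryDist Ω y ^ α)) x * ‖f x‖ₑ) := by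
          refine setLIntegral_mono' h.measurableSet fun x hx => ?_
          rw [← mul_assoc]
          gcongr
          exact hM x hx
      _ < ∞ := by
          rw [lintegral_const_mul' _ _ ENNReal.coe_ne_top]
          exact ENNReal.mul_lt_top ENNReal.coe_lt_top hfin
  · have hf := measurable_enorm_Lp f
    have hGf := h.measurable_eGreen hf
    rw [hX, mul_one, wL1Norm_eq (by fun_prop)]
    calc _ ≤ ∫⁻ x in Ω, a * (ENNReal.ofReal (bdryDist Ω x ^ α) *
          eGreen Ω G (fun y => ‖f y‖ₑ) x) := by
          refine lintegral_mono_ae ?_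
          filter_upwards [hu] with x hx
          rw [mul_left_comm]
          gcongr
      _ = _ := by
          rw [lintegral_const_mul _ (by fun_prop), h.lintegral_mul_eGreen hf (by fun_prop)]
          simp_rw [mul_comm]

/-- Monotonicity of 𝔾₀ applied to |f| ≤ c δ^α. The inclusion in L¹(Ω; δ^γ) is the integrability of
δ^{γ+α}. -/
lemma solMapsBoundedly_wSup (h : IsGreenKernel Ω s γ C D G) {A : ℝ → ℝ → ℝ≥0}
    (hA : ∀ z ∉ Set.range lam, ∀ T : L1Space Ω γ →L[ℝ] L1Space Ω γ, IsSolutionOperator lam φ z T →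
      ∀ f : L1Space Ω γ, ∀ᵐ x ∂volume.restrict Ω, ‖T f x‖ₑ ≤
        A (nextEigenvalue lam z) (spectralDist lam z) * eGreen Ω G (fun y => ‖f y‖ₑ) x)
    {α : ℝ} (hα : ∫⁻ x in Ω, ENNReal.ofReal (bdryDist Ω x ^ (γ + α)) < ∞) :
    SolMapsBoundedly γ lam φ (wSupNorm Ω fun x => bdryDist Ω x ^ α)
      (wSupNorm Ω (greenOp Ω G fun x => bdryDist Ω x ^ α)) := by
  refine h.solMapsBoundedly_of_le hA (fun f g hfg => ?_) (fun f hf hfin => ?_) (M := 1)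
    fun f u hfin a hu => ?_
  · refine eLpNorm_congr_ae ?_
    filter_upwards [hfg] with x hx
    rw [hx]
  · rw [wL1Norm_eq (by fun_prop)]
    set c := wSupNorm Ω (fun x => bdryDist Ω x ^ α) f
    calc _ ≤ ∫⁻ x in Ω, c * ENNReal.ofReal (bdryDist Ω x ^ (γ + α)) := by
          refine lintegral_mono_ae ?_
          filter_upwards [ae_restrict_mem h.measurableSet,
            ae_enorm_le_wSupNorm_mul (f := f) (h.ae_rpow_pos α)] with x hx h1
          have hx0 := h.delta_pos x hx
          rw [Real.rpow_add hx0, ENNReal.ofReal_mul (by positivity), mul_left_comm]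
          gcongr
      _ < ∞ := by
          rw [lintegral_const_mul' _ _ hfin.ne]
          exact ENNReal.mul_lt_top hfin hα
  · refine wSupNorm_le (h.ae_greenOp_bdryDist_rpow_pos hα) ?_
    filter_upwards [hu, ae_restrict_mem h.measurableSet] with x hx hxΩ
    refine hx.trans ?_
    rw [h.ofReal_greenOp_bdryDist_rpow hα hxΩ, mul_one, mul_assoc]
    gcongr
    rw [← eGreen_const_mul hfin.ne]
    exact eGreen_mono (ae_enorm_le_wSupNorm_mul (h.ae_rpow_pos α)) x

end IsGreenKernel

/-! ### Local mapping properties, and the ℍ² bound. -/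

namespace IsGreenKernel

variable {n : ℕ} {Ω : Set (Eu n)} {s γ C D : ℝ} {G : Eu n → Eu n → ℝ}
  {lam : ℕ → ℝ} {φ : HilbertBasis ℕ ℝ (L2Space Ω)}

lemma wL1Norm_eq_enorm (f : L1Space Ω γ) : wL1Norm Ω (fun x => bdryDist Ω x ^ γ) f = ‖f‖ₑ :=
  (Lp.enorm_def f).symm

lemma exists_le_bdryDist (h : IsGreenKernel Ω s γ C D G) {K : Set (Eu n)} (hK : IsCompact K)
    (hKΩ : K ⊆ Ω) : ∃ c : ℝ, 0 < c ∧ ∀ x ∈ K, c ≤ bdryDist Ω x :=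
  hK.exists_forall_le' (continuous_bdryDist Ω).continuousOn fun x hx => h.delta_pos x (hKΩ hx)

/-- Interior estimate: the part of `f` outside `U ⊇ K` has a bounded effect on `K`. -/
lemma exists_eGreen_le_of_compact (h : IsGreenKernel Ω s γ C D G) {K U : Set (Eu n)}
    (hK : IsCompact K) (hU : IsOpen U) (hKU : K ⊆ U) (hUΩ : U ⊆ Ω) :
    ∃ M : ℝ≥0, ∀ f : L1Space Ω γ, ∀ x ∈ K, eGreen Ω G (fun y => ‖f y‖ₑ) x ≤
      M * (eRiesz Ω (2 * s) (U.indicator fun y => ENNReal.ofReal (bdryDist Ω y ^ γ) * ‖f y‖ₑ) x +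
        ‖f‖ₑ) := by
  obtain ⟨c, hc, hcK⟩ := h.exists_le_bdryDist hK (hKU.trans hUΩ)
  obtain ⟨r, hr, hrU⟩ := hK.exists_thickening_subset_open hU hKU
  set k : ℝ≥0 := (c ^ γ).toNNReal with hk
  have hk0 : k ≠ 0 := by
    rw [hk, Ne, Real.toNNReal_eq_zero, not_le]
    positivity
  set t : ℝ≥0 := (r ^ (2 * s - n)).toNNReal with ht
  refine ⟨k⁻¹ * ((2 * C).toNNReal * (1 + t)), fun f x hx => ?_⟩
  set H : Eu n → ℝ≥0∞ := fun y => ENNReal.ofReal (bdryDist Ω y ^ γ) * ‖f y‖ₑ with hH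
  have hf := measurable_enorm_Lp f
  have hHm : Measurable H := by fun_prop
  have hxΩ : x ∈ Ω := hUΩ (hKU hx)
  -- A point outside U has distance at least r from K, so there the kernel is at most t = r^{2s-n}.
  have h1 : eRiesz Ω (2 * s) H x ≤ eRiesz Ω (2 * s) (U.indicator H) x + t * ‖f‖ₑ := by
    have hi := hHm.indicator hU.measurableSet
    rw [enorm_L1, ← lintegral_const_mul _ hHm, eRiesz, eRiesz, ← lintegral_add_left (by fun_prop)]
    refine lintegral_mono fun y => ?_
    by_cases hy : y ∈ U
    · rw [Set.indicator_of_mem hy]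
      exact le_self_add
    · rw [Set.indicator_of_notMem hy, mul_zero, zero_add]
      refine mul_le_mul' (ENNReal.ofReal_le_ofReal ?_) le_rfl
      refine Real.rpow_le_rpow_of_nonpos hr ?_ (by linarith [h.two_s_lt])
      by_contra hlt
      refine hy (hrU (Metric.mem_thickening_iff.2 ⟨x, hx, ?_⟩))
      rw [dist_comm]
      exact not_le.1 hlt
  have h2 : eGreen Ω G (fun y => ‖f y‖ₑ) x * k ≤
      ENNReal.ofReal (2 * C) * eRiesz Ω (2 * s) H x := by
    refine le_trans ?_ (h.rpow_mul_eGreen_le _ hxΩ)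
    rw [mul_comm]
    refine mul_le_mul' (ENNReal.ofReal_le_ofReal ?_) le_rfl
    exact Real.rpow_le_rpow hc.le (hcK x hx) h.γ_pos.le
  have h3 : eRiesz Ω (2 * s) H x ≤
      (1 + t) * (eRiesz Ω (2 * s) (U.indicator H) x + ‖f‖ₑ) := by
    refine h1.trans ?_
    rw [add_mul, one_mul, mul_add]
    exact add_le_add le_self_add le_add_self
  rw [ENNReal.coe_mul, ENNReal.coe_inv hk0, mul_assoc, mul_comm, ← div_eq_mul_inv]
  rw [ENNReal.le_div_iff_mul_le (by simp [hk0]) (by simp), ENNReal.coe_mul, mul_assoc]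
  refine h2.trans (mul_le_mul' le_rfl ?_)
  rw [ENNReal.coe_add, ENNReal.coe_one]
  exact h3

lemma exists_eLpNorm_le_of_compact (h : IsGreenKernel Ω s γ C D G) {p q : ℝ≥0∞} (hq : 1 ≤ q)
    (hpq : RieszMapsBoundedly Ω s p q) {K U : Set (Eu n)}
    (hK : IsCompact K) (hU : IsOpen U) (hKU : K ⊆ U) (hUΩ : U ⊆ Ω) :
    ∃ M : ℝ≥0, ∀ f u : L1Space Ω γ,
      eLpNorm (fun y => ENNReal.ofReal (bdryDist Ω y ^ γ) * ‖f y‖ₑ) p (volume.restrict U) < ∞ →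
      ∀ a : ℝ≥0,
      (∀ᵐ x ∂volume.restrict Ω, ‖u x‖ₑ ≤ a * eGreen Ω G (fun y => ‖f y‖ₑ) x) →
      eLpNorm u q (volume.restrict K) ≤ (a * M : ℝ≥0) *
        (eLpNorm (fun y => ENNReal.ofReal (bdryDist Ω y ^ γ) * ‖f y‖ₑ) p (volume.restrict U) +
          ‖f‖ₑ) := by
  obtain ⟨M₁, hM₁⟩ := h.exists_eGreen_le_of_compact hK hU hKU hUΩ
  obtain ⟨M₂, hM₂⟩ := hpq
  have hKΩ : volume.restrict K ≤ volume.restrict Ω :=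
    Measure.restrict_mono_set _ (hKU.trans hUΩ)
  -- The norm of the constant 1 in L^q(K). For q = ∞ the exponent is 0 and the value is 1.
  have hv : volume K ^ q.toReal⁻¹ ≠ ∞ :=
    (ENNReal.rpow_lt_top_of_nonneg (by positivity) hK.measure_lt_top.ne).ne
  obtain ⟨v, hv⟩ : ∃ v : ℝ≥0, (v : ℝ≥0∞) = volume K ^ q.toReal⁻¹ := ⟨_, ENNReal.coe_toNNReal hv⟩
  refine ⟨M₁ * (M₂ + v), fun f u hfin a hu => ?_⟩
  set H : Eu n → ℝ≥0∞ := fun y => ENNReal.ofReal (bdryDist Ω y ^ γ) * ‖f y‖ₑ with hH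
  have hf := measurable_enorm_Lp f
  have hHm : Measurable H := by fun_prop
  have hi := hHm.indicator hU.measurableSet
  have hHU : eLpNorm (U.indicator H) p (volume.restrict Ω) = eLpNorm H p (volume.restrict U) := by
    rw [eLpNorm_indicator_eq_eLpNorm_restrict hU.measurableSet,
      Measure.restrict_restrict hU.measurableSet, Set.inter_eq_left.2 hUΩ]
  have h1 := hM₂ _ hi (by rwa [hHU])
  rw [hHU] at h1
  set N := eLpNorm H p (volume.restrict U)
  have hR := measurable_eRiesz (Ω := Ω) (b := 2 * s) hi
  calc eLpNorm u q (volume.restrict K) ≤ (a * M₁ : ℝ≥0) *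
        eLpNorm (eRiesz Ω (2 * s) (U.indicator H) + fun _ => ‖f‖ₑ) q (volume.restrict K) := by
        refine eLpNorm_le_mul_eLpNorm_of_ae_le_mul' ?_ q
        filter_upwards [ae_mono hKΩ hu, ae_restrict_mem hK.measurableSet] with x hx hxK
        rw [enorm_eq_self, ENNReal.coe_mul, mul_assoc]
        exact hx.trans (mul_le_mul' le_rfl (hM₁ f x hxK))
    _ ≤ (a * M₁ : ℝ≥0) * (M₂ * N + ‖f‖ₑ * v) := by
        gcongr
        refine (eLpNorm_add_le hR.aestronglyMeasurable aestronglyMeasurable_const hq).trans ?_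
        refine add_le_add ((eLpNorm_mono_measure _ hKΩ).trans h1) ?_
        refine (eLpNorm_le_of_ae_enorm_bound (C := ‖f‖ₑ) (by simp)).trans ?_
        rw [Measure.restrict_apply_univ, smul_eq_mul, hv]
    _ ≤ (a * M₁ : ℝ≥0) * ((M₂ + v) * (N + ‖f‖ₑ)) := by
        gcongr
        calc _ ≤ (M₂ * N + ‖f‖ₑ * v) + (M₂ * ‖f‖ₑ + v * N) := le_self_add
          _ = _ := by ring
    _ = _ := by
        push_cast
        ring

/-- The interior estimate with U = Ω and p = 1, where the local term is itself the norm of f in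
L¹(Ω; δ^γ). -/
lemma solMapsLocally_one (h : IsGreenKernel Ω s γ C D G) {A : ℝ → ℝ → ℝ≥0}
    (hA : ∀ z ∉ Set.range lam, ∀ T : L1Space Ω γ →L[ℝ] L1Space Ω γ, IsSolutionOperator lam φ z T →
      ∀ f : L1Space Ω γ, ∀ᵐ x ∂volume.restrict Ω, ‖T f x‖ₑ ≤
        A (nextEigenvalue lam z) (spectralDist lam z) * eGreen Ω G (fun y => ‖f y‖ₑ) x)
    {q : ℝ≥0∞} (hq : 1 ≤ q) (hpq : RieszMapsBoundedly Ω s 1 q) {K : Set (Eu n)}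
    (hK : CompactlyIn K Ω) :
    ∃ C : ℝ → ℝ → ℝ≥0, ∀ z : ℝ, z ∉ Set.range lam →
      ∀ T : L1Space Ω γ →L[ℝ] L1Space Ω γ, IsSolutionOperator lam φ z T →
        ∀ f : L1Space Ω γ, IsLpLoc Ω q (T f) ∧
          LpNormOn q K (T f) ≤ C (nextEigenvalue lam z) (spectralDist lam z) *
            wL1Norm Ω (fun x => bdryDist Ω x ^ γ) f := by
  have key : ∀ K : Set (Eu n), IsCompact K → K ⊆ Ω → ∃ M : ℝ≥0, ∀ f u : L1Space Ω γ, ∀ a : ℝ≥0,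
      (∀ᵐ x ∂volume.restrict Ω, ‖u x‖ₑ ≤ a * eGreen Ω G (fun y => ‖f y‖ₑ) x) →
      eLpNorm u q (volume.restrict K) ≤ (a * M : ℝ≥0) * ‖f‖ₑ := fun K hK hKΩ => by
    obtain ⟨M, hM⟩ := h.exists_eLpNorm_le_of_compact hq hpq hK h.isOpen hKΩ subset_rfl
    refine ⟨M * 2, fun f u a hu => ?_⟩
    have e : eLpNorm (fun y => ENNReal.ofReal (bdryDist Ω y ^ γ) * ‖f y‖ₑ) 1 (volume.restrict Ω) =
        ‖f‖ₑ := by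
      rw [eLpNorm_one_eq_lintegral_enorm, enorm_L1]
      rfl
    refine (hM f u (by rw [e]; exact enorm_lt_top) a hu).trans (le_of_eq ?_)
    rw [e]
    push_cast
    ring
  obtain ⟨M, hM⟩ := key _ hK.1 (hK.2.trans interior_subset)
  refine ⟨fun a d => A a d * M, fun z hz T hT f => ⟨fun K' hK' hK'Ω => ?_, ?_⟩⟩
  · obtain ⟨M', hM'⟩ := key K' hK' hK'Ω
    exact ⟨(h.aestronglyMeasurable_L1 _).mono_measure (Measure.restrict_mono_set _ hK'Ω),
      (hM' f _ _ (hA z hz T hT f)).trans_lt (by finiteness)⟩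
  · rw [wL1Norm_eq_enorm]
    exact (eLpNorm_mono_measure _ (Measure.restrict_mono_set _ subset_closure)).trans
      (hM f _ _ (hA z hz T hT f))

lemma solMapsLocally_of_riesz (h : IsGreenKernel Ω s γ C D G) {A : ℝ → ℝ → ℝ≥0}
    (hA : ∀ z ∉ Set.range lam, ∀ T : L1Space Ω γ →L[ℝ] L1Space Ω γ, IsSolutionOperator lam φ z T →
      ∀ f : L1Space Ω γ, ∀ᵐ x ∂volume.restrict Ω, ‖T f x‖ₑ ≤
        A (nextEigenvalue lam z) (spectralDist lam z) * eGreen Ω G (fun y => ‖f y‖ₑ) x)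
    {p q : ℝ≥0∞} (hq : 1 ≤ q) (hpq : RieszMapsBoundedly Ω s p q) :
    SolMapsLocally (Ω := Ω) γ lam φ p q := by
  have key : ∀ K K₀ : Set (Eu n), IsCompact K → IsCompact (closure K₀) → K ⊆ interior K₀ →
      closure K₀ ⊆ Ω → ∃ M : ℝ≥0, ∀ f u : L1Space Ω γ, IsLpLoc Ω p f → ∀ a : ℝ≥0,
      (∀ᵐ x ∂volume.restrict Ω, ‖u x‖ₑ ≤ a * eGreen Ω G (fun y => ‖f y‖ₑ) x) →
      eLpNorm f p (volume.restrict K₀) < ∞ ∧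
      eLpNorm u q (volume.restrict K) ≤
        (a * M : ℝ≥0) * (eLpNorm f p (volume.restrict K₀) + ‖f‖ₑ) := fun K K₀ hK hK₀ hKK₀ hK₀Ω => by
    have hUΩ : interior K₀ ⊆ Ω := (interior_subset.trans subset_closure).trans hK₀Ω
    obtain ⟨M, hM⟩ := h.exists_eLpNorm_le_of_compact hq hpq hK isOpen_interior hKK₀ hUΩ
    set B : ℝ≥0 := (D ^ γ).toNNReal with hB
    refine ⟨M * (B + 1), fun f u hf a hu => ?_⟩
    have hfin : eLpNorm f p (volume.restrict K₀) < ∞ :=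
      (eLpNorm_mono_measure _ (Measure.restrict_mono_set _ subset_closure)).trans_lt
        (hf _ hK₀ hK₀Ω).2
    have hH : eLpNorm (fun y => ENNReal.ofReal (bdryDist Ω y ^ γ) * ‖f y‖ₑ) p
        (volume.restrict (interior K₀)) ≤ B * eLpNorm f p (volume.restrict K₀) := by
      refine (eLpNorm_le_mul_eLpNorm_of_ae_le_mul' (g := f) (c := B) ?_ p).trans
        (mul_le_mul' le_rfl (eLpNorm_mono_measure _ (Measure.restrict_mono_set _ interior_subset)))
      filter_upwards [ae_restrict_mem isOpen_interior.measurableSet] with y hy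
      rw [enorm_eq_self]
      refine mul_le_mul' (ENNReal.ofReal_le_ofReal ?_) le_rfl
      exact Real.rpow_le_rpow (h.delta_pos y (hUΩ hy)).le (h.delta_le y (hUΩ hy)) h.γ_pos.le
    have hlt := hH.trans_lt (ENNReal.mul_lt_top ENNReal.coe_lt_top hfin)
    have hfu := hM f u hlt a hu
    refine ⟨hfin, hfu.trans ?_⟩
    calc _ ≤ (a * M : ℝ≥0) * (B * eLpNorm f p (volume.restrict K₀) + ‖f‖ₑ) := by gcongr
      _ ≤ (a * M : ℝ≥0) * ((B + 1) * (eLpNorm f p (volume.restrict K₀) + ‖f‖ₑ)) := by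
          gcongr
          rw [add_mul, one_mul, mul_add]
          exact add_le_add le_self_add le_add_self
      _ = _ := by
          push_cast
          ring
  intro K K₀ hK hK₀
  obtain ⟨M, hM⟩ := key _ K₀ hK.1 hK₀.1 hK.2 (hK₀.2.trans interior_subset)
  refine ⟨fun a d => A a d * M, fun z hz T hT f hf => ⟨fun K' hK' hK'Ω => ?_, ?_⟩⟩
  · obtain ⟨L, hL, hKL, hLΩ⟩ := exists_compact_between hK' h.isOpen hK'Ω
    obtain ⟨M', hM'⟩ := key K' L hK' (by rwa [hL.isClosed.closure_eq]) hKL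
      (by rwa [hL.isClosed.closure_eq])
    obtain ⟨h1, h2⟩ := hM' f _ hf _ (hA z hz T hT f)
    exact ⟨(h.aestronglyMeasurable_L1 _).mono_measure (Measure.restrict_mono_set _ hK'Ω),
      h2.trans_lt (ENNReal.mul_lt_top ENNReal.coe_lt_top (ENNReal.add_lt_top.2 ⟨h1, enorm_lt_top⟩))⟩
  · rw [wL1Norm_eq_enorm]
    exact (eLpNorm_mono_measure _ (Measure.restrict_mono_set _ subset_closure)).trans
      (hM f _ hf _ (hA z hz T hT f)).2

/-- The solution operator maps `L²(Ω)` to `ℍ²_ℒ(Ω)`. -/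
lemma solMapsBoundedly_H2 (h : IsGreenKernel Ω s γ C D G) (hpos : ∀ j, 0 < lam j)
    (hmono : Monotone lam) (hdiv : Tendsto lam atTop atTop) :
    SolMapsBoundedly γ lam φ (LpNormOn 2 Ω) (H2Norm lam φ) := by
  refine ⟨fun a d => (1 + (a + d) / d).toNNReal, fun z hz T hT f hf hfin => ?_⟩
  have hmem : MemLp f 1 (wMeasure Ω fun x => bdryDist Ω x ^ γ) :=
    ⟨hf.mono_ac wMeasure_absolutelyContinuous,
      h.wL1Norm_lt_top_of_eLpNorm one_le_two hf hfin⟩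
  refine ⟨hmem, ?_⟩
  have hf2 : MemLp f 2 (volume.restrict Ω) := ⟨hf, hfin⟩
  obtain ⟨R, hR, -, hRφ, -⟩ := exists_resolvent φ hdiv hz
  have hae : T (hmem.toLp f) =ᵐ[volume.restrict Ω] R (hf2.toLp f) := by
    rw [← hR]
    exact hT _ _ (((h.ac_wMeasure γ).ae_eq hmem.coeFn_toLp).trans hf2.coeFn_toLp.symm)
  have hd := spectralDist_pos hdiv hz
  set d := spectralDist lam z with hd'
  set a := nextEigenvalue lam z with ha
  have hza : |z| ≤ a + d := abs_le_nextEigenvalue_add hdiv hmono hpos hz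
  have had : 0 ≤ a + d := (abs_nonneg z).trans hza
  -- This bounds λ_j / |λ_j - z| ≤ 1 + |z| / |λ_j - z|.
  set B := 1 + (a + d) / d with hB
  have hB0 : 0 ≤ B := by positivity
  have hint : ∀ j, ∫ x in Ω, T (hmem.toLp f) x * φ j x =
      (lam j - z)⁻¹ * inner ℝ (φ j) (hf2.toLp f) := fun j => by
    rw [← hRφ, L2.inner_def]
    refine integral_congr_ae ?_
    filter_upwards [hae] with x hx
    rw [hx]
    simp
  have hcoef : ∀ j, lam j ^ 2 * ((lam j - z)⁻¹ * inner ℝ (φ j) (hf2.toLp f)) ^ 2 ≤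
      B ^ 2 * inner ℝ (φ j) (hf2.toLp f) ^ 2 := fun j => by
    rw [mul_pow, ← mul_assoc, ← mul_pow]
    refine mul_le_mul_of_nonneg_right ?_ (sq_nonneg _)
    rw [sq_le_sq, abs_of_nonneg hB0, abs_mul, abs_inv, ← div_eq_mul_inv]
    have h1 : d ≤ |lam j - z| := spectralDist_le j
    rw [div_le_iff₀ (hd.trans_le h1)]
    have h2 : |lam j| ≤ |lam j - z| + |z| := by
      have := abs_add_le (lam j - z) z
      rwa [sub_add_cancel] at this
    have h3 : a + d ≤ (a + d) / d * |lam j - z| := by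
      rw [div_mul_eq_mul_div, le_div_iff₀ hd]
      gcongr
    rw [hB, add_mul, one_mul]
    linarith
  rw [H2Norm, if_pos ((memLp_congr_ae hae).2 (Lp.memLp _))]
  have hnorm : LpNormOn 2 Ω f = ENNReal.ofReal ‖hf2.toLp f‖ := by
    rw [ofReal_norm, Lp.enorm_toLp]
    rfl
  calc _ ≤ (∑' j, ENNReal.ofReal (B ^ 2 * inner ℝ (φ j) (hf2.toLp f) ^ 2)) ^ (1 / 2 : ℝ) := by
        refine ENNReal.rpow_le_rpow (ENNReal.tsum_le_tsum fun j =>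
          ENNReal.ofReal_le_ofReal ?_) (by norm_num)
        rw [hint]
        exact hcoef j
    _ = ENNReal.ofReal ((B * ‖hf2.toLp f‖) ^ 2) ^ (1 / 2 : ℝ) := by
        have hs := (φ.hasSum_sq_inner (hf2.toLp f)).mul_left (B ^ 2)
        rw [← ENNReal.ofReal_tsum_of_nonneg (fun j => by positivity) hs.summable, hs.tsum_eq,
          mul_pow]
    _ = _ := by
        rw [ENNReal.ofReal_rpow_of_nonneg (by positivity) (by norm_num), ← Real.sqrt_eq_rpow,
          Real.sqrt_sq (by positivity), ENNReal.ofReal_mul hB0, hnorm]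
        rfl

end IsGreenKernel

/-! ### Exclusion of the case n < 2s. -/

section Subcritical

variable {n : ℕ} {Ω : Set (Eu n)} {s γ : ℝ} {G : Eu n → Eu n → ℝ}

lemma continuousAt_modelKernel {x₀ y₀ : Eu n} (hxy : x₀ ≠ y₀) (hγ : 0 ≤ γ) :
    ContinuousAt (fun q : Eu n × Eu n => modelKernel Ω s γ q.1 q.2) (x₀, y₀) := by
  have hd : Continuous fun q : Eu n × Eu n => dist q.1 q.2 := by fun_prop
  have hd0 : dist x₀ y₀ ≠ 0 := dist_ne_zero.2 hxy
  have hpow : ∀ p : ℝ, ContinuousAt (fun q : Eu n × Eu n => dist q.1 q.2 ^ p) (x₀, y₀) :=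
    fun p => hd.continuousAt.rpow_const (Or.inl hd0)
  have hpow0 : ∀ p : ℝ, dist x₀ y₀ ^ p ≠ 0 := fun p =>
    (Real.rpow_pos_of_pos (dist_pos.2 hxy) p).ne'
  have h1 : ContinuousAt (fun q : Eu n × Eu n => bdryDist Ω q.1 ^ γ) (x₀, y₀) :=
    ((continuous_bdryDist Ω).comp continuous_fst).continuousAt.rpow_const (Or.inr hγ)
  have h2 : ContinuousAt (fun q : Eu n × Eu n => bdryDist Ω q.2 ^ γ) (x₀, y₀) :=
    ((continuous_bdryDist Ω).comp continuous_snd).continuousAt.rpow_const (Or.inr hγ)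
  exact ((continuousAt_const.div (hpow _) (hpow0 _)).mul
    ((h1.div (hpow _) (hpow0 _)).min continuousAt_const)).mul
      ((h2.div (hpow _) (hpow0 _)).min continuousAt_const)

/-- If the kernel is small near the diagonal and not away from it, the Green operator takes
negative values in the sense of quadratic forms. -/
lemma exists_inner_greenOp_neg (hΩ : IsOpen Ω) (hΩb : Bornology.IsBounded Ω)
    (hG : Measurable (Function.uncurry G)) {K : ℝ}
    (hK : ∀ x ∈ Ω, ∀ y ∈ Ω, x ≠ y → |G x y| ≤ K) (hn : 1 ≤ n) {x₀ y₀ : Eu n} {ε c m : ℝ}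
    (hε : 0 < ε) (hx₀ : Metric.ball x₀ ε ⊆ Ω) (hy₀ : Metric.ball y₀ ε ⊆ Ω)
    (hdisj : Disjoint (Metric.ball x₀ ε) (Metric.ball y₀ ε)) (hcm : c < m)
    (hc : ∀ x ∈ Ω, ∀ y ∈ Ω, x ≠ y → dist x y < 2 * ε → G x y ≤ c)
    (hm : ∀ x ∈ Metric.ball x₀ ε, ∀ y ∈ Metric.ball y₀ ε, m ≤ G x y ∧ m ≤ G y x) :
    ∃ f : L2Space Ω, ∃ hu : MemLp (greenOp Ω G f) 2 (volume.restrict Ω),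
      inner ℝ (hu.toLp (greenOp Ω G f)) f < 0 := by
  have hΩm : MeasurableSet Ω := hΩ.measurableSet
  have : IsFiniteMeasure (volume.restrict Ω) := ⟨by
    rw [Measure.restrict_apply_univ]
    exact hΩb.measure_lt_top⟩
  set A := Metric.ball x₀ ε with hA
  set B := Metric.ball y₀ ε with hB
  have hAm : MeasurableSet A := measurableSet_ball
  have hBm : MeasurableSet B := measurableSet_ball
  set V := volume.real (Metric.ball (0 : Eu n) ε) with hV
  have hVA : ∀ a : Eu n, volume.real (Metric.ball a ε) = V := fun a => by
    rw [hV, measureReal_def, Measure.addHaar_ball_center, measureReal_def]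
  have hV0 : 0 < V := by
    rw [hV, measureReal_def]
    exact ENNReal.toReal_pos (Metric.measure_ball_pos _ _ hε).ne' measure_ball_lt_top.ne
  -- In the quadratic form of 1_A - 1_B, the two self-interactions carry kernel values at most c and
  -- the two cross terms, with the opposite sign, values at least m > c.
  set f : Eu n → ℝ := fun x => A.indicator 1 x - B.indicator 1 x with hf
  have hfm : Measurable f := (measurable_one.indicator hAm).sub (measurable_one.indicator hBm)
  have hf1 : ∀ x, ‖f x‖ ≤ 1 := fun x => by
    by_cases hxA : x ∈ A
    · simp [hf, hxA, Set.disjoint_left.1 hdisj hxA]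
    · by_cases hxB : x ∈ B <;> simp [hf, hxA, hxB]
  have hf2 : MemLp f 2 (volume.restrict Ω) :=
    MemLp.of_bound hfm.aestronglyMeasurable 1 (Eventually.of_forall hf1)
  have hint : ∀ x ∈ Ω, Integrable (G x) (volume.restrict Ω) := fun x hx =>
    Integrable.of_bound hG.of_uncurry_left.aestronglyMeasurable K (by
      filter_upwards [ae_mem_ne hn hΩm x] with y hy
      exact hK x hx y hy.1 hy.2.symm)
  have hu : ∀ x ∈ Ω, greenOp Ω G f x = (∫ y in A, G x y) - ∫ y in B, G x y := fun x hx => by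
    have e : ∀ S : Set (Eu n), MeasurableSet S → S ⊆ Ω →
        ∫ y in Ω, S.indicator (G x) y = ∫ y in S, G x y := fun S hS hSΩ => by
      rw [setIntegral_indicator hS, Set.inter_eq_right.2 hSΩ]
    rw [← e A hAm hx₀, ← e B hBm hy₀, ← integral_sub ((hint x hx).indicator hAm)
      ((hint x hx).indicator hBm), greenOp]
    refine integral_congr_ae (Eventually.of_forall fun y => ?_)
    by_cases hyA : y ∈ A <;> by_cases hyB : y ∈ B <;> simp [hf, hyA, hyB]
  have hnear : ∀ a : Eu n, Metric.ball a ε ⊆ Ω → ∀ x ∈ Metric.ball a ε,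
      ∫ y in Metric.ball a ε, G x y ≤ V * c := fun a ha x hx => by
    rw [← hVA a, ← smul_eq_mul, ← setIntegral_const]
    refine integral_mono_ae ((hint x (ha hx)).mono_measure (Measure.restrict_mono_set _ ha))
      (integrableOn_const measure_ball_lt_top.ne) ?_
    filter_upwards [ae_mem_ne hn measurableSet_ball x] with y hy
    refine hc x (ha hx) y (ha hy.1) hy.2.symm ?_
    have := dist_triangle_right x y a
    have h1 := Metric.mem_ball.1 hx
    have h2 := Metric.mem_ball.1 hy.1
    linarith
  have hfar : ∀ a : Eu n, Metric.ball a ε ⊆ Ω → ∀ x ∈ Ω, (∀ y ∈ Metric.ball a ε, m ≤ G x y) →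
      V * m ≤ ∫ y in Metric.ball a ε, G x y := fun a ha x hx hxm => by
    rw [← hVA a, ← smul_eq_mul, ← setIntegral_const]
    refine integral_mono_ae (integrableOn_const measure_ball_lt_top.ne)
      ((hint x hx).mono_measure (Measure.restrict_mono_set _ ha)) ?_
    filter_upwards [ae_restrict_mem measurableSet_ball] with y hy
    exact hxm y hy
  have hle : ∀ x ∈ Ω, f x * greenOp Ω G f x ≤
      A.indicator (fun _ => V * (c - m)) x + B.indicator (fun _ => V * (c - m)) x := fun x hx => by
    rw [hu x hx]
    by_cases hxA : x ∈ A
    · have hxB : x ∉ B := Set.disjoint_left.1 hdisj hxA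
      have h1 := hnear x₀ hx₀ x hxA
      have h2 := hfar y₀ hy₀ x hx fun y hy => (hm x hxA y hy).1
      simp only [hf, hxA, hxB, Set.indicator_of_mem, Set.indicator_of_notMem, not_false_eq_true,
        Pi.one_apply]
      linarith
    · by_cases hxB : x ∈ B
      · have h1 := hnear y₀ hy₀ x hxB
        have h2 := hfar x₀ hx₀ x hx fun y hy => (hm y hy x hxB).2
        simp only [hf, hxA, hxB, Set.indicator_of_mem, Set.indicator_of_notMem, not_false_eq_true,
          Pi.one_apply]
        linarith
      · simp [hf, hxA, hxB]
  have hum : StronglyMeasurable (greenOp Ω G f) :=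
    StronglyMeasurable.integral_prod_right (f := fun x y => G x y * f y)
      (hG.stronglyMeasurable.mul (hfm.comp measurable_snd).stronglyMeasurable)
  have hub : ∀ x ∈ Ω, ‖greenOp Ω G f x‖ ≤ K * (volume.restrict Ω).real Set.univ := fun x hx => by
    refine norm_integral_le_of_norm_le_const ?_
    filter_upwards [ae_mem_ne hn hΩm x] with y hy
    have h1 := hK x hx y hy.1 hy.2.symm
    rw [norm_mul]
    exact (mul_le_of_le_one_right (norm_nonneg _) (hf1 y)).trans h1
  have hu2 : MemLp (greenOp Ω G f) 2 (volume.restrict Ω) := by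
    refine MemLp.of_bound hum.aestronglyMeasurable (K * (volume.restrict Ω).real Set.univ) ?_
    filter_upwards [ae_restrict_mem hΩm] with x hx
    exact hub x hx
  have hgF : greenOp Ω G (hf2.toLp f) = greenOp Ω G f := funext (greenOp_congr hf2.coeFn_toLp)
  refine ⟨hf2.toLp f, by rwa [hgF], ?_⟩
  simp_rw [hgF]
  rw [L2.inner_def]
  have hconst : ∀ S : Set (Eu n), MeasurableSet S →
      Integrable (S.indicator fun _ => V * (c - m)) (volume.restrict Ω) := fun S hS =>
    (integrable_const _).indicator hS
  have hind : ∀ a : Eu n, Metric.ball a ε ⊆ Ω →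
      ∫ x in Ω, (Metric.ball a ε).indicator (fun _ => V * (c - m)) x = V * (V * (c - m)) :=
    fun a ha => by
      rw [setIntegral_indicator measurableSet_ball, Set.inter_eq_right.2 ha, setIntegral_const,
        hVA, smul_eq_mul]
  calc ∫ x in Ω, inner ℝ (hu2.toLp (greenOp Ω G f) x) (hf2.toLp f x) =
      ∫ x in Ω, f x * greenOp Ω G f x := by
        refine integral_congr_ae ?_
        filter_upwards [hu2.coeFn_toLp, hf2.coeFn_toLp] with x h1 h2
        rw [h1, h2]
        simp
    _ ≤ ∫ x in Ω, (A.indicator (fun _ => V * (c - m)) x +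
          B.indicator (fun _ => V * (c - m)) x) := by
        refine integral_mono_ae ?_ ((hconst A hAm).add (hconst B hBm)) ?_
        · exact hf2.integrable_mul hu2
        · filter_upwards [ae_restrict_mem hΩm] with x hx
          exact hle x hx
    _ = V * (V * (c - m)) + V * (V * (c - m)) := by
        rw [integral_add (hconst A hAm) (hconst B hBm), hind x₀ hx₀, hind y₀ hy₀]
    _ < 0 := by
        have : V * (V * (c - m)) < 0 :=
          mul_neg_of_pos_of_neg hV0 (mul_neg_of_pos_of_neg hV0 (by linarith))
        linarith

/-- A non-negative operator has no Green function with these bounds in the case `n < 2 s`, in which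
the kernel vanishes on the diagonal. -/
theorem two_s_le_of_isGreenFunction (hn : 1 ≤ n) (hΩ : IsOpen Ω) (hne : Ω.Nonempty)
    (hΩb : Bornology.IsBounded Ω) (hγ : 0 ≤ γ) {L : L2Space Ω →ₗ.[ℝ] L2Space Ω}
    (hLpos : IsNonnegOp L) (hLG : IsGreenFunction Ω L G) (hG : GreenKernelBounds Ω s γ G) :
    2 * s ≤ n := by
  by_contra hlt
  rw [not_le] at hlt
  obtain ⟨C, hC, hcmp⟩ := hG.comparable
  obtain ⟨D, hD, hdist, -⟩ := exists_diam_bound hn hne hΩb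
  have hp : 0 < 2 * s - n := by linarith
  have hup : ∀ x ∈ Ω, ∀ y ∈ Ω, x ≠ y → G x y ≤ C * dist x y ^ (2 * s - n) := fun x hx y hy hxy =>
    ((hcmp x hx y hy hxy).2).trans (mul_le_mul_of_nonneg_left (modelKernel_le_riesz x y) hC.le)
  obtain ⟨x₀, hx₀⟩ := hne
  have : Nonempty (Fin n) := ⟨⟨0, hn⟩⟩
  have := Module.punctured_nhds_neBot ℝ (Eu n) x₀
  obtain ⟨y₀, hy₀x, hy₀⟩ := (𝓝[≠] x₀).nonempty_of_mem
    (inter_mem self_mem_nhdsWithin (mem_nhdsWithin_of_mem_nhds (hΩ.mem_nhds hx₀)))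
  have hxy : x₀ ≠ y₀ := fun h => hy₀x h.symm
  have hk0 : 0 < modelKernel Ω s γ x₀ y₀ :=
    modelKernel_pos (bdryDist_pos hn hΩ hΩb hx₀) (bdryDist_pos hn hΩ hΩb hy₀) hxy
  -- Half the value leaves room for a lower bound by continuity on neighbourhoods of x₀ and y₀.
  set k := modelKernel Ω s γ x₀ y₀ / 2 with hk
  have hkm : ∀ᶠ q : Eu n × Eu n in 𝓝 (x₀, y₀), k < modelKernel Ω s γ q.1 q.2 :=
    (continuousAt_modelKernel hxy hγ).eventually (lt_mem_nhds (half_lt_self hk0))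
  obtain ⟨ε₁, hε₁, hk₁⟩ := Metric.eventually_nhds_iff.1 hkm
  obtain ⟨ε₂, hε₂, hx₂⟩ := Metric.isOpen_iff.1 hΩ x₀ hx₀
  obtain ⟨ε₃, hε₃, hy₃⟩ := Metric.isOpen_iff.1 hΩ y₀ hy₀
  have hρ : 0 < dist x₀ y₀ := dist_pos.2 hxy
  have hm0 : 0 < C⁻¹ * k := by positivity
  -- As 2s - n > 0, the kernel at distances below 2ε is eventually smaller than its lower bound
  -- between the two balls.
  have hsmall : ∀ᶠ ε : ℝ in 𝓝[>] 0, C * (2 * ε) ^ (2 * s - n) < C⁻¹ * k := by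
    refine (Tendsto.mono_left ?_ nhdsWithin_le_nhds).eventually (gt_mem_nhds hm0)
    have : ContinuousAt (fun ε : ℝ => C * (2 * ε) ^ (2 * s - n)) 0 :=
      continuousAt_const.mul ((continuousAt_const.mul continuousAt_id).rpow_const (Or.inr hp.le))
    have h0 := this.tendsto
    rwa [mul_zero, Real.zero_rpow hp.ne', mul_zero] at h0
  have hmin : 0 < min (min ε₁ ε₂) (min ε₃ (dist x₀ y₀ / 2)) := by positivity
  obtain ⟨ε, ⟨hε, hεm⟩, hεC⟩ := (Filter.Eventually.and (Ioo_mem_nhdsGT hmin) hsmall).exists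
  simp only [lt_min_iff] at hεm
  obtain ⟨⟨h1, h2⟩, h3, h4⟩ := hεm
  have hxΩ : Metric.ball x₀ ε ⊆ Ω := (Metric.ball_subset_ball h2.le).trans hx₂
  have hyΩ : Metric.ball y₀ ε ⊆ Ω := (Metric.ball_subset_ball h3.le).trans hy₃
  have hdisj : Disjoint (Metric.ball x₀ ε) (Metric.ball y₀ ε) :=
    Metric.ball_disjoint_ball (by linarith)
  obtain ⟨f, hu, hneg⟩ := exists_inner_greenOp_neg hΩ hΩb hG.meas (K := C * D ^ (2 * s - n))
    (fun x hx y hy hxy => by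
      rw [abs_of_pos (hG.pos x hx y hy hxy)]
      refine (hup x hx y hy hxy).trans ?_
      gcongr
      exact hdist x hx y hy) hn hε hxΩ hyΩ hdisj hεC
    (fun x hx y hy hxy hd => by
      refine (hup x hx y hy hxy).trans ?_
      gcongr)
    (fun x hx y hy => by
      have hne : x ≠ y := fun h => Set.disjoint_left.1 hdisj hx (h ▸ hy)
      have h5 : k < modelKernel Ω s γ x y := hk₁ (y := (x, y)) (by
        rw [Prod.dist_eq, max_lt_iff]
        exact ⟨(Metric.mem_ball.1 hx).trans h1, (Metric.mem_ball.1 hy).trans h1⟩)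
      have h6 : C⁻¹ * k ≤ G x y :=
        (mul_le_mul_of_nonneg_left h5.le (by positivity)).trans (hcmp x (hxΩ hx) y (hyΩ hy) hne).1
      exact ⟨h6, by rwa [← hG.symm x (hxΩ hx) y (hyΩ hy) hne]⟩)
  obtain ⟨w, hw1, hw2⟩ := L.mem_graph_iff.1 ((hLG _ f).2 hu.coeFn_toLp)
  have := hLpos w
  rw [hw1, hw2] at this
  exact absurd hneg (not_lt.2 this)

end Subcritical

/-! ### The Green operator as the inverse of ℒ, and its eigenbasis. -/

section Operator

variable {n : ℕ} {Ω : Set (Eu n)} {s γ : ℝ} {G : Eu n → Eu n → ℝ}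
  {L : L2Space Ω →ₗ.[ℝ] L2Space Ω} {T : L2Space Ω →L[ℝ] L2Space Ω}

lemma exists_isGreenKernel (hn : 1 ≤ n) (hne : Ω.Nonempty) (hΩb : Bornology.IsBounded Ω)
    (hΩ : IsOpen Ω) (hs : 0 < s) (h2s : 2 * s < n) (hγ0 : 0 < γ) (hγ1 : γ ≤ 1)
    (hG : GreenKernelBounds Ω s γ G) : ∃ C D : ℝ, IsGreenKernel Ω s γ C D G := by
  obtain ⟨C, hC, hcmp⟩ := hG.comparable
  obtain ⟨D, hD, hdist, hδ⟩ := exists_diam_bound hn hne hΩb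
  exact ⟨C, D,
    { one_le := hn
      isOpen := hΩ
      nonempty := hne
      s_pos := hs
      two_s_lt := h2s
      γ_pos := hγ0
      γ_le := hγ1
      C_pos := hC
      D_pos := hD
      dist_le := hdist
      delta_le := hδ
      delta_pos := fun x hx => bdryDist_pos hn hΩ hΩb hx
      meas := hG.meas
      symm := fun x hx y hy => by
        rcases eq_or_ne x y with rfl | hxy
        · rfl
        · exact hG.symm x hx y hy hxy
      lower := fun x hx y hy hxy => (hcmp x hx y hy hxy).1
      upper := fun x hx y hy hxy => (hcmp x hx y hy hxy).2 }⟩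

lemma isGreenFunction_iff_graph (hLG : IsGreenFunction Ω L G)
    (hT : ∀ f : L2Space Ω, T f =ᵐ[volume.restrict Ω] greenOp Ω G f) (u f : L2Space Ω) :
    (u, f) ∈ L.graph ↔ u = T f := by
  rw [hLG]
  exact ⟨fun hu => Lp.ext (hu.trans (hT f).symm), fun hu => hu ▸ hT f⟩

/-- The operator has an orthonormal basis of eigenfunctions. -/
theorem IsGreenKernel.exists_isEigenbasis {C D : ℝ} (h : IsGreenKernel Ω s γ C D G)
    (hLpos : IsNonnegOp L) (hT : ∀ f : L2Space Ω, T f =ᵐ[volume.restrict Ω] greenOp Ω G f)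
    (hgraph : ∀ u f : L2Space Ω, (u, f) ∈ L.graph ↔ u = T f) :
    ∃ (lam : ℕ → ℝ) (φ : HilbertBasis ℕ ℝ (L2Space Ω)), IsEigenbasis L lam φ := by
  -- If T f = 0 then (0, f) lies in the graph of the linear operator ℒ, so f = ℒ0 = 0.
  have hinj : ∀ f : L2Space Ω, T f = 0 → f = 0 := fun f hf =>
    L.graph_fst_eq_zero_snd ((hgraph _ _).2 hf.symm) rfl
  have hpos : ∀ f : L2Space Ω, 0 ≤ inner ℝ (T f) f := fun f => by
    obtain ⟨w, hw1, hw2⟩ := L.mem_graph_iff.1 ((hgraph (T f) f).2 rfl)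
    have := hLpos w
    rwa [hw1, hw2] at this
  have := h.isFiniteMeasure
  obtain ⟨j, M, hM⟩ := h.exists_norm_pow_apply_le hT
  obtain ⟨lam, φ, h1, h2, h3, h4⟩ := exists_eigenbasis (h.isSymmetric hT)
    (h.not_finiteDimensional hT hinj) hpos hinj
    fun k e he => sum_norm_sq_le_of_ae_bound hM he
  exact ⟨lam, φ, h1, h2, h3, fun k => (hgraph _ _).2 (h4 k)⟩

end Operator

end

theorem mainTheorem4 {n : ℕ} (hn : 1 ≤ n) (Ω : Set (Eu n)) (hΩne : Ω.Nonempty)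
    (hΩb : Bornology.IsBounded Ω) (hΩ : IsC11Domain Ω)
    (s γ : ℝ) (hs0 : 0 < s) (hs1 : s < 1) (hns : (n : ℝ) ≠ 2 * s) (hγ0 : 0 < γ) (hγ1 : γ ≤ 1)
    (L : L2Space Ω →ₗ.[ℝ] L2Space Ω) (hLpos : IsNonnegOp L)
    (G : Eu n → Eu n → ℝ) (hLG : IsGreenFunction Ω L G) (hG : GreenKernelBounds Ω s γ G) :
    -- the operator has an orthonormal eigenbasis, and whichever is chosen:
    (∃ (lam : ℕ → ℝ) (φ : HilbertBasis ℕ ℝ (L2Space Ω)), IsEigenbasis L lam φ) ∧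
    ∀ (lam : ℕ → ℝ) (φ : HilbertBasis ℕ ℝ (L2Space Ω)), IsEigenbasis L lam φ →
      -- the spectral series converges, and the solution operator extends uniquely
      (∀ z : ℝ, z ∉ Set.range lam →
        (∀ f : L2Space Ω,
          HasSum (fun j => (inner ℝ f (φ j) / (lam j - z)) • φ j) (spectralSol lam φ z f)) ∧
        (∃! T : L1Space Ω γ →L[ℝ] L1Space Ω γ, IsSolutionOperator lam φ z T) ∧
        ∀ T : L1Space Ω γ →L[ℝ] L1Space Ω γ, IsSolutionOperator lam φ z T →
          ∀ f u : L1Space Ω γ, IsWeakDualSolution lam φ z f u ↔ u = T f) ∧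
      -- global mapping properties
      (∀ α : ℝ, -1 - γ < α →
        SolMapsBoundedly γ lam φ
          (wL1Norm Ω (greenOp Ω G (fun x => bdryDist Ω x ^ α)))
          (wL1Norm Ω (fun x => bdryDist Ω x ^ α))) ∧
      (∀ p : ℝ, 1 ≤ p → p < n / (n - 2 * s) →
        SolMapsBoundedly γ lam φ (LpNormOn 1 Ω) (LpNormOn (ENNReal.ofReal p) Ω)) ∧
      SolMapsBoundedly γ lam φ (LpNormOn 2 Ω) (H2Norm lam φ) ∧
      (∀ p₀ p₁ : ℝ, 1 < p₀ → p₀ < n / (2 * s) → 1 / p₁ = 1 / p₀ - 2 * s / n →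
        SolMapsBoundedly γ lam φ
          (LpNormOn (ENNReal.ofReal p₀) Ω) (LpNormOn (ENNReal.ofReal p₁) Ω)) ∧
      (∀ q : ℝ, n / (2 * s) < q →
        SolMapsBoundedly γ lam φ (LpNormOn (ENNReal.ofReal q) Ω) (LpNormOn ∞ Ω)) ∧
      (∀ α : ℝ, -1 - γ < α →
        SolMapsBoundedly γ lam φ
          (wSupNorm Ω (fun x => bdryDist Ω x ^ α))
          (wSupNorm Ω (greenOp Ω G (fun x => bdryDist Ω x ^ α)))) ∧
      -- local mapping properties
      (∀ p : ℝ, 1 < p → p < n / (n - 2 * s) → ∀ K : Set (Eu n), CompactlyIn K Ω →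
        ∃ C : ℝ → ℝ → ℝ≥0, ∀ z : ℝ, z ∉ Set.range lam →
          ∀ T : L1Space Ω γ →L[ℝ] L1Space Ω γ, IsSolutionOperator lam φ z T →
            ∀ f : L1Space Ω γ,
              IsLpLoc Ω (ENNReal.ofReal p) (T f) ∧
              LpNormOn (ENNReal.ofReal p) K (T f) ≤
                C (nextEigenvalue lam z) (spectralDist lam z) *
                  wL1Norm Ω (fun x => bdryDist Ω x ^ γ) f) ∧
      (∀ p₀ p₁ : ℝ, 1 < p₀ → p₀ < n / (2 * s) → 1 / p₁ = 1 / p₀ - 2 * s / n →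
        SolMapsLocally (Ω := Ω) γ lam φ (ENNReal.ofReal p₀) (ENNReal.ofReal p₁)) ∧
      (∀ q : ℝ, n / (2 * s) < q →
        SolMapsLocally (Ω := Ω) γ lam φ (ENNReal.ofReal q) ∞) ∧
      SolMapsLocally (Ω := Ω) γ lam φ ∞ ∞ := by
  have hΩo : IsOpen Ω := hΩ.1
  -- Non-negativity of ℒ rules out n < 2s, and equality is excluded by hypothesis.
  have h2s : 2 * s < n := lt_of_le_of_ne
    (two_s_le_of_isGreenFunction hn hΩo hΩne hΩb hγ0.le hLpos hLG hG) hns.symm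
  obtain ⟨C, D, h⟩ := exists_isGreenKernel hn hΩne hΩb hΩo hs0 h2s hγ0 hγ1 hG
  obtain ⟨T, hT⟩ := h.exists_greenCLM
  have hgraph := isGreenFunction_iff_graph hLG hT
  refine ⟨h.exists_isEigenbasis hLpos hT hgraph, fun lam φ hφ => ?_⟩
  have heig : ∀ j, φ j = T (lam j • φ j) := fun j => (hgraph _ _).1 (hφ.eigen j)
  obtain ⟨A, hA⟩ := h.exists_enorm_spectralSol_le hT hφ.pos hφ.mono hφ.diverges heig
  have hAT : ∀ z ∉ Set.range lam, ∀ T : L1Space Ω γ →L[ℝ] L1Space Ω γ,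
      IsSolutionOperator lam φ z T → ∀ f : L1Space Ω γ, ∀ᵐ x ∂volume.restrict Ω, ‖T f x‖ₑ ≤
        A (nextEigenvalue lam z) (spectralDist lam z) * eGreen Ω G (fun y => ‖f y‖ₑ) x :=
    fun z hz T hT f => h.enorm_solution_le (hA z hz) hT f
  -- The regularity of the boundary, beyond openness of Ω, enters only here; the range of α is
  -- exactly γ + α > -1.
  have hδ : ∀ α : ℝ, -1 - γ < α → ∫⁻ x in Ω, ENNReal.ofReal (bdryDist Ω x ^ (γ + α)) < ∞ :=
    fun α hα => lintegral_bdryDist_rpow_lt_top hn hΩne hΩb hΩ (by linarith)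
  have hq1 : ∀ q : ℝ, n / (2 * s) < q → (1 : ℝ) ≤ q := fun q hq =>
    ((one_lt_div (by positivity)).2 h2s).le.trans hq.le
  refine ⟨fun z hz => ⟨fun f => ?_, h.existsUnique_isSolutionOperator hφ.diverges hz (hA z hz),
    fun T hT f u => h.isWeakDualSolution_iff hφ.diverges hz (hA z hz) hT f u⟩,
    fun α hα => h.solMapsBoundedly_wL1 hAT (hδ α hα),
    fun p hp hpn => h.solMapsBoundedly_of_riesz hAT le_rfl (h.rieszMapsBoundedly_one hp hpn),
    h.solMapsBoundedly_H2 hφ.pos hφ.mono hφ.diverges,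
    fun p₀ p₁ hp hpn hpq => h.solMapsBoundedly_of_riesz hAT (ENNReal.one_le_ofReal.2 hp.le)
      (h.rieszMapsBoundedly_sobolev hp hpn hpq),
    fun q hq => h.solMapsBoundedly_of_riesz hAT (ENNReal.one_le_ofReal.2 (hq1 q hq))
      (h.rieszMapsBoundedly_top hq),
    fun α hα => h.solMapsBoundedly_wSup hAT (hδ α hα),
    fun p hp hpn K hK => h.solMapsLocally_one hAT (ENNReal.one_le_ofReal.2 hp.le)
      (h.rieszMapsBoundedly_one hp.le hpn) hK,
    fun p₀ p₁ hp hpn hpq => h.solMapsLocally_of_riesz hAT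
      (ENNReal.one_le_ofReal.2 (hp.le.trans (h.exponent_pos hp hpn hpq).le))
      (h.rieszMapsBoundedly_sobolev hp hpn hpq),
    fun q hq => h.solMapsLocally_of_riesz hAT le_top (h.rieszMapsBoundedly_top hq),
    h.solMapsLocally_of_riesz hAT le_top h.rieszMapsBoundedly_top_top⟩
  obtain ⟨R, hR, hsum, -⟩ := IsGreenKernel.exists_resolvent φ hφ.diverges hz
  rw [hR]
  exact hsum f
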